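/- Let $n\ge 0$, let $s$ be the $n\times n$ matrix with $1$'s on the antidiagonal and $0$'s elsewhere, $J=\begin{pmatrix}0&s\\-s&0\end{pmatrix}$ and $G=\mathrm{Sp}_{2n}(\mathbb C)=\{X\in \mathrm{GL}_{2n}(\mathbb C)\mid X^tJX=J\}$. Let $B$ be the subgroup of upper-triangular matrices of $G$, and let $\mathfrak n$ be the Lie algebra of its unipotent radical, i.e. the space of strictly upper-triangular $X$ with $X^tJ+JX=0$. The group $B$ acts on the dual space $\mathfrak n^*$ by $\langle g.\lambda,x\rangle=\langle\lambda,g^{-1}xg\rangle$. Let $\Phi^+=\{\epsilon_i\pm\epsilon_j\mid 1\le i<j\le n\}\cup\{2\epsilon_i\mid 1\le i\le n\}\subset\mathbb R^n$ be the set of positive roots of $C_n$, $r_\alpha$ the orthogonal reflection of $\mathbb R^n$ in the hyperplane orthogonal to $\alpha$, and $W$ the Weyl group, generated by all $r_\alpha$, $\alpha\in\Phi^+$. Its fundamental reflections are the $r_\alpha$ with $\alpha\in\{\epsilon_1-\epsilon_2,\dots,\epsilon_{n-1}-\epsilon_n,2\epsilon_n\}$. The Bruhat–Chevalley order $\le_B$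 on $W$ is taken with respect to them: $u\le_B w$ if $u$ is the product of a subword of a reduced expression of $w$. Index rows and columns of $2n\times 2n$ matrices by $1,\dots,n,-n,\dots,-1$ and let $e_{a,b}$ be the matrix units. Then $\mathfrak n$ has the basis $e_\alpha$, $\alpha\in\Phi^+$, where $e_{\epsilon_i-\epsilon_j}=e_{i,j}-e_{-j,-i}$, $e_{\epsilon_i+\epsilon_j}=e_{i,-j}+e_{j,-i}$, $e_{2\epsilon_i}=e_{i,-i}$; let $e_\alpha^*$ be the dual basis of $\mathfrak n^*$. A support of $\sigma\in W$ is a set $D\subseteq\Phi^+$ of pairwise orthogonal roots such that $\sigma=\prod_{\alpha\in D}r_\alpha$ and $\alpha-\beta\notin\Phi^+$ for all $\alpha,\beta\in D$. Let $\sigma,\tau\in W$ satisfy $\sigma^2=\tau^2=1$. Then $\sigma$ and $\tau$ each have exactly one support, denoted $\mathrm{Supp}(\sigma)$ and $\mathrm{Supp}(\tau)$. Let $\Omega_\sigma\subseteq\mathfrak n^*$ be the $B$-orbit of $f_\sigma=\sum_{\alpha\in\mathrm{Supp}(\sigma)}e_\alpha^*$, and similarly $\Omega_\tau$. Then $\Omega_\sigma$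 is contained in the Zariski closure of $\Omega_\tau$ if and only if $\sigma\le_B\tau$. -/

import Mathlib

namespace SpOrbit

open Matrix Module

/-! ### The root system `C_n` and its Weyl group -/

/-- Positive roots of `C_n`: `ε_i - ε_j` and `ε_i + ε_j` for `i < j`, and `2 ε_i`. -/
inductive PosRoot (n : ℕ) : Type
  | sub (i j : Fin n) (h : i < j) : PosRoot n
  | add (i j : Fin n) (h : i < j) : PosRoot n
  | long (i : Fin n) : PosRoot n
  deriving DecidableEq, Fintype

/-- The standard basis vector `ε_i` of `ℝ^n`. -/
noncomputable def eps {n : ℕ} (i : Fin n) : EuclideanSpace ℝ (Fin n) :=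
  EuclideanSpace.single i 1

/-- The positive root as a vector of `ℝ^n`. -/
noncomputable def PosRoot.vec {n : ℕ} : PosRoot n → EuclideanSpace ℝ (Fin n)
  | .sub i j _ => eps i - eps j
  | .add i j _ => eps i + eps j
  | .long i => (2 : ℝ) • eps i

/-- The orthogonal reflection of `ℝ^n` in the hyperplane orthogonal to `α`. -/
noncomputable def PosRoot.reflection {n : ℕ} (α : PosRoot n) :
    EuclideanSpace ℝ (Fin n) ≃ₗᵢ[ℝ] EuclideanSpace ℝ (Fin n) :=
  (ℝ ∙ α.vec)ᗮ.reflection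

/-- The Weyl group of `C_n`: the group of isometries of `ℝ^n` generated by the reflections `r_α`
(note `r_{-α} = r_α`, so positive roots suffice). -/
noncomputable def weylGroup (n : ℕ) :
    Subgroup (EuclideanSpace ℝ (Fin n) ≃ₗᵢ[ℝ] EuclideanSpace ℝ (Fin n)) :=
  Subgroup.closure (Set.range PosRoot.reflection)

/-- The reflection `r_α` as an element of the Weyl group. -/
noncomputable def refl {n : ℕ} (α : PosRoot n) : weylGroup n :=
  ⟨α.reflection, Subgroup.subset_closure ⟨α, rfl⟩⟩

/-- The fundamental roots `ε_1 - ε_2, …, ε_{n-1} - ε_n, 2 ε_n`. -/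
def simpleRoot {n : ℕ} (i : Fin n) : PosRoot n :=
  if h : i.val + 1 < n then .sub i ⟨i.val + 1, h⟩ (Fin.lt_def.2 (Nat.lt_succ_self i.val))
  else .long i

/-- The product of fundamental reflections spelled by a word. -/
noncomputable def wordProd {n : ℕ} (ω : List (Fin n)) : weylGroup n :=
  (ω.map fun i => refl (simpleRoot i)).prod

/-- A word is reduced if no shorter word has the same product. -/
def IsReduced {n : ℕ} (ω : List (Fin n)) : Prop :=
  ∀ ω' : List (Fin n), wordProd ω' = wordProd ω → ω.length ≤ ω'.length

/-- The Bruhat–Chevalley order: `u ≤ w` if `u` is the product of a subword of a reduced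
expression of `w`. -/
def BruhatLE {n : ℕ} (u w : weylGroup n) : Prop :=
  ∃ ω : List (Fin n), IsReduced ω ∧ wordProd ω = w ∧
    ∃ ω' : List (Fin n), ω'.Sublist ω ∧ wordProd ω' = u

/-- `D` is a support of `σ`: its roots are pairwise orthogonal, no difference of two of them is
a positive root, and `σ` is the product of the reflections `r_α`, `α ∈ D` (these commute, so the
order chosen by `Finset.toList` is irrelevant). -/
structure IsSupport {n : ℕ} (σ : weylGroup n) (D : Finset (PosRoot n)) : Prop where
  orthogonal : ∀ α ∈ D, ∀ β ∈ D, α ≠ β → inner ℝ α.vec β.vec = 0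
  sub_ne : ∀ α ∈ D, ∀ β ∈ D, ∀ γ : PosRoot n, α.vec - β.vec ≠ γ.vec
  prod_eq : (D.toList.map refl).prod = σ

open Classical in
/-- The support of an involution. -/
noncomputable def supp {n : ℕ} (σ : weylGroup n) : Finset (PosRoot n) :=
  if h : ∃ D, IsSupport σ D then h.choose else ∅

/-! ### The symplectic group, its Borel subgroup, and the nilradical

Rows and columns are indexed by `Fin (2 * n)`, in the order `1, …, n, -n, …, -1`, so that
`i ↦ -i` is `Fin.rev`. -/

/-- The index `i`. -/
def pos {n : ℕ} (i : Fin n) : Fin (2 * n) := Fin.castLE (by omega) i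

/-- The index `-i`. -/
def neg {n : ℕ} (i : Fin n) : Fin (2 * n) := (pos i).rev

/-- Complex `2n × 2n` matrices. -/
abbrev Mat (n : ℕ) : Type := Matrix (Fin (2 * n)) (Fin (2 * n)) ℂ

/-- The matrix `J = [[0, s], [-s, 0]]`, where `s` has ones on the antidiagonal. -/
def J (n : ℕ) : Mat n :=
  Matrix.of fun a b => if b = a.rev then (if a.val < n then 1 else -1) else 0

/-- `Sp_{2n}(ℂ)`. -/
def Sp (n : ℕ) : Subgroup (GL (Fin (2 * n)) ℂ) where
  carrier := {g | (g : Mat n)ᵀ * J n * (g : Mat n) = J n}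
  one_mem' := by simp
  mul_mem' := by
    intro a b ha hb
    simp only [Set.mem_ofPred_eq, Units.val_mul, Matrix.transpose_mul] at *
    calc _ = (b : Mat n)ᵀ * ((a : Mat n)ᵀ * J n * (a : Mat n)) *
          (b : Mat n) := by simp only [Matrix.mul_assoc]
      _ = _ := by rw [ha, hb]
  inv_mem' := by
    intro a ha
    simp only [Set.mem_ofPred_eq] at *
    have h1 : (a : Mat n) * ((a⁻¹ : GL (Fin (2 * n)) ℂ) : Mat n) = 1 := a.mul_inv
    have h2 : ((a⁻¹ : GL (Fin (2 * n)) ℂ) : Mat n)ᵀ * (a : Mat n)ᵀ = 1 := by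
      rw [← Matrix.transpose_mul, h1, Matrix.transpose_one]
    calc _ = ((a⁻¹ : GL (Fin (2 * n)) ℂ) : Mat n)ᵀ * ((a : Mat n)ᵀ * J n * (a : Mat n)) *
          ((a⁻¹ : GL (Fin (2 * n)) ℂ) : Mat n) := by rw [ha]
      _ = (((a⁻¹ : GL (Fin (2 * n)) ℂ) : Mat n)ᵀ * (a : Mat n)ᵀ) * J n *
          ((a : Mat n) * ((a⁻¹ : GL (Fin (2 * n)) ℂ) : Mat n)) := by
            simp only [Matrix.mul_assoc]
      _ = _ := by rw [h1, h2, Matrix.one_mul, Matrix.mul_one]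

/-- The Borel subgroup of upper-triangular matrices in `Sp_{2n}(ℂ)`. -/
def borel (n : ℕ) : Subgroup (GL (Fin (2 * n)) ℂ) where
  carrier := {g | g ∈ Sp n ∧ ∀ a b : Fin (2 * n), b < a → (g : Mat n) a b = 0}
  one_mem' := ⟨one_mem _, fun a b h => by simp [Matrix.one_apply_ne h.ne']⟩
  mul_mem' := by
    rintro x y ⟨hx, hx'⟩ ⟨hy, hy'⟩
    refine ⟨mul_mem hx hy, ?_⟩
    have h1 : BlockTriangular (x : Mat n) id := fun a b h => hx' a b h
    have h2 : BlockTriangular (y : Mat n) id := fun a b h => hy' a b h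
    exact fun a b h => by simpa using h1.mul h2 h
  inv_mem' := by
    rintro x ⟨hx, hx'⟩
    refine ⟨inv_mem hx, ?_⟩
    have h1 : BlockTriangular (x : Mat n) id := fun a b h => hx' a b h
    have : Invertible (x : Mat n) := x.invertible
    intro a b h
    have := blockTriangular_inv_of_blockTriangular h1
    rw [Matrix.coe_units_inv]
    exact this h

/-- The Lie algebra `𝔫` of the unipotent radical of the Borel subgroup: the strictly
upper-triangular matrices `X` with `Xᵀ J + J X = 0`. -/
def nil (n : ℕ) : Submodule ℂ (Mat n) where
  carrier := {X | Xᵀ * J n + J n * X = 0 ∧ ∀ a b : Fin (2 * n), b ≤ a → X a b = 0}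
  zero_mem' := by simp
  add_mem' := by
    rintro X Y ⟨hX, hX'⟩ ⟨hY, hY'⟩
    refine ⟨?_, fun a b h => by simp [hX' a b h, hY' a b h]⟩
    rw [Matrix.transpose_add, Matrix.add_mul, Matrix.mul_add, add_add_add_comm, hX, hY, add_zero]
  smul_mem' := by
    rintro c X ⟨hX, hX'⟩
    refine ⟨?_, fun a b h => by simp [hX' a b h]⟩
    rw [Matrix.transpose_smul, Matrix.smul_mul, Matrix.mul_smul, ← smul_add, hX, smul_zero]

theorem strict_mul_left {m : ℕ} {X Y : Matrix (Fin m) (Fin m) ℂ}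
    (hX : ∀ a b, b < a → X a b = 0) (hY : ∀ a b, b ≤ a → Y a b = 0) :
    ∀ a b, b ≤ a → (X * Y) a b = 0 := by
  intro a b h
  rw [Matrix.mul_apply]
  refine Finset.sum_eq_zero fun c _ => ?_
  rcases lt_or_ge c a with hc | hc
  · rw [hX a c hc, zero_mul]
  · rw [hY c b (h.trans hc), mul_zero]

theorem strict_mul_right {m : ℕ} {X Y : Matrix (Fin m) (Fin m) ℂ}
    (hX : ∀ a b, b ≤ a → X a b = 0) (hY : ∀ a b, b < a → Y a b = 0) :
    ∀ a b, b ≤ a → (X * Y) a b = 0 := by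
  intro a b h
  rw [Matrix.mul_apply]
  refine Finset.sum_eq_zero fun c _ => ?_
  rcases le_or_gt c a with hc | hc
  · rw [hX a c hc, zero_mul]
  · rw [hY c b (h.trans_lt hc), mul_zero]

theorem conj_mem_nil {n : ℕ} {g : GL (Fin (2 * n)) ℂ} (hg : g ∈ borel n)
    {X : Mat n} (hX : X ∈ nil n) :
    (g : Mat n) * X * ((g⁻¹ : GL (Fin (2 * n)) ℂ) : Mat n) ∈ nil n := by
  have hg' := inv_mem hg
  refine ⟨?_, strict_mul_right (strict_mul_left hg.2 hX.2) hg'.2⟩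
  have h1 : ((g⁻¹ : GL (Fin (2 * n)) ℂ) : Mat n) * (g : Mat n) = 1 := g.inv_mul
  have h2 : (g : Mat n)ᵀ * ((g⁻¹ : GL (Fin (2 * n)) ℂ) : Mat n)ᵀ = 1 := by
    rw [← Matrix.transpose_mul, h1, Matrix.transpose_one]
  have e : J n = ((g⁻¹ : GL (Fin (2 * n)) ℂ) : Mat n)ᵀ * J n * ((g⁻¹ : GL (Fin (2 * n)) ℂ) : Mat n) :=
    hg'.1.symm
  calc _ = ((g⁻¹ : GL (Fin (2 * n)) ℂ) : Mat n)ᵀ * (Xᵀ * ((g : Mat n)ᵀ *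
            ((g⁻¹ : GL (Fin (2 * n)) ℂ) : Mat n)ᵀ) * J n) * ((g⁻¹ : GL (Fin (2 * n)) ℂ) : Mat n) +
          ((g⁻¹ : GL (Fin (2 * n)) ℂ) : Mat n)ᵀ * (J n * (((g⁻¹ : GL (Fin (2 * n)) ℂ) : Mat n) *
            (g : Mat n)) * X) * ((g⁻¹ : GL (Fin (2 * n)) ℂ) : Mat n) := by
        nth_rewrite 1 [e]
        nth_rewrite 2 [e]
        simp only [Matrix.transpose_mul, Matrix.mul_assoc]
    _ = ((g⁻¹ : GL (Fin (2 * n)) ℂ) : Mat n)ᵀ * (Xᵀ * J n + J n * X) *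
          ((g⁻¹ : GL (Fin (2 * n)) ℂ) : Mat n) := by
        rw [h1, h2, Matrix.mul_one, Matrix.mul_one, Matrix.mul_add, Matrix.add_mul]
    _ = 0 := by rw [hX.1, Matrix.mul_zero, Matrix.zero_mul]

/-- The adjoint action of the Borel subgroup on `𝔫`: `Ad_g x = g x g⁻¹`. -/
def Ad (n : ℕ) : Representation ℂ (borel n) (nil n) where
  toFun g :=
    { toFun := fun X => ⟨_, conj_mem_nil g.2 X.2⟩
      map_add' := fun X Y => Subtype.ext (by simp [Matrix.mul_add, Matrix.add_mul])
      map_smul' := fun c X => Subtype.ext (by simp) }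
  map_one' := by ext X : 2; simp
  map_mul' g h := by ext X : 2; simp [Matrix.mul_assoc]

/-- The coadjoint action of the Borel subgroup on `𝔫*`: `⟨g.l, x⟩ = ⟨l, Ad_g⁻¹ x⟩`. -/
abbrev coAd (n : ℕ) : Representation ℂ (borel n) (Dual ℂ (nil n)) := (Ad n).dual

/-! ### Root vectors and the dual basis -/

/-- The root vector `e_α` as a matrix. -/
def rootMatrix {n : ℕ} : PosRoot n → Mat n
  | .sub i j _ => Matrix.single (pos i) (pos j) 1 - Matrix.single (neg j) (neg i) 1
  | .add i j _ => Matrix.single (pos i) (neg j) 1 + Matrix.single (pos j) (neg i) 1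
  | .long i => Matrix.single (pos i) (neg i) 1

/-- The position of the entry that reads off the coefficient of `e_α`. -/
def entry {n : ℕ} : PosRoot n → Fin (2 * n) × Fin (2 * n)
  | .sub i j _ => (pos i, pos j)
  | .add i j _ => (pos i, neg j)
  | .long i => (pos i, neg i)

theorem symp_iff {n : ℕ} (X : Mat n) :
    Xᵀ * J n + J n * X = 0 ↔ ∀ a b : Fin (2 * n),
      X b a * (if b.val < n then 1 else -1) + (if a.val < n then 1 else -1) * X a.rev b.rev = 0 := by
  have key : ∀ a b : Fin (2 * n), (Xᵀ * J n + J n * X) a b.rev =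
      X b a * (if b.val < n then 1 else -1) +
        (if a.val < n then 1 else -1) * X a.rev b.rev := by
    intro a b
    simp [Matrix.add_apply, Matrix.mul_apply, J, Fin.rev_inj]
  constructor
  · intro h a b
    rw [← key, h, Matrix.zero_apply]
  · intro h
    ext a b
    have := key a b.rev
    rw [Fin.rev_rev] at this
    rw [this]
    simpa using h a b.rev

theorem rootMatrix_mem {n : ℕ} (α : PosRoot n) : rootMatrix α ∈ nil n := by
  constructor
  · rw [symp_iff]
    intro a b
    have ha := a.isLt
    have hb := b.isLt
    rcases α with ⟨i, j, h⟩ | ⟨i, j, h⟩ | i <;>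
      simp only [rootMatrix, Matrix.add_apply, Matrix.sub_apply, Matrix.single_apply, pos, neg,
        Fin.ext_iff, Fin.val_rev, Fin.val_castLE] <;>
      grind
  · intro a b hab
    have ha := a.isLt
    have hb := b.isLt
    rw [Fin.le_def] at hab
    rcases α with ⟨i, j, h⟩ | ⟨i, j, h⟩ | i <;>
      simp only [rootMatrix, Matrix.add_apply, Matrix.sub_apply, Matrix.single_apply, pos, neg,
        Fin.ext_iff, Fin.val_rev, Fin.val_castLE] <;>
      grind

/-- The root vector `e_α` of `𝔫`. -/
def rootVec {n : ℕ} (α : PosRoot n) : nil n := ⟨rootMatrix α, rootMatrix_mem α⟩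

theorem rootMatrix_entry {n : ℕ} (α β : PosRoot n) :
    rootMatrix α (entry β).1 (entry β).2 = if α = β then 1 else 0 := by
  rcases α with ⟨i, j, h⟩ | ⟨i, j, h⟩ | i <;> rcases β with ⟨k, l, h'⟩ | ⟨k, l, h'⟩ | k <;>
    simp only [rootMatrix, entry, Matrix.add_apply, Matrix.sub_apply, Matrix.single_apply, pos, neg,
      Fin.ext_iff, Fin.val_rev, Fin.val_castLE, PosRoot.sub.injEq, PosRoot.add.injEq,
      PosRoot.long.injEq, reduceCtorEq] <;>
    grind

theorem eq_zero_of_entry {n : ℕ} {X : Mat n} (hX : X ∈ nil n)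
    (h : ∀ α : PosRoot n, X (entry α).1 (entry α).2 = 0) : X = 0 := by
  have hs := (symp_iff X).1 hX.1
  have low : ∀ a b : Fin (2 * n), b ≤ a → X a b = 0 := hX.2
  have refl0 : ∀ a b : Fin (2 * n), X a b = 0 → X b.rev a.rev = 0 := by
    intro a b h0
    have := hs b a
    rw [h0, zero_mul, zero_add] at this
    split_ifs at this <;> simpa using this
  have half : ∀ a b : Fin (2 * n), a.val + b.val + 1 ≤ 2 * n → X a b = 0 := by
    intro a b hab
    rcases le_or_gt b a with hba | hba
    · exact low a b hba
    have hba' := Fin.lt_def.1 hba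
    have ha : a.val < n := by omega
    have hpa : pos ⟨a.val, ha⟩ = a := rfl
    rcases lt_or_ge b.val n with hb | hb
    · have := h (.sub ⟨a.val, ha⟩ ⟨b.val, hb⟩ hba)
      exact this
    · have hb2 := b.isLt
      have hb' : b.rev.val < n := by rw [Fin.val_rev]; omega
      have hnb : neg ⟨b.rev.val, hb'⟩ = b := by
        apply Fin.ext
        simp only [neg, pos, Fin.val_rev, Fin.val_castLE]
        omega
      rcases Nat.lt_or_ge a.val b.rev.val with h1 | h1
      · have := h (.add ⟨a.val, ha⟩ ⟨b.rev.val, hb'⟩ h1)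
        simpa only [entry, hnb, hpa] using this
      · have e : b.rev.val = a.val := by rw [Fin.val_rev] at h1 ⊢; omega
        have := h (.long ⟨a.val, ha⟩)
        have hn2 : neg ⟨a.val, ha⟩ = b := by rw [← hnb]; congr 1; exact Fin.ext e.symm
        simpa only [entry, hn2, hpa] using this
  ext a b
  rcases Nat.lt_or_ge (2 * n) (a.val + b.val + 1) with hab | hab
  · have h0 := half b.rev a.rev (by simp only [Fin.val_rev]; omega)
    simpa using refl0 _ _ h0
  · exact half a b hab

theorem sum_entry {n : ℕ} (c : PosRoot n → ℂ) (β : PosRoot n) :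
    (∑ α, c α • rootVec α : nil n).1 (entry β).1 (entry β).2 = c β := by
  simp [Matrix.sum_apply, rootVec, rootMatrix_entry]

/-- The basis `e_α` of `𝔫`. -/
noncomputable def rootBasis (n : ℕ) : Basis (PosRoot n) ℂ (nil n) :=
  Basis.mk (v := rootVec)
    (by
      rw [Fintype.linearIndependent_iff]
      intro c hc β
      rw [← sum_entry c β, hc]
      rfl)
    (by
      intro X _
      have : X = ∑ α, X.1 (entry α).1 (entry α).2 • rootVec α := by
        rw [← sub_eq_zero]
        refine Subtype.ext (eq_zero_of_entry (Subtype.prop _) fun β => ?_)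
        rw [Submodule.coe_sub, Matrix.sub_apply, sum_entry, sub_self]
      rw [this]
      exact Submodule.sum_mem _ fun α _ =>
        Submodule.smul_mem _ _ (Submodule.subset_span ⟨α, rfl⟩))

/-- The linear form `f_D`, the sum over `α ∈ D` of the elements `e_α*` of the dual basis. -/
noncomputable def form {n : ℕ} (D : Finset (PosRoot n)) : Dual ℂ (nil n) :=
  ∑ α ∈ D, (rootBasis n).coord α

/-- The orbit `Ω_σ` of `f_{Supp σ}` under the coadjoint action of the Borel subgroup. -/
noncomputable def orbit {n : ℕ} (σ : weylGroup n) : Set (Dual ℂ (nil n)) :=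
  Set.range fun g : borel n => coAd n g (form (supp σ))

/-- Coordinates on `𝔫*`: the values on the root vectors. -/
noncomputable def coords {n : ℕ} (l : Dual ℂ (nil n)) : PosRoot n → ℂ :=
  fun α => l (rootVec α)

/-- The Zariski closure of a subset of the affine space `𝔫*`: the common zeros of all polynomial
functions that vanish on the subset. -/
def zariskiClosure {n : ℕ} (S : Set (Dual ℂ (nil n))) : Set (Dual ℂ (nil n)) :=
  coords ⁻¹' MvPolynomial.zeroLocus ℂ (MvPolynomial.vanishingIdeal ℂ (coords '' S))

end SpOrbit

/-! Since `(Q + Qᵀ) * J n` runs through the symplectic Lie algebra, a linear form on `𝔫` is the same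
as a symmetric matrix supported at the positions `(x, y)` with `x < -y`. Under this dictionary the
coadjoint action is congruence `S ↦ gᵀ S g`, truncated to those positions (`toSym_coAd`). View `W`
as the permutations of `±1, …, ±n` commuting with negation. Then `f_σ` becomes a matrix of type `σ`
(`IsType`), with nonzero entries exactly at the positions `(x, -σ x)`, `x < σ x`. Supports exist and
are unique because their conditions force the roots to use disjoint indices, so that a support just
lists the nontrivial cycles of `σ` up to negation.

On the combinatorial side, `bruhatLE_iff` turns the Bruhat order into the comparison of rank
functions `rk`, so that it is induced from the symmetric group. This rests on the lifting property
for simple reflections, which is arithmetic with three consecutive rows of `rk` (`rk_row`).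

Closure implies order (`IsType.rkLE_of_inCl`): congruence by upper-triangular matrices does not
raise the rank of a corner (rows below `i`, columns `y` with `k ≤ -y`). For type `τ` this rank is at
most `rk τ i k`, and a suitable minor witnesses the rank for type `σ`. Corners with `i ≤ k` lie
within the visible positions, and for involutions these corners suffice.

Order implies closure (`IsType.inCl_of_rkLE`): induction on `τ`. Let `i` be the last descent of `τ`
and `P` the corresponding minimal parabolic. The closure of the orbit of `τ` is the full preimage of
a `P`-stable set of linear forms on the nilradical of `P` (`IsType.inCl_parab`). Indeed the entry at
the simple root is free in this closure (`IsType.inCl_of_cut_eq`), the negative simple root subgroup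
acts on a matrix of type `τ`, up to that entry, like Borel elements (`IsType.saturated_rootElt`),
and the big cell is dense in `P`. If `i` is a descent of `σ`, matrices of types `lower i σ` and `σ`
are `P`-congruent up to that entry (`IsType.raise`). Lifting gives `lower i σ ≤ lower i τ` or `σ ≤
lower i τ`, so the induction hypothesis for `lower i τ`, followed by raising where needed, reaches
`σ`. -/

namespace SpOrbit

open Matrix Module

open Equiv (Perm)

/-! ### Signed permutations and their rank functions -/

/-- The number of `a < i` with `k ≤ π a`. -/
def rk {N : ℕ} (π : Perm (Fin N)) (i k : ℕ) : ℕ :=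
  (Finset.univ.filter fun a : Fin N => a.val < i ∧ k ≤ (π a).val).card

/-- The comparison of rank functions (the Bruhat order of the symmetric group). -/
def RkLE {N : ℕ} (σ τ : Perm (Fin N)) : Prop := ∀ i k, rk σ i k ≤ rk τ i k

theorem perm_inv_apply {α : Type*} (π : Perm α) (a : α) : π⁻¹ (π a) = a := π.symm_apply_apply a

theorem perm_apply_inv {α : Type*} (π : Perm α) (a : α) : π (π⁻¹ a) = a := π.apply_symm_apply a

theorem rk_succ {N : ℕ} (π : Perm (Fin N)) (a : Fin N) (k : ℕ) :
    rk π (a.val + 1) k = rk π a.val k + if k ≤ (π a).val then 1 else 0 := by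
  unfold rk
  split_ifs with h
  · rw [← Finset.card_insert_of_notMem (a := a) (by simp)]
    congr 1
    ext b
    simp only [Finset.mem_filter, Finset.mem_univ, true_and, Finset.mem_insert]
    constructor
    · rintro ⟨h1, h2⟩
      rcases Nat.lt_succ_iff_lt_or_eq.1 h1 with h3 | h3
      · exact Or.inr ⟨h3, h2⟩
      · exact Or.inl (Fin.ext h3)
    · rintro (rfl | ⟨h1, h2⟩)
      · exact ⟨Nat.lt_succ_self _, h⟩
      · exact ⟨by omega, h2⟩
  · rw [add_zero]
    congr 1
    ext b
    simp only [Finset.mem_filter, Finset.mem_univ, true_and]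
    constructor
    · rintro ⟨h1, h2⟩
      refine ⟨?_, h2⟩
      rcases Nat.lt_succ_iff_lt_or_eq.1 h1 with h3 | h3
      · exact h3
      · rw [Fin.ext h3] at h2
        exact absurd h2 h
    · rintro ⟨h1, h2⟩
      exact ⟨by omega, h2⟩

theorem rk_eq_of_ge {N : ℕ} (π : Perm (Fin N)) {i : ℕ} (hi : N ≤ i) (k : ℕ) :
    rk π i k = rk π N k := by
  unfold rk
  congr 1
  ext b
  have := b.isLt
  simp only [Finset.mem_filter, Finset.mem_univ, true_and]
  constructor <;> rintro ⟨_, h⟩ <;> exact ⟨by omega, h⟩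

theorem rk_eq_zero_of_ge {N : ℕ} (π : Perm (Fin N)) (i : ℕ) {k : ℕ} (hk : N ≤ k) :
    rk π i k = 0 := by
  unfold rk
  rw [Finset.card_eq_zero, Finset.filter_eq_empty_iff]
  rintro b - ⟨_, h⟩
  have := (π b).isLt
  omega

theorem card_lt {N i : ℕ} (hi : i ≤ N) :
    (Finset.univ.filter fun a : Fin N => a.val < i).card = i := by
  rw [Fin.card_filter_val_lt]
  omega

/-- Both `i - rk π⁻¹ i k` and `k - rk π k i` count the `a < k` with `π a < i`. -/
theorem rk_inv {N : ℕ} (π : Perm (Fin N)) {i k : ℕ} (hi : i ≤ N) (hk : k ≤ N) :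
    rk π⁻¹ i k + k = rk π k i + i := by
  have h1 : rk π⁻¹ i k + (Finset.univ.filter fun a : Fin N => a.val < k ∧ (π a).val < i).card
      = i := by
    conv_rhs => rw [← card_lt hi]
    rw [← Finset.card_filter_add_card_filter_not (s := Finset.univ.filter
      fun a : Fin N => a.val < i) (p := fun a => k ≤ (π⁻¹ a).val), Finset.filter_filter,
      Finset.filter_filter]
    unfold rk
    congr 1
    refine Finset.card_bij (fun a _ => π a) ?_ (fun a _ b _ h => π.injective h) ?_
    · intro a
      simp only [Finset.mem_filter, Finset.mem_univ, true_and, perm_inv_apply]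
      omega
    · intro b hb
      refine ⟨π⁻¹ b, ?_, by simp⟩
      simp only [Finset.mem_filter, Finset.mem_univ, true_and, perm_apply_inv] at hb ⊢
      omega
  have h2 : rk π k i + (Finset.univ.filter fun a : Fin N => a.val < k ∧ (π a).val < i).card
      = k := by
    conv_rhs => rw [← card_lt hk]
    rw [← Finset.card_filter_add_card_filter_not (s := Finset.univ.filter
      fun a : Fin N => a.val < k) (p := fun a => i ≤ (π a).val), Finset.filter_filter,
      Finset.filter_filter]
    simp only [not_le]
    rfl
  omega

theorem RkLE.of_le {N : ℕ} {σ τ : Perm (Fin N)}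
    (h : ∀ i k, i ≤ N → k ≤ N → rk σ i k ≤ rk τ i k) : RkLE σ τ := by
  intro i k
  rcases le_total N k with hk | hk
  · rw [rk_eq_zero_of_ge σ i hk]
    exact Nat.zero_le _
  · rcases le_total N i with hi | hi
    · rw [rk_eq_of_ge σ hi, rk_eq_of_ge τ hi]
      exact h _ _ le_rfl hk
    · exact h i k hi hk

theorem RkLE.inv {N : ℕ} {σ τ : Perm (Fin N)} (h : RkLE σ τ) : RkLE σ⁻¹ τ⁻¹ := by
  refine RkLE.of_le fun i k hi hk => ?_
  have h1 := rk_inv σ hi hk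
  have h2 := rk_inv τ hi hk
  have h3 := h k i
  omega

theorem RkLE.trans {N : ℕ} {σ τ ρ : Perm (Fin N)} (h : RkLE σ τ) (h' : RkLE τ ρ) : RkLE σ ρ :=
  fun i k => (h i k).trans (h' i k)

/-- For involutions it suffices to compare the ranks at positions weakly above the diagonal. -/
theorem RkLE.of_involutive {N : ℕ} {σ τ : Perm (Fin N)} (hσ : σ⁻¹ = σ) (hτ : τ⁻¹ = τ)
    (h : ∀ i k, i ≤ k → k ≤ N → rk σ i k ≤ rk τ i k) : RkLE σ τ := by
  refine RkLE.of_le fun i k hi hk => ?_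
  rcases le_total i k with hik | hik
  · exact h i k hik hk
  · have h1 := rk_inv σ hi hk
    have h2 := rk_inv τ hi hk
    have h3 := h k i hik hi
    rw [hσ] at h1
    rw [hτ] at h2
    omega

theorem perm_eq_one_of_le {N : ℕ} (π : Perm (Fin N)) (h : ∀ a, π a ≤ a) : π = 1 := by
  have key : ∀ m : ℕ, ∀ a : Fin N, a.val = m → π a = a := by
    intro m
    induction m using Nat.strong_induction_on with
    | _ m ih =>
      intro a ha
      rcases (h a).lt_or_eq with h1 | h1
      · have h2 := ih (π a).val (by rw [← ha]; exact h1) (π a) rfl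
        exact absurd (π.injective h2) h1.ne
      · exact h1
  ext a
  rw [key a.val a rfl]
  rfl

theorem RkLE.eq_one {N : ℕ} {σ : Perm (Fin N)} (h : RkLE σ 1) : σ = 1 := by
  refine perm_eq_one_of_le σ fun a => ?_
  by_contra hlt
  rw [not_le, Fin.lt_def] at hlt
  have h1 : rk (1 : Perm (Fin N)) (a.val + 1) (a.val + 1) = 0 := by
    unfold rk
    rw [Finset.card_eq_zero, Finset.filter_eq_empty_iff]
    rintro b - ⟨h1, h2⟩
    rw [Equiv.Perm.one_apply] at h2
    omega
  have h2 := rk_succ σ a (a.val + 1)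
  rw [if_pos (by omega)] at h2
  have := h (a.val + 1) (a.val + 1)
  omega

theorem perm_eq_one_of_adjacent {N : ℕ} (π : Perm (Fin N))
    (h : ∀ a b : Fin N, b.val = a.val + 1 → π a < π b) : π = 1 := by
  have hm : ∀ d : ℕ, ∀ a b : Fin N, b.val = a.val + d + 1 → π a < π b := by
    intro d
    induction d with
    | zero => intro a b hab; exact h a b hab
    | succ d ih =>
      intro a b hab
      have := b.isLt
      exact (ih a ⟨a.val + d + 1, by omega⟩ rfl).trans (h _ _ (by simp only; omega))
  have hmono : StrictMono π := fun a b hab =>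
    hm (b.val - a.val - 1) a b (by have := Fin.lt_def.1 hab; omega)
  have hinv : ∀ a, π⁻¹ a ≤ a := fun a => by
    have := hmono.id_le (π⁻¹ a)
    simpa using this
  rw [← inv_inv π, perm_eq_one_of_le _ hinv, inv_one]

/-- The permutation of `±1, …, ±n` induced by the reflection in `ε_x - ε_z`. -/
def pairRefl {N : ℕ} (x z : Fin N) : Perm (Fin N) :=
  if z = x.rev then Equiv.swap x z else Equiv.swap x z * Equiv.swap x.rev z.rev

theorem rev_ne {n : ℕ} (x : Fin (2 * n)) : x.rev ≠ x := by
  intro h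
  have := congrArg Fin.val h
  rw [Fin.val_rev] at this
  omega

theorem pairRefl_apply {n : ℕ} {x z : Fin (2 * n)} (hxz : x ≠ z) (a : Fin (2 * n)) :
    pairRefl x z a = if a = x then z else if a = z then x else if a = x.rev then z.rev
      else if a = z.rev then x.rev else a := by
  have h1 := rev_ne x
  have h2 := rev_ne z
  unfold pairRefl
  split_ifs with h h3 h3 h3 h3 h3 h3 h3 h3 <;>
    simp only [Equiv.Perm.mul_apply, Equiv.swap_apply_def] <;>
    grind [Fin.rev_rev, Fin.rev_inj]

/-- Permutations commuting with `a ↦ -a`. -/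
def RevComm {N : ℕ} (π : Perm (Fin N)) : Prop := ∀ a, π a.rev = (π a).rev

theorem RevComm.mul {N : ℕ} {π ρ : Perm (Fin N)} (h : RevComm π) (h' : RevComm ρ) :
    RevComm (π * ρ) := fun a => by
  rw [Equiv.Perm.mul_apply, Equiv.Perm.mul_apply, h', h]

theorem RevComm.one {N : ℕ} : RevComm (1 : Perm (Fin N)) := fun _ => rfl

theorem RevComm.inv {N : ℕ} {π : Perm (Fin N)} (h : RevComm π) : RevComm π⁻¹ := fun a => by
  rw [Equiv.Perm.inv_eq_iff_eq, h, perm_apply_inv]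

theorem pairRefl_revComm {n : ℕ} {x z : Fin (2 * n)} (hxz : x ≠ z) :
    RevComm (pairRefl x z) := by
  intro a
  have h1 := rev_ne x
  have h2 := rev_ne z
  rw [pairRefl_apply hxz, pairRefl_apply hxz]
  grind [Fin.rev_rev, Fin.rev_inj]

theorem pairRefl_mul_self {n : ℕ} {x z : Fin (2 * n)} (hxz : x ≠ z) :
    pairRefl x z * pairRefl x z = 1 := by
  ext a
  have h1 := rev_ne x
  have h2 := rev_ne z
  rw [Equiv.Perm.mul_apply, pairRefl_apply hxz, pairRefl_apply hxz]
  grind [Fin.rev_rev, Fin.rev_inj, Equiv.Perm.one_apply]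

/-- The successor of the index `i`. -/
def nxt {n : ℕ} (i : Fin n) : Fin (2 * n) := ⟨i.val + 1, by omega⟩

theorem val_pos {n : ℕ} (i : Fin n) : (pos i).val = i.val := rfl

theorem val_nxt {n : ℕ} (i : Fin n) : (nxt i).val = i.val + 1 := rfl

theorem pos_ne_nxt {n : ℕ} (i : Fin n) : pos i ≠ nxt i := by
  intro h
  have := congrArg Fin.val h
  rw [val_pos, val_nxt] at this
  omega

/-- The permutation of `±1, …, ±n` induced by the `i`-th fundamental reflection. -/
def simplePerm {n : ℕ} (i : Fin n) : Perm (Fin (2 * n)) := pairRefl (pos i) (nxt i)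

theorem simplePerm_apply {n : ℕ} (i : Fin n) (a : Fin (2 * n)) :
    simplePerm i a = if a = pos i then nxt i else if a = nxt i then pos i else
      if a = (pos i).rev then (nxt i).rev else if a = (nxt i).rev then (pos i).rev else a :=
  pairRefl_apply (pos_ne_nxt i) a

theorem simplePerm_revComm {n : ℕ} (i : Fin n) : RevComm (simplePerm i) :=
  pairRefl_revComm (pos_ne_nxt i)

theorem simplePerm_mul_self {n : ℕ} (i : Fin n) : simplePerm i * simplePerm i = 1 :=
  pairRefl_mul_self (pos_ne_nxt i)

theorem simplePerm_inv {n : ℕ} (i : Fin n) : (simplePerm i)⁻¹ = simplePerm i :=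
  inv_eq_of_mul_eq_one_left (simplePerm_mul_self i)

theorem simplePerm_pos {n : ℕ} (i : Fin n) : simplePerm i (pos i) = nxt i := by
  rw [simplePerm_apply, if_pos rfl]

theorem simplePerm_nxt {n : ℕ} (i : Fin n) : simplePerm i (nxt i) = pos i := by
  rw [simplePerm_apply, if_neg (pos_ne_nxt i).symm, if_pos rfl]

theorem simplePerm_simplePerm {n : ℕ} (i : Fin n) (a : Fin (2 * n)) :
    simplePerm i (simplePerm i a) = a := by
  rw [← Equiv.Perm.mul_apply, simplePerm_mul_self, Equiv.Perm.one_apply]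

theorem simplePerm_val {n : ℕ} (i : Fin n) (a : Fin (2 * n)) :
    (simplePerm i a).val = if a.val = i.val then i.val + 1 else if a.val = i.val + 1 then i.val else
      if a.val + i.val + 1 = 2 * n then 2 * n - 2 - i.val else
      if a.val + i.val + 2 = 2 * n then 2 * n - 1 - i.val else a.val := by
  rw [simplePerm_apply]
  simp only [Fin.ext_iff, Fin.val_rev, val_pos, val_nxt, apply_ite Fin.val]
  have := a.isLt
  have := i.isLt
  split_ifs <;> omega

/-- `π` has a right descent at `i`. -/
def Desc {n : ℕ} (π : Perm (Fin (2 * n))) (i : Fin n) : Prop := π (nxt i) < π (pos i)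

theorem not_desc_iff {n : ℕ} (π : Perm (Fin (2 * n))) (i : Fin n) :
    ¬ Desc π i ↔ π (pos i) < π (nxt i) := by
  unfold Desc
  rw [not_lt, le_iff_lt_or_eq, or_iff_left]
  exact fun h => pos_ne_nxt i (π.injective h)

theorem desc_mul {n : ℕ} (π : Perm (Fin (2 * n))) (i : Fin n) :
    Desc (π * simplePerm i) i ↔ ¬ Desc π i := by
  rw [not_desc_iff]
  unfold Desc
  rw [Equiv.Perm.mul_apply, Equiv.Perm.mul_apply, simplePerm_pos, simplePerm_nxt]

theorem mul_mul_simplePerm {n : ℕ} (π : Perm (Fin (2 * n))) (i : Fin n) :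
    π * simplePerm i * simplePerm i = π := by
  rw [mul_assoc, simplePerm_mul_self, mul_one]

/-- The rows of the rank function changed by the `i`-th fundamental reflection. -/
def IsRow {n : ℕ} (i : Fin n) (j : ℕ) : Prop := j = i.val + 1 ∨ j = 2 * n - 1 - i.val

theorem IsRow.not_pred {n : ℕ} {i : Fin n} {j : ℕ} (h : IsRow i j) : ¬ IsRow i (j - 1) := by
  unfold IsRow at *
  omega

theorem IsRow.not_succ {n : ℕ} {i : Fin n} {j : ℕ} (h : IsRow i j) : ¬ IsRow i (j + 1) := by
  unfold IsRow at *
  omega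

/-- The set of positions below `j` is stable under the simple permutation unless `j` separates two
swapped neighbours, which happens precisely in the rows `IsRow`. -/
theorem rk_mul_simplePerm {n : ℕ} (π : Perm (Fin (2 * n))) (i : Fin n) {j : ℕ} (hj : ¬ IsRow i j)
    (k : ℕ) : rk (π * simplePerm i) j k = rk π j k := by
  have hi := i.isLt
  unfold IsRow at hj
  have hlt : ∀ a : Fin (2 * n), a.val < j → (simplePerm i a).val < j := by
    intro a h1
    have := a.isLt
    rw [simplePerm_val]
    split_ifs <;> omega
  unfold rk
  refine Finset.card_bij (fun a _ => simplePerm i a) ?_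
    (fun a _ b _ h => (simplePerm i).injective h) ?_
  · intro a ha
    have h := (Finset.mem_filter.1 ha).2
    exact Finset.mem_filter.2 ⟨Finset.mem_univ _, hlt a h.1, h.2⟩
  · intro b hb
    have h := (Finset.mem_filter.1 hb).2
    refine ⟨simplePerm i b, Finset.mem_filter.2 ⟨Finset.mem_univ _, hlt b h.1, ?_⟩,
      simplePerm_simplePerm i b⟩
    rw [Equiv.Perm.mul_apply, simplePerm_simplePerm]
    exact h.2

/-- The increments of `rk` on the two sides of row `j` are the indicators of `k ≤ π a` and `k ≤ π b`
for the swapped neighbours `a`, `b`. Hence the entry in row `j` is half the sum of its two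
neighbours, rounded down at an ascent and up at a descent. -/
theorem rk_row {n : ℕ} {π : Perm (Fin (2 * n))} (hπ : RevComm π) {i : Fin n} {j : ℕ}
    (hj : IsRow i j) (k : ℕ) :
    (¬ Desc π i → 2 * rk π j k ≤ rk π (j - 1) k + rk π (j + 1) k ∧
      rk π (j - 1) k + rk π (j + 1) k ≤ 2 * rk π j k + 1) ∧
    (Desc π i → 2 * rk π j k ≤ rk π (j - 1) k + rk π (j + 1) k + 1 ∧
      rk π (j - 1) k + rk π (j + 1) k ≤ 2 * rk π j k) := by
  have hi := i.isLt
  have key : ∃ a b : Fin (2 * n), a.val + 1 = j ∧ b.val = j ∧ (Desc π i ↔ π b < π a) := by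
    rcases hj with rfl | rfl
    · exact ⟨pos i, nxt i, rfl, rfl, Iff.rfl⟩
    · refine ⟨(nxt i).rev, (pos i).rev, ?_, ?_, ?_⟩
      · rw [Fin.val_rev, val_nxt]; omega
      · rw [Fin.val_rev, val_pos]; omega
      · rw [hπ, hπ, Fin.rev_lt_rev]; rfl
  obtain ⟨a, b, rfl, hb, hD⟩ := key
  have h1 := rk_succ π a k
  have h2 := rk_succ π b k
  rw [hb] at h2
  have hne : (π a).val ≠ (π b).val := fun h => by
    have := congrArg Fin.val (π.injective (Fin.ext h))
    omega
  rw [hD, Fin.lt_def, Nat.add_sub_cancel]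
  constructor
  · intro h
    split_ifs at h1 h2 <;> omega
  · intro h
    split_ifs at h1 h2 <;> omega

/-! ### The lifting property of the rank order -/

section Lifting

variable {n : ℕ} {σ τ : Perm (Fin (2 * n))} {i : Fin n}

/-- Only the rows `IsRow` can change, and there the entry is the rounded half-sum of two unchanged
neighbours. After multiplication `τ` has a descent, so its half-sum is rounded up, which dominates
either rounding for `σ`. The next two lemmas use the same comparison of roundings. -/
theorem RkLE.mul_of_asc (hσ : RevComm σ) (hτ : RevComm τ) (h : RkLE σ τ) (hd : ¬ Desc τ i) :
    RkLE (σ * simplePerm i) (τ * simplePerm i) := by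
  intro j k
  by_cases hj : IsRow i j
  · have h1 := rk_row (hσ.mul (simplePerm_revComm i)) hj k
    have h2 := (rk_row (hτ.mul (simplePerm_revComm i)) hj k).2 ((desc_mul τ i).2 hd)
    rw [rk_mul_simplePerm _ _ hj.not_pred, rk_mul_simplePerm _ _ hj.not_succ] at h1 h2
    have h3 := h (j - 1) k
    have h4 := h (j + 1) k
    by_cases hd' : Desc (σ * simplePerm i) i
    · have := h1.2 hd'
      omega
    · have := h1.1 hd'
      omega
  · rw [rk_mul_simplePerm _ _ hj, rk_mul_simplePerm _ _ hj]
    exact h j k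

theorem RkLE.le_mul_of_asc (hσ : RevComm σ) (hτ : RevComm τ) (h : RkLE σ τ) (hd : ¬ Desc τ i) :
    RkLE σ (τ * simplePerm i) := by
  intro j k
  by_cases hj : IsRow i j
  · have h1 := rk_row hσ hj k
    have h2 := (rk_row (hτ.mul (simplePerm_revComm i)) hj k).2 ((desc_mul τ i).2 hd)
    rw [rk_mul_simplePerm _ _ hj.not_pred, rk_mul_simplePerm _ _ hj.not_succ] at h2
    have h3 := h (j - 1) k
    have h4 := h (j + 1) k
    by_cases hd' : Desc σ i
    · have := h1.2 hd'
      omega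
    · have := h1.1 hd'
      omega
  · rw [rk_mul_simplePerm _ _ hj]
    exact h j k

theorem RkLE.le_mul_of_desc (hσ : RevComm σ) (hτ : RevComm τ) (h : RkLE σ τ) (hd : Desc τ i)
    (hd' : ¬ Desc σ i) : RkLE σ (τ * simplePerm i) := by
  intro j k
  by_cases hj : IsRow i j
  · have h1 := (rk_row hσ hj k).1 hd'
    have h2 := (rk_row (hτ.mul (simplePerm_revComm i)) hj k).1 (by rwa [desc_mul, not_not])
    rw [rk_mul_simplePerm _ _ hj.not_pred, rk_mul_simplePerm _ _ hj.not_succ] at h2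
    have h3 := h (j - 1) k
    have h4 := h (j + 1) k
    omega
  · rw [rk_mul_simplePerm _ _ hj]
    exact h j k

theorem mul_le_of_desc (hσ : RevComm σ) (hd : Desc σ i) : RkLE (σ * simplePerm i) σ := by
  have h := RkLE.le_mul_of_asc (hσ.mul (simplePerm_revComm i)) (hσ.mul (simplePerm_revComm i))
    (fun _ _ => le_rfl) (by rwa [desc_mul, not_not] : ¬ Desc (σ * simplePerm i) i)
  rwa [mul_mul_simplePerm] at h

theorem RkLE.mul_of_desc (hσ : RevComm σ) (hτ : RevComm τ) (h : RkLE σ τ) (hd : Desc τ i)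
    (hd' : Desc σ i) : RkLE (σ * simplePerm i) (τ * simplePerm i) :=
  RkLE.le_mul_of_desc (hσ.mul (simplePerm_revComm i)) hτ ((mul_le_of_desc hσ hd').trans h) hd
    (by rwa [desc_mul, not_not])

end Lifting

/-- Fundamental ascents control adjacent positions in the first half, including the middle pair;
negation carries them to the second half. -/
theorem eq_one_of_not_desc {n : ℕ} {π : Perm (Fin (2 * n))} (hπ : RevComm π)
    (h : ∀ i, ¬ Desc π i) : π = 1 := by
  refine perm_eq_one_of_adjacent π fun a b hab => ?_
  have hb := b.isLt
  by_cases ha : a.val < n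
  · have h1 := (not_desc_iff π ⟨a.val, ha⟩).1 (h _)
    have e1 : pos ⟨a.val, ha⟩ = a := rfl
    have e2 : nxt ⟨a.val, ha⟩ = b := Fin.ext hab.symm
    rwa [e1, e2] at h1
  · have hr : b.rev.val < n := by rw [Fin.val_rev]; omega
    have h1 := (not_desc_iff π ⟨b.rev.val, hr⟩).1 (h _)
    have e1 : pos ⟨b.rev.val, hr⟩ = b.rev := rfl
    have e2 : nxt ⟨b.rev.val, hr⟩ = a.rev := by
      apply Fin.ext
      rw [val_nxt, Fin.val_rev, Fin.val_rev]
      omega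
    rw [e1, e2, hπ, hπ, Fin.rev_lt_rev] at h1
    exact h1

/-! ### The length function -/

/-- The set of inversions of a permutation. -/
def inversions {N : ℕ} (π : Perm (Fin N)) : Finset (Fin N × Fin N) :=
  Finset.univ.filter fun a => a.1 < a.2 ∧ π a.2 < π a.1

theorem mem_inversions {N : ℕ} (π : Perm (Fin N)) (a : Fin N × Fin N) :
    a ∈ inversions π ↔ a.1 < a.2 ∧ π a.2 < π a.1 := by
  simp [inversions]

theorem card_inversions_mul_swap {N : ℕ} (π : Perm (Fin N)) {p q : Fin N}
    (hpq : q.val = p.val + 1) (h : π p < π q) :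
    (inversions (π * Equiv.swap p q)).card = (inversions π).card + 1 := by
  -- A swap of adjacent positions preserves the order of every pair except `(p, q)` itself, so it
  -- carries inversions to inversions and adds just that one.
  have hlt : ∀ a b : Fin N, a < b → ¬ (a = p ∧ b = q) → Equiv.swap p q a < Equiv.swap p q b := by
    intro a b hab hne
    rw [Fin.lt_def] at hab ⊢
    simp only [Equiv.swap_apply_def, Fin.ext_iff] at hne ⊢
    split_ifs <;> omega
  have key : inversions (π * Equiv.swap p q) = insert (p, q) ((inversions π).map
      ((Equiv.swap p q).prodCongr (Equiv.swap p q)).toEmbedding) := by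
    ext ⟨a, b⟩
    rw [Finset.mem_insert, Finset.mem_map_equiv, mem_inversions, mem_inversions]
    simp only [Equiv.prodCongr_symm, Equiv.symm_swap, Equiv.prodCongr_apply, Prod.map_apply,
      Equiv.Perm.mul_apply, Prod.mk.injEq]
    constructor
    · rintro ⟨h1, h2⟩
      by_cases hab : a = p ∧ b = q
      · exact Or.inl hab
      · exact Or.inr ⟨hlt a b h1 hab, h2⟩
    · rintro (⟨rfl, rfl⟩ | ⟨h1, h2⟩)
      · rw [Equiv.swap_apply_left, Equiv.swap_apply_right]
        exact ⟨Fin.lt_def.2 (by omega), h⟩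
      · refine ⟨?_, h2⟩
        have h3 := hlt _ _ h1 (by
          rintro ⟨h3, h4⟩
          rw [h3, h4] at h2
          exact lt_asymm h h2)
        rwa [Equiv.swap_apply_self, Equiv.swap_apply_self] at h3
  rw [key, Finset.card_insert_of_notMem, Finset.card_map]
  rw [Finset.mem_map_equiv, mem_inversions]
  simp only [Equiv.prodCongr_symm, Equiv.symm_swap, Equiv.prodCongr_apply, Prod.map_apply,
    Equiv.swap_apply_left, Equiv.swap_apply_right]
  rintro ⟨h1, -⟩
  have := Fin.lt_def.1 h1
  omega

/-- Twice the Coxeter length of a signed permutation. -/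
def len {n : ℕ} (π : Perm (Fin (2 * n))) : ℕ := (inversions π).card + rk π n n

/-- The last fundamental reflection is a single adjacent swap and also makes one value negative, so
each summand of `len` grows by one. Any other is a product of two mirror-image adjacent swaps that
keep each half in place, so two inversions appear and the number of sign changes stays. -/
theorem len_mul_of_asc {n : ℕ} {π : Perm (Fin (2 * n))} (hπ : RevComm π) {i : Fin n}
    (hd : ¬ Desc π i) : len (π * simplePerm i) = len π + 2 := by
  have hi := i.isLt
  have hasc := (not_desc_iff π i).1 hd
  have hpq : (nxt i).val = (pos i).val + 1 := rfl
  by_cases hrev : nxt i = (pos i).rev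
  · have hval := congrArg Fin.val hrev
    rw [Fin.val_rev, val_nxt, val_pos] at hval
    have h1 := card_inversions_mul_swap π hpq hasc
    have e : simplePerm i = Equiv.swap (pos i) (nxt i) := by
      rw [simplePerm, pairRefl, if_pos hrev]
    rw [← e] at h1
    rw [hrev, hπ, Fin.lt_def, Fin.val_rev] at hasc
    have h2 := rk_succ π (pos i) n
    have h3 := rk_succ (π * simplePerm i) (pos i) n
    rw [rk_mul_simplePerm _ _ (j := (pos i).val) (by unfold IsRow; rw [val_pos]; omega), Equiv.Perm.mul_apply,
      simplePerm_pos, hrev, hπ, Fin.val_rev, if_pos (by omega)] at h3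
    rw [if_neg (by omega)] at h2
    have e2 : (pos i).val + 1 = n := by rw [val_pos]; omega
    rw [e2] at h2 h3
    unfold len
    omega
  · have hval : ¬ (i.val + 1 = n) := fun h => hrev (Fin.ext (by
      rw [Fin.val_rev, val_nxt, val_pos]; omega))
    have e : simplePerm i = Equiv.swap (pos i) (nxt i) * Equiv.swap (nxt i).rev (pos i).rev := by
      rw [simplePerm, pairRefl, if_neg hrev, Equiv.swap_comm (nxt i).rev]
    have h1 := card_inversions_mul_swap π hpq hasc
    have hne : ∀ a : Fin (2 * n), n ≤ a.val → Equiv.swap (pos i) (nxt i) a = a := fun a ha =>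
      Equiv.swap_apply_of_ne_of_ne (fun h => by rw [h, val_pos] at ha; omega)
        (fun h => by rw [h, val_nxt] at ha; omega)
    have h2 := card_inversions_mul_swap (π * Equiv.swap (pos i) (nxt i)) (p := (nxt i).rev)
      (q := (pos i).rev) (by rw [Fin.val_rev, Fin.val_rev, val_pos, val_nxt]; omega) (by
        rw [Equiv.Perm.mul_apply, Equiv.Perm.mul_apply, hne, hne, hπ, hπ, Fin.rev_lt_rev]
        · exact hasc
        · rw [Fin.val_rev, val_pos]; omega
        · rw [Fin.val_rev, val_nxt]; omega)
    rw [mul_assoc, ← e] at h2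
    have h3 := rk_mul_simplePerm π i (j := n) (by unfold IsRow; omega) n
    unfold len
    omega

theorem len_mul_of_desc {n : ℕ} {π : Perm (Fin (2 * n))} (hπ : RevComm π) {i : Fin n}
    (hd : Desc π i) : len (π * simplePerm i) + 2 = len π := by
  rw [← len_mul_of_asc (hπ.mul (simplePerm_revComm i)) (i := i) (by rwa [desc_mul, not_not]),
    mul_mul_simplePerm]

theorem len_one {n : ℕ} : len (1 : Perm (Fin (2 * n))) = 0 := by
  unfold len rk
  rw [Nat.add_eq_zero_iff, Finset.card_eq_zero, Finset.card_eq_zero,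
    Finset.filter_eq_empty_iff, inversions, Finset.filter_eq_empty_iff]
  refine ⟨?_, ?_⟩
  · rintro a - ⟨h1, h2⟩
    exact lt_asymm h1 h2
  · rintro a - ⟨h1, h2⟩
    rw [Equiv.Perm.one_apply] at h2
    omega

/-! ### The Weyl group as a group of signed permutations -/

/-- The vectors `ε_a`, `a ∈ {1, …, n, -n, …, -1}`, where `ε_{-i} = -ε_i`. -/
noncomputable def signedEps {n : ℕ} (a : Fin (2 * n)) : EuclideanSpace ℝ (Fin n) :=
  if h : a.val < n then eps ⟨a.val, h⟩
  else -eps ⟨a.rev.val, by rw [Fin.val_rev]; omega⟩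

theorem signedEps_pos {n : ℕ} (i : Fin n) : signedEps (pos i) = eps i := by
  unfold signedEps
  rw [dif_pos (by rw [val_pos]; exact i.isLt)]
  rfl

theorem signedEps_rev {n : ℕ} (a : Fin (2 * n)) : signedEps a.rev = -signedEps a := by
  unfold signedEps
  have ha := a.isLt
  by_cases h : a.val < n
  · rw [dif_pos h, dif_neg (by rw [Fin.val_rev]; omega)]
    congr 2
    apply Fin.ext
    simp only [Fin.val_rev]
    omega
  · rw [dif_neg h, dif_pos (by rw [Fin.val_rev]; omega), neg_neg]

theorem signedEps_neg {n : ℕ} (i : Fin n) : signedEps (neg i) = -eps i := by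
  rw [neg, signedEps_rev, signedEps_pos]

theorem pos_or_neg {n : ℕ} (a : Fin (2 * n)) : (∃ i, a = pos i) ∨ ∃ i, a = neg i := by
  by_cases h : a.val < n
  · exact Or.inl ⟨⟨a.val, h⟩, rfl⟩
  · have ha := a.isLt
    refine Or.inr ⟨⟨a.rev.val, by rw [Fin.val_rev]; omega⟩, ?_⟩
    rw [neg, ← Fin.rev_eq_iff]
    rfl

theorem pos_injective {n : ℕ} : Function.Injective (pos : Fin n → Fin (2 * n)) := fun i j h => by
  have h' := congrArg Fin.val h
  exact Fin.ext h'

theorem pos_ne_neg {n : ℕ} (i j : Fin n) : pos i ≠ neg j := by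
  intro h
  have := congrArg Fin.val h
  rw [neg, Fin.val_rev, val_pos, val_pos] at this
  omega

theorem neg_injective {n : ℕ} : Function.Injective (neg : Fin n → Fin (2 * n)) := fun _ _ h =>
  pos_injective (Fin.rev_injective h)

theorem pos_rev {n : ℕ} (i : Fin n) : (pos i).rev = neg i := rfl

theorem neg_rev {n : ℕ} (i : Fin n) : (neg i).rev = pos i := Fin.rev_rev _

theorem inner_eps {n : ℕ} (i j : Fin n) :
    inner ℝ (eps i) (eps j) = if i = j then (1 : ℝ) else 0 := by
  unfold eps
  rw [EuclideanSpace.inner_single_left]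
  simp

theorem inner_signedEps {n : ℕ} (a b : Fin (2 * n)) :
    inner ℝ (signedEps a) (signedEps b) =
      (if a = b then (1 : ℝ) else 0) - if a = b.rev then (1 : ℝ) else 0 := by
  rcases pos_or_neg a with ⟨i, rfl⟩ | ⟨i, rfl⟩ <;> rcases pos_or_neg b with ⟨j, rfl⟩ | ⟨j, rfl⟩ <;>
    simp [signedEps_pos, signedEps_neg, inner_eps, pos_rev, neg_rev, pos_ne_neg,
      (pos_ne_neg _ _).symm, pos_injective.eq_iff, neg_injective.eq_iff]

theorem norm_signedEps {n : ℕ} (a : Fin (2 * n)) : ‖signedEps a‖ = 1 := by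
  have h := inner_signedEps a a
  rw [if_pos rfl, if_neg (rev_ne a).symm, real_inner_self_eq_norm_sq, sub_zero] at h
  exact (pow_eq_one_iff_of_nonneg (norm_nonneg _) two_ne_zero).1 h

theorem signedEps_injective {n : ℕ} : Function.Injective (signedEps : Fin (2 * n) → _) := by
  intro a b h
  have h1 := inner_signedEps a b
  rw [h, real_inner_self_eq_norm_sq, norm_signedEps] at h1
  by_contra hne
  rw [if_neg hne] at h1
  split_ifs at h1 <;> norm_num at h1

/-- A root can be written as `ε_x - ε_z` with the pair `(x, z)` or `(-z, -x)`; the second inequality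
singles out the pair used by `entry`. -/
theorem entry_val {n : ℕ} (α : PosRoot n) : (entry α).1 < (entry α).2 ∧
    (entry α).1.val + (entry α).2.val + 1 ≤ 2 * n := by
  rcases α with ⟨i, j, h⟩ | ⟨i, j, h⟩ | i <;>
    simp only [entry, neg, Fin.lt_def, Fin.val_rev, val_pos] <;> omega

theorem entry_ne {n : ℕ} (α : PosRoot n) : (entry α).1 ≠ (entry α).2 := (entry_val α).1.ne

theorem entry_injective {n : ℕ} : Function.Injective (entry : PosRoot n → _) := by
  intro α β h
  have h1 := rootMatrix_entry α α
  rw [h, rootMatrix_entry] at h1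
  by_contra hne
  rw [if_neg hne, if_pos rfl] at h1
  exact zero_ne_one h1

theorem exists_entry {n : ℕ} {x z : Fin (2 * n)} (h : x < z) (h' : x.val + z.val + 1 ≤ 2 * n) :
    ∃ α : PosRoot n, entry α = (x, z) := by
  rw [Fin.lt_def] at h
  rcases pos_or_neg x with ⟨i, rfl⟩ | ⟨i, rfl⟩
  · rcases pos_or_neg z with ⟨j, rfl⟩ | ⟨j, rfl⟩
    · exact ⟨.sub i j h, rfl⟩
    · rcases lt_trichotomy i j with hij | rfl | hij
      · exact ⟨.add i j hij, rfl⟩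
      · exact ⟨.long i, rfl⟩
      · rw [neg, Fin.val_rev, val_pos, val_pos] at h'
        have := Fin.lt_def.1 hij
        omega
  · rw [neg, Fin.val_rev, val_pos] at h h'
    omega

theorem vec_eq {n : ℕ} (α : PosRoot n) :
    α.vec = signedEps (entry α).1 - signedEps (entry α).2 := by
  rcases α with ⟨i, j, h⟩ | ⟨i, j, h⟩ | i <;>
    simp [PosRoot.vec, entry, signedEps_pos, signedEps_neg, two_smul]

theorem reflection_signedEps {n : ℕ} (α : PosRoot n) (a : Fin (2 * n)) :
    α.reflection (signedEps a) = signedEps (pairRefl (entry α).1 (entry α).2 a) := by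
  set x := (entry α).1
  set z := (entry α).2
  have hxz : x ≠ z := entry_ne α
  have hx : α.reflection (signedEps x) = signedEps z := by
    unfold PosRoot.reflection
    simp only [vec_eq]
    exact Submodule.reflection_sub (by rw [norm_signedEps, norm_signedEps])
  have hz : α.reflection (signedEps z) = signedEps x := by
    rw [← hx]
    exact Submodule.reflection_reflection _ _
  rw [pairRefl_apply hxz]
  split_ifs with h1 h2 h3 h4
  · rw [h1, hx]
  · rw [h2, hz]
  · rw [h3, signedEps_rev, map_neg, hx, signedEps_rev]
  · rw [h4, signedEps_rev, map_neg, hz, signedEps_rev]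
  · unfold PosRoot.reflection
    simp only [vec_eq]
    refine Submodule.reflection_mem_subspace_eq_self ?_
    rw [Submodule.mem_orthogonal_singleton_iff_inner_right, inner_sub_left, inner_signedEps,
      inner_signedEps, if_neg (Ne.symm h1), if_neg (Ne.symm h2), if_neg, if_neg]
    · simp
    · exact fun h => h4 (by rw [show (entry α).2 = z from rfl] at h; rw [h, Fin.rev_rev])
    · exact fun h => h3 (by rw [show (entry α).1 = x from rfl] at h; rw [h, Fin.rev_rev])

theorem exists_perm {n : ℕ} (w : weylGroup n) : ∃ π : Perm (Fin (2 * n)), RevComm π ∧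
    ∀ a, w.1 (signedEps a) = signedEps (π a) := by
  obtain ⟨w, hw⟩ := w
  induction hw using Subgroup.closure_induction with
  | mem x hx =>
    obtain ⟨α, rfl⟩ := hx
    exact ⟨_, pairRefl_revComm (entry_ne α), reflection_signedEps α⟩
  | one => exact ⟨1, RevComm.one, fun a => rfl⟩
  | mul x y hx hy ihx ihy =>
    obtain ⟨π, h1, h2⟩ := ihx
    obtain ⟨ρ, h3, h4⟩ := ihy
    refine ⟨π * ρ, h1.mul h3, fun a => ?_⟩
    rw [Equiv.Perm.mul_apply, ← h2, ← h4]
    rfl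
  | inv x hx ihx =>
    obtain ⟨π, h1, h2⟩ := ihx
    refine ⟨π⁻¹, h1.inv, fun a => ?_⟩
    have h3 := h2 (π⁻¹ a)
    rw [perm_apply_inv] at h3
    change x⁻¹ (signedEps a) = _
    change x _ = _ at h3
    rw [← h3]
    exact x.symm_apply_apply _

/-- The signed permutation given by an element of the Weyl group. -/
noncomputable def perm {n : ℕ} : weylGroup n →* Perm (Fin (2 * n)) where
  toFun w := (exists_perm w).choose
  map_one' := by
    ext a : 1
    apply signedEps_injective
    rw [← (exists_perm 1).choose_spec.2]
    rfl
  map_mul' v w := by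
    ext a : 1
    apply signedEps_injective
    rw [← (exists_perm (v * w)).choose_spec.2, Equiv.Perm.mul_apply,
      ← (exists_perm v).choose_spec.2, ← (exists_perm w).choose_spec.2]
    rfl

theorem perm_revComm {n : ℕ} (w : weylGroup n) : RevComm (perm w) :=
  (exists_perm w).choose_spec.1

theorem apply_signedEps {n : ℕ} (w : weylGroup n) (a : Fin (2 * n)) :
    w.1 (signedEps a) = signedEps (perm w a) :=
  (exists_perm w).choose_spec.2 a

theorem perm_injective {n : ℕ} : Function.Injective (perm : weylGroup n →* _) := by
  intro v w h
  apply Subtype.ext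
  apply LinearIsometryEquiv.toLinearEquiv_injective
  apply LinearEquiv.toLinearMap_injective
  refine (EuclideanSpace.basisFun (Fin n) ℝ).toBasis.ext fun i => ?_
  have h1 := apply_signedEps v (pos i)
  have h2 := apply_signedEps w (pos i)
  rw [h, ← h2, signedEps_pos] at h1
  simpa [eps] using h1

theorem perm_refl {n : ℕ} (α : PosRoot n) :
    perm (refl α) = pairRefl (entry α).1 (entry α).2 := by
  ext a : 1
  apply signedEps_injective
  rw [← apply_signedEps, ← reflection_signedEps]
  rfl

theorem entry_simpleRoot {n : ℕ} (i : Fin n) : entry (simpleRoot i) = (pos i, nxt i) := by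
  unfold simpleRoot
  split_ifs with h
  · rfl
  · simp only [entry, Prod.mk.injEq, true_and]
    apply Fin.ext
    rw [neg, Fin.val_rev, val_pos, val_nxt]
    omega

theorem perm_refl_simpleRoot {n : ℕ} (i : Fin n) : perm (refl (simpleRoot i)) = simplePerm i := by
  rw [perm_refl, entry_simpleRoot]
  rfl

/-! ### Reduced words and the Bruhat order -/

theorem wordProd_append {n : ℕ} (ω : List (Fin n)) (i : Fin n) :
    wordProd (ω ++ [i]) = wordProd ω * refl (simpleRoot i) := by
  simp [wordProd]

theorem perm_wordProd_append {n : ℕ} (ω : List (Fin n)) (i : Fin n) :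
    perm (wordProd (ω ++ [i])) = perm (wordProd ω) * simplePerm i := by
  rw [wordProd_append, map_mul, perm_refl_simpleRoot]

theorem wordProd_nil {n : ℕ} : wordProd ([] : List (Fin n)) = 1 := rfl

theorem len_wordProd_le {n : ℕ} (ω : List (Fin n)) : len (perm (wordProd ω)) ≤ 2 * ω.length := by
  induction ω using List.reverseRecOn with
  | nil => rw [wordProd_nil, map_one, len_one]; exact Nat.zero_le _
  | append_singleton ω i ih =>
    rw [perm_wordProd_append, List.length_append, List.length_singleton]
    by_cases h : Desc (perm (wordProd ω)) i
    · have := len_mul_of_desc (perm_revComm _) h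
      omega
    · have := len_mul_of_asc (perm_revComm _) h
      omega

theorem mul_refl_mul_refl {n : ℕ} (w : weylGroup n) (i : Fin n) :
    w * refl (simpleRoot i) * refl (simpleRoot i) = w := by
  apply perm_injective
  rw [map_mul, map_mul, perm_refl_simpleRoot, mul_mul_simplePerm]

/-- A descent `i` of `τ` is peeled off as the last letter of a word for `τ`. By lifting, the
remaining prefix dominates `σ` with `i` removed or `σ` itself, according to whether `i` is a descent
of `σ`; in the first case the subword also ends in `i`. -/
theorem exists_subword {n : ℕ} (σ τ : weylGroup n) (h : RkLE (perm σ) (perm τ)) :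
    ∃ ω : List (Fin n), 2 * ω.length = len (perm τ) ∧ wordProd ω = τ ∧
      ∃ ω' : List (Fin n), ω'.Sublist ω ∧ wordProd ω' = σ := by
  induction hm : len (perm τ) using Nat.strong_induction_on generalizing σ τ with
  | _ m ih =>
    by_cases hd : ∃ i, Desc (perm τ) i
    · obtain ⟨i, hi⟩ := hd
      have hlen := len_mul_of_desc (perm_revComm τ) hi
      have hp : ∀ w : weylGroup n, perm (w * refl (simpleRoot i)) = perm w * simplePerm i :=
        fun w => by rw [map_mul, perm_refl_simpleRoot]
      by_cases hσ : Desc (perm σ) i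
      · have hle := h.mul_of_desc (perm_revComm σ) (perm_revComm τ) hi hσ
        rw [← hp, ← hp] at hle
        obtain ⟨ω, h1, h2, ω', h3, h4⟩ := ih _ (by rw [hp]; omega) _ _ hle rfl
        refine ⟨ω ++ [i], ?_, ?_, ω' ++ [i], h3.append_right _, ?_⟩
        · rw [hp] at h1
          rw [List.length_append, List.length_singleton]
          omega
        · rw [wordProd_append, h2, mul_refl_mul_refl]
        · rw [wordProd_append, h4, mul_refl_mul_refl]
      · have hle := h.le_mul_of_desc (perm_revComm σ) (perm_revComm τ) hi hσ
        rw [← hp] at hle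
        obtain ⟨ω, h1, h2, ω', h3, h4⟩ := ih _ (by rw [hp]; omega) _ _ hle rfl
        refine ⟨ω ++ [i], ?_, ?_, ω', h3.trans (List.sublist_append_left _ _), h4⟩
        · rw [hp] at h1
          rw [List.length_append, List.length_singleton]
          omega
        · rw [wordProd_append, h2, mul_refl_mul_refl]
    · have h1 : perm τ = 1 := eq_one_of_not_desc (perm_revComm τ) (not_exists.1 hd)
      have h2 : perm σ = 1 := (h1 ▸ h).eq_one
      refine ⟨[], ?_, ?_, [], List.Sublist.refl _, ?_⟩
      · rw [← hm, h1, len_one, List.length_nil]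
      · rw [wordProd_nil]
        exact perm_injective (by rw [h1, map_one])
      · rw [wordProd_nil]
        exact perm_injective (by rw [h2, map_one])

/-- The hypothesis on the length makes each letter an ascent of the prefix before it, so appending
the letter preserves the comparison whether or not the subword uses it. -/
theorem rkLE_of_sublist {n : ℕ} (ω : List (Fin n))
    (hω : 2 * ω.length = len (perm (wordProd ω))) (ω' : List (Fin n)) (h : ω'.Sublist ω) :
    RkLE (perm (wordProd ω')) (perm (wordProd ω)) := by
  induction ω using List.reverseRecOn generalizing ω' with
  | nil => rw [List.sublist_nil.1 h]; exact fun _ _ => le_rfl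
  | append_singleton ω i ih =>
    have hlen := len_wordProd_le ω
    rw [perm_wordProd_append, List.length_append, List.length_singleton] at hω
    have hd : ¬ Desc (perm (wordProd ω)) i := fun hd => by
      have := len_mul_of_desc (perm_revComm _) hd
      omega
    have h1 := len_mul_of_asc (perm_revComm _) hd
    have ih := ih (by omega)
    obtain ⟨ω₁, ω₂, rfl, h2, h3⟩ := List.sublist_append_iff.1 h
    rw [perm_wordProd_append]
    rcases List.sublist_singleton.1 h3 with rfl | rfl
    · rw [List.append_nil]
      exact (ih _ h2).le_mul_of_asc (perm_revComm _) (perm_revComm _) hd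
    · rw [perm_wordProd_append]
      exact (ih _ h2).mul_of_asc (perm_revComm _) (perm_revComm _) hd

theorem isReduced_iff {n : ℕ} (ω : List (Fin n)) :
    IsReduced ω ↔ 2 * ω.length = len (perm (wordProd ω)) := by
  constructor
  · intro h
    obtain ⟨ω', h1, h2, -⟩ := exists_subword (wordProd ω) (wordProd ω) (fun _ _ => le_rfl)
    have h3 := h ω' h2
    have h4 := len_wordProd_le ω
    omega
  · intro h ω' hω'
    have h1 := len_wordProd_le ω'
    rw [hω'] at h1
    omega

theorem bruhatLE_iff {n : ℕ} (σ τ : weylGroup n) : BruhatLE σ τ ↔ RkLE (perm σ) (perm τ) := by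
  constructor
  · rintro ⟨ω, h1, rfl, ω', h2, rfl⟩
    exact rkLE_of_sublist ω ((isReduced_iff ω).1 h1) ω' h2
  · intro h
    obtain ⟨ω, h1, rfl, ω', h2, h3⟩ := exists_subword σ τ h
    exact ⟨ω, (isReduced_iff ω).2 h1, rfl, ω', h2, h3⟩

/-! ### Supports of involutions -/

/-- The indices `a` with `ε_a` not orthogonal to `α`. -/
def Touches {n : ℕ} (α : PosRoot n) (a : Fin (2 * n)) : Prop :=
  a = (entry α).1 ∨ a = (entry α).2 ∨ a = (entry α).1.rev ∨ a = (entry α).2.rev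

theorem not_touches_iff {n : ℕ} {α : PosRoot n} {a : Fin (2 * n)} :
    ¬ Touches α a ↔ a ≠ (entry α).1 ∧ a ≠ (entry α).2 ∧ a ≠ (entry α).1.rev ∧
      a ≠ (entry α).2.rev := by
  simp [Touches, not_or]

/-- The signed permutation of a reflection. -/
noncomputable def rperm {n : ℕ} (α : PosRoot n) : Perm (Fin (2 * n)) :=
  pairRefl (entry α).1 (entry α).2

theorem rperm_apply {n : ℕ} (α : PosRoot n) (a : Fin (2 * n)) :
    rperm α a = if a = (entry α).1 then (entry α).2 else if a = (entry α).2 then (entry α).1 else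
      if a = (entry α).1.rev then (entry α).2.rev else
      if a = (entry α).2.rev then (entry α).1.rev else a :=
  pairRefl_apply (entry_ne α) a

theorem rperm_of_not_touches {n : ℕ} {α : PosRoot n} {a : Fin (2 * n)} (h : ¬ Touches α a) :
    rperm α a = a := by
  obtain ⟨h1, h2, h3, h4⟩ := not_touches_iff.1 h
  rw [rperm_apply, if_neg h1, if_neg h2, if_neg h3, if_neg h4]

theorem touches_rperm {n : ℕ} {α : PosRoot n} {a : Fin (2 * n)} (h : Touches α a) :
    Touches α (rperm α a) := by
  rw [rperm_apply]
  unfold Touches at *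
  grind [Fin.rev_rev]

/-- Roots whose index sets are pairwise disjoint. -/
def IndexDisjoint {n : ℕ} (α β : PosRoot n) : Prop := ∀ a, Touches α a → ¬ Touches β a

theorem prod_rperm_apply {n : ℕ} (L : List (PosRoot n)) (hL : L.Pairwise IndexDisjoint)
    (a : Fin (2 * n)) :
    (∀ α ∈ L, Touches α a → (L.map rperm).prod a = rperm α a) ∧
      ((∀ α ∈ L, ¬ Touches α a) → (L.map rperm).prod a = a) := by
  induction L with
  | nil => exact ⟨fun α h => absurd h List.not_mem_nil, fun _ => rfl⟩
  | cons β L ih =>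
    rw [List.pairwise_cons] at hL
    obtain ⟨ih1, ih2⟩ := ih hL.2
    simp only [List.map_cons, List.prod_cons, Equiv.Perm.mul_apply]
    refine ⟨fun α hα ht => ?_, fun h => ?_⟩
    · rcases List.mem_cons.1 hα with rfl | hα
      · rw [ih2 fun γ hγ => hL.1 γ hγ a ht]
      · rw [ih1 α hα ht, rperm_of_not_touches fun h => hL.1 α hα _ h (touches_rperm ht)]
    · rw [ih2 fun α hα => h α (List.mem_cons_of_mem _ hα),
        rperm_of_not_touches (h β List.mem_cons_self)]

theorem perm_prod_refl {n : ℕ} (L : List (PosRoot n)) :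
    perm (L.map refl).prod = (L.map rperm).prod := by
  rw [map_list_prod, List.map_map]
  congr 2
  ext1 α
  exact perm_refl α

theorem inner_vec {n : ℕ} (α β : PosRoot n) (h : IndexDisjoint α β) :
    inner ℝ α.vec β.vec = (0 : ℝ) := by
  have h1 := h (entry α).1 (Or.inl rfl)
  have h2 := h (entry α).2 (Or.inr (Or.inl rfl))
  rw [not_touches_iff] at h1 h2
  rw [vec_eq, vec_eq]
  simp only [inner_sub_left, inner_sub_right, inner_signedEps]
  simp [h1, h2]

/-- The two indices in `{1, …, n}` involved in a root. -/
def idx {n : ℕ} : PosRoot n → Fin n × Fin n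
  | .sub i j _ => (i, j)
  | .add i j _ => (i, j)
  | .long i => (i, i)

theorem touches_iff_idx {n : ℕ} (α : PosRoot n) (a : Fin (2 * n)) :
    Touches α a ↔ (a = pos (idx α).1 ∨ a = neg (idx α).1) ∨
      (a = pos (idx α).2 ∨ a = neg (idx α).2) := by
  rcases α with ⟨i, j, h⟩ | ⟨i, j, h⟩ | i <;> simp only [Touches, entry, idx, pos_rev, neg_rev] <;>
    tauto

theorem indexDisjoint_of_idx {n : ℕ} {α β : PosRoot n} (h1 : (idx α).1 ≠ (idx β).1)
    (h2 : (idx α).1 ≠ (idx β).2) (h3 : (idx α).2 ≠ (idx β).1) (h4 : (idx α).2 ≠ (idx β).2) :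
    IndexDisjoint α β := by
  intro a ha hb
  rw [touches_iff_idx] at ha hb
  rcases ha with (rfl | rfl) | (rfl | rfl) <;>
    simp_all [pos_injective.eq_iff, neg_injective.eq_iff, pos_ne_neg, (pos_ne_neg _ _).symm]

/-- Distinct orthogonal positive roots share an index only in the case `ε_i - ε_j`, `ε_i + ε_j`, and
the difference of these two is the root `2 ε_j`. -/
theorem indexDisjoint_of {n : ℕ} {α β : PosRoot n} (hne : α ≠ β)
    (h : inner ℝ α.vec β.vec = (0 : ℝ)) (h1 : ∀ γ : PosRoot n, α.vec - β.vec ≠ γ.vec)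
    (h2 : ∀ γ : PosRoot n, β.vec - α.vec ≠ γ.vec) : IndexDisjoint α β := by
  have hsub : ∀ (i j : Fin n) (h : i < j), (PosRoot.add i j h).vec - (PosRoot.sub i j h).vec =
      (PosRoot.long j).vec := by
    intro i j h
    simp only [PosRoot.vec, two_smul]
    abel
  have e : ∀ i j : Fin n, inner ℝ (eps i) (eps j) = if i = j then (1 : ℝ) else 0 := inner_eps
  rcases α with ⟨i, j, hij⟩ | ⟨i, j, hij⟩ | i <;> rcases β with ⟨k, l, hkl⟩ | ⟨k, l, hkl⟩ | k <;>
    simp only [PosRoot.vec, inner_sub_left, inner_sub_right, inner_add_left, inner_add_right,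
      inner_smul_left, inner_smul_right, e, RCLike.conj_to_real] at h <;>
    apply indexDisjoint_of_idx <;> simp only [idx] <;> intro heq <;> split_ifs at h <;>
    first
      | (exfalso; omega)
      | (exfalso; norm_num at h; done)
      | (subst_vars; first
          | exact hne rfl
          | exact h1 _ (hsub _ _ _)
          | exact h2 _ (hsub _ _ _))

/-- The support of the involution with signed permutation `π`. -/
noncomputable def suppOf {n : ℕ} (π : Perm (Fin (2 * n))) : Finset (PosRoot n) :=
  Finset.univ.filter fun α => π (entry α).1 = (entry α).2

theorem mem_suppOf {n : ℕ} {π : Perm (Fin (2 * n))} {α : PosRoot n} :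
    α ∈ suppOf π ↔ π (entry α).1 = (entry α).2 := by
  simp [suppOf]

theorem IsSupport.pairwise {n : ℕ} {σ : weylGroup n} {D : Finset (PosRoot n)}
    (h : IsSupport σ D) : D.toList.Pairwise IndexDisjoint := by
  refine List.Pairwise.imp_of_mem ?_ D.nodup_toList
  intro α β hα hβ hne
  rw [Finset.mem_toList] at hα hβ
  exact indexDisjoint_of hne (h.orthogonal α hα β hβ hne) (h.sub_ne α hα β hβ) (h.sub_ne β hβ α hα)

theorem IsSupport.perm_eq {n : ℕ} {σ : weylGroup n} {D : Finset (PosRoot n)}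
    (h : IsSupport σ D) : perm σ = (D.toList.map rperm).prod := by
  rw [← h.prod_eq, perm_prod_refl]

/-- The reflections of a support move disjoint sets of indices, so at each index `σ` agrees with the
only reflection touching it, or is trivial. Hence `D` can be read off `σ`. -/
theorem IsSupport.eq_suppOf {n : ℕ} {σ : weylGroup n} {D : Finset (PosRoot n)}
    (h : IsSupport σ D) : D = suppOf (perm σ) := by
  have hp := h.perm_eq
  have hL := prod_rperm_apply _ h.pairwise
  simp only [Finset.mem_toList, ← hp] at hL
  ext α
  rw [mem_suppOf]
  constructor
  · intro hα
    rw [(hL _).1 α hα (Or.inl rfl), rperm_apply, if_pos rfl]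
  · intro hα
    by_cases hex : ∃ β ∈ D, Touches β (entry α).1
    · obtain ⟨β, hβ, ht⟩ := hex
      have h1 := (hL _).1 β hβ ht
      rw [hα] at h1
      suffices α = β by rwa [this]
      apply entry_injective
      obtain ⟨h2, h3⟩ := entry_val α
      obtain ⟨h4, h5⟩ := entry_val β
      rw [rperm_apply] at h1
      rw [Fin.lt_def] at h2 h4
      unfold Touches at ht
      simp only [Fin.ext_iff, apply_ite Fin.val, Fin.val_rev, Prod.ext_iff] at *
      have := (entry α).1.isLt
      have := (entry α).2.isLt
      have := (entry β).1.isLt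
      have := (entry β).2.isLt
      split_ifs at h1 <;> omega
    · push Not at hex
      exact absurd (hα.symm.trans ((hL _).2 hex)) (entry_ne α).symm

theorem inner_vec_signedEps {n : ℕ} {α : PosRoot n} {a : Fin (2 * n)} (h : ¬ Touches α a) :
    inner ℝ α.vec (signedEps a) = (0 : ℝ) := by
  obtain ⟨h1, h2, h3, h4⟩ := not_touches_iff.1 h
  rw [vec_eq, inner_sub_left, inner_signedEps, inner_signedEps, if_neg h1.symm, if_neg h2.symm,
    if_neg, if_neg]
  · simp
  · exact fun e => h4 (by rw [e, Fin.rev_rev])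
  · exact fun e => h3 (by rw [e, Fin.rev_rev])

theorem inner_vec_self {n : ℕ} (α : PosRoot n) :
    inner ℝ α.vec α.vec = if (entry α).2 = (entry α).1.rev then (4 : ℝ) else 2 := by
  have h1 := entry_ne α
  have h2 : (entry α).1 = (entry α).2.rev ↔ (entry α).2 = (entry α).1.rev :=
    ⟨fun h => by rw [h, Fin.rev_rev], fun h => by rw [h, Fin.rev_rev]⟩
  rw [vec_eq]
  simp only [inner_sub_left, inner_sub_right, inner_signedEps, if_true, if_neg h1, if_neg h1.symm,
    if_neg (rev_ne _).symm, h2]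
  split_ifs <;> norm_num

/-- If `γ = α - β` with `α`, `β` orthogonal, then `‖γ‖² ≥ 4`, so `γ = 2 ε_a`. But `γ` pairs
nontrivially with both `α` and `β`, so both would touch the index `a`. -/
theorem sub_ne_vec {n : ℕ} {α β : PosRoot n} (h : IndexDisjoint α β) (γ : PosRoot n) :
    α.vec - β.vec ≠ γ.vec := by
  intro hγ
  have h0 := inner_vec α β h
  have h0' : inner ℝ β.vec α.vec = (0 : ℝ) := by rw [real_inner_comm, h0]
  have h1 : inner ℝ γ.vec γ.vec = inner ℝ α.vec α.vec + inner ℝ β.vec β.vec := by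
    rw [← hγ]
    simp only [inner_sub_left, inner_sub_right, h0, h0']
    ring
  have hlong : (entry γ).2 = (entry γ).1.rev := by
    by_contra hc
    rw [inner_vec_self, inner_vec_self, inner_vec_self, if_neg hc] at h1
    split_ifs at h1 <;> norm_num at h1
  have h2 : γ.vec = (2 : ℝ) • signedEps (entry γ).1 := by
    rw [vec_eq, hlong, signedEps_rev, two_smul, sub_neg_eq_add]
  have h3 : inner ℝ α.vec γ.vec = inner ℝ α.vec α.vec := by
    rw [← hγ, inner_sub_right, h0, sub_zero]
  have h4 : inner ℝ β.vec γ.vec = -inner ℝ β.vec β.vec := by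
    rw [← hγ, inner_sub_right, h0', zero_sub]
  rw [h2, inner_smul_right] at h3 h4
  by_cases ht : Touches α (entry γ).1
  · rw [inner_vec_signedEps (h _ ht), inner_vec_self] at h4
    split_ifs at h4 <;> norm_num at h4
  · rw [inner_vec_signedEps ht, inner_vec_self] at h3
    split_ifs at h3 <;> norm_num at h3

/-! ### Existence of the support of an involution -/

section

variable {n : ℕ} {π : Perm (Fin (2 * n))}

theorem apply_of_mem_suppOf (hπ : RevComm π) (hinv : ∀ a, π (π a) = a) {α : PosRoot n}
    (hα : α ∈ suppOf π) {a : Fin (2 * n)} (ht : Touches α a) : rperm α a = π a := by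
  rw [mem_suppOf] at hα
  have h2 : π (entry α).2 = (entry α).1 := by rw [← hα, hinv]
  have h3 := hπ (entry α).1
  have h4 := hπ (entry α).2
  rw [rperm_apply]
  unfold Touches at ht
  grind

theorem indexDisjoint_of_mem_suppOf (hπ : RevComm π) (hinv : ∀ a, π (π a) = a) {α β : PosRoot n}
    (hα : α ∈ suppOf π) (hβ : β ∈ suppOf π) (hne : α ≠ β) : IndexDisjoint α β := by
  intro a ha hb
  apply hne
  apply entry_injective
  have h1 := apply_of_mem_suppOf hπ hinv hα ha
  have h2 := apply_of_mem_suppOf hπ hinv hβ hb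
  rw [← h2, rperm_apply, rperm_apply] at h1
  obtain ⟨h2, h3⟩ := entry_val α
  obtain ⟨h4, h5⟩ := entry_val β
  rw [Fin.lt_def] at h2 h4
  unfold Touches at ha hb
  simp only [Fin.ext_iff, apply_ite Fin.val, Fin.val_rev, Prod.ext_iff] at *
  have := a.isLt
  have := (entry α).1.isLt
  have := (entry α).2.isLt
  have := (entry β).1.isLt
  have := (entry β).2.isLt
  split_ifs at h1 <;> omega

theorem exists_touches (hπ : RevComm π) (hinv : ∀ a, π (π a) = a) {a : Fin (2 * n)}
    (ha : π a ≠ a) : ∃ α ∈ suppOf π, Touches α a := by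
  have hr := hπ a
  have hr2 : π (π a).rev = a.rev := by rw [hπ, hinv]
  have key : ∀ x z : Fin (2 * n), x < z → x.val + z.val + 1 ≤ 2 * n → π x = z →
      (a = x ∨ a = z ∨ a = x.rev ∨ a = z.rev) → ∃ α ∈ suppOf π, Touches α a := by
    intro x z h1 h2 h3 h4
    obtain ⟨α, hα⟩ := exists_entry h1 h2
    refine ⟨α, ?_, ?_⟩
    · rw [mem_suppOf, hα, h3]
    · unfold Touches
      rw [hα]
      exact h4
  have h1 := a.isLt
  have h2 := (π a).isLt
  rcases lt_or_gt_of_ne ha with h | h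
  · by_cases hs : a.val + (π a).val + 1 ≤ 2 * n
    · exact key _ _ h (by omega) (hinv a) (by simp)
    · refine key _ _ (Fin.rev_lt_rev.2 h) (by rw [Fin.val_rev, Fin.val_rev]; omega) hr (by simp)
  · by_cases hs : a.val + (π a).val + 1 ≤ 2 * n
    · exact key _ _ h (by omega) rfl (by simp)
    · refine key _ _ (Fin.rev_lt_rev.2 h) (by rw [Fin.val_rev, Fin.val_rev]; omega) hr2 (by simp)

end

theorem perm_perm {n : ℕ} {σ : weylGroup n} (hσ : σ ^ 2 = 1) (a : Fin (2 * n)) :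
    perm σ (perm σ a) = a := by
  rw [← Equiv.Perm.mul_apply, ← map_mul, ← pow_two, hσ, map_one, Equiv.Perm.one_apply]

theorem isSupport_suppOf {n : ℕ} {σ : weylGroup n} (hσ : σ ^ 2 = 1) :
    IsSupport σ (suppOf (perm σ)) := by
  have hs : ∀ α ∈ suppOf (perm σ), ∀ β ∈ suppOf (perm σ), α ≠ β → IndexDisjoint α β :=
    fun α hα β hβ => indexDisjoint_of_mem_suppOf (perm_revComm σ) (perm_perm hσ) hα hβ
  refine ⟨fun α hα β hβ hne => inner_vec α β (hs α hα β hβ hne), fun α hα β hβ γ => ?_, ?_⟩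
  · rcases eq_or_ne α β with rfl | hne
    · rw [sub_self]
      intro h
      have := inner_vec_self γ
      rw [← h, inner_zero_left] at this
      split_ifs at this <;> norm_num at this
    · exact sub_ne_vec (hs α hα β hβ hne) γ
  · apply perm_injective
    rw [perm_prod_refl]
    ext a : 1
    have hL : (suppOf (perm σ)).toList.Pairwise IndexDisjoint := by
      refine List.Pairwise.imp_of_mem ?_ (Finset.nodup_toList _)
      intro α β hα hβ hne
      exact hs α (Finset.mem_toList.1 hα) β (Finset.mem_toList.1 hβ) hne
    have hp := prod_rperm_apply _ hL a
    by_cases hex : ∃ α ∈ suppOf (perm σ), Touches α a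
    · obtain ⟨α, hα, ht⟩ := hex
      rw [hp.1 α (Finset.mem_toList.2 hα) ht,
        apply_of_mem_suppOf (perm_revComm σ) (perm_perm hσ) hα ht]
    · rw [hp.2 fun α hα ht => hex ⟨α, Finset.mem_toList.1 hα, ht⟩]
      by_contra hne
      exact hex (exists_touches (perm_revComm σ) (perm_perm hσ) (Ne.symm hne))

theorem existsUnique_isSupport {n : ℕ} {σ : weylGroup n} (hσ : σ ^ 2 = 1) :
    ∃! D, IsSupport σ D :=
  ⟨_, isSupport_suppOf hσ, fun _ h => h.eq_suppOf⟩

theorem supp_eq {n : ℕ} {σ : weylGroup n} (hσ : σ ^ 2 = 1) : supp σ = suppOf (perm σ) := by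
  have h : ∃ D, IsSupport σ D := ⟨_, isSupport_suppOf hσ⟩
  unfold supp
  rw [dif_pos h]
  exact h.choose_spec.eq_suppOf

/-! ### Symmetric matrices and the congruence action -/

/-- The sign of the `a`-th row of `J`. -/
def eta {n : ℕ} (a : Fin (2 * n)) : ℂ := if a.val < n then 1 else -1

theorem eta_rev {n : ℕ} (a : Fin (2 * n)) : eta a.rev = -eta a := by
  have := a.isLt
  unfold eta
  rw [Fin.val_rev]
  split_ifs <;> first | omega | simp

theorem eta_mul_self {n : ℕ} (a : Fin (2 * n)) : eta a * eta a = 1 := by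
  unfold eta
  split_ifs <;> norm_num

theorem J_apply {n : ℕ} (a b : Fin (2 * n)) : J n a b = if b = a.rev then eta a else 0 := rfl

/-- The congruence action. -/
def congr {n : ℕ} (g S : Mat n) : Mat n := gᵀ * S * g

theorem congr_mul {n : ℕ} (g h S : Mat n) : congr (g * h) S = congr h (congr g S) := by
  simp only [congr, Matrix.transpose_mul, Matrix.mul_assoc]

theorem congr_one {n : ℕ} (S : Mat n) : congr 1 S = S := by
  simp [congr]

theorem congr_symm {n : ℕ} (g : Mat n) {S : Mat n} (hS : Sᵀ = S) :
    (congr g S)ᵀ = congr g S := by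
  simp only [congr, Matrix.transpose_mul, hS, Matrix.transpose_transpose, Matrix.mul_assoc]

theorem congr_apply {n : ℕ} (g S : Mat n) (x y : Fin (2 * n)) :
    congr g S x y = ∑ b, ∑ a, g a x * S a b * g b y := by
  simp only [congr, Matrix.mul_apply, Matrix.transpose_apply, Finset.sum_mul]

/-- Flags compatible with the symplectic form, given by the block number of every index. -/
structure IsFlag {n : ℕ} (f : Fin (2 * n) → ℕ) : Prop where
  mono : Monotone f
  rev_le : ∀ a b, f a ≤ f b → f b.rev ≤ f a.rev

theorem isFlag_val {n : ℕ} : IsFlag (Fin.val : Fin (2 * n) → ℕ) where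
  mono := fun _ _ h => h
  rev_le := fun _ _ h => Fin.rev_le_rev.2 h

/-- The parabolic subgroup stabilising a flag. -/
def parab {n : ℕ} (f : Fin (2 * n) → ℕ) : Subgroup (GL (Fin (2 * n)) ℂ) where
  carrier := {g | g ∈ Sp n ∧ BlockTriangular (g : Mat n) f}
  one_mem' := ⟨one_mem _, blockTriangular_one⟩
  mul_mem' := by
    rintro x y ⟨hx, hx'⟩ ⟨hy, hy'⟩
    exact ⟨mul_mem hx hy, by simpa using hx'.mul hy'⟩
  inv_mem' := by
    rintro x ⟨hx, hx'⟩
    have : Invertible (x : Mat n) := x.invertible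
    refine ⟨inv_mem hx, ?_⟩
    rw [Matrix.coe_units_inv]
    exact blockTriangular_inv_of_blockTriangular hx'

theorem borel_le_parab {n : ℕ} {f : Fin (2 * n) → ℕ} (hf : IsFlag f) : borel n ≤ parab f := by
  rintro g ⟨h1, h2⟩
  exact ⟨h1, fun a b h => h2 a b (hf.mono.reflect_lt h)⟩

/-- The truncation of a matrix to the positions visible on the nilradical of a parabolic. -/
def cut {n : ℕ} (f : Fin (2 * n) → ℕ) (S : Mat n) : Mat n :=
  Matrix.of fun x y => if f x < f y.rev then S x y else 0

theorem cut_apply {n : ℕ} (f : Fin (2 * n) → ℕ) (S : Mat n) (x y : Fin (2 * n)) :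
    cut f S x y = if f x < f y.rev then S x y else 0 := rfl

theorem cut_eq_cut_iff {n : ℕ} {f : Fin (2 * n) → ℕ} {S T : Mat n} :
    cut f S = cut f T ↔ ∀ x y, f x < f y.rev → S x y = T x y := by
  constructor
  · intro h x y hxy
    have := congrFun (congrFun h x) y
    rwa [cut_apply, cut_apply, if_pos hxy, if_pos hxy] at this
  · intro h
    ext x y
    rw [cut_apply, cut_apply]
    split_ifs with hxy
    · exact h x y hxy
    · rfl

theorem cut_cut_val {n : ℕ} {f : Fin (2 * n) → ℕ} (hf : IsFlag f) (S : Mat n) :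
    cut f (cut Fin.val S) = cut f S := by
  rw [cut_eq_cut_iff]
  intro x y h
  rw [cut_apply, if_pos (Fin.lt_def.1 (hf.mono.reflect_lt h))]

/-- By block triangularity a retained entry of `gᵀ S g` involves only retained entries of `S`. This
is dual to the stability of the nilradical of a parabolic under that parabolic. -/
theorem cut_congr_cut {n : ℕ} {f : Fin (2 * n) → ℕ} (hf : IsFlag f) {g : Mat n}
    (hg : BlockTriangular g f) (S : Mat n) : cut f (congr g (cut f S)) = cut f (congr g S) := by
  rw [cut_eq_cut_iff]
  intro x y hxy
  rw [congr_apply, congr_apply]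
  refine Finset.sum_congr rfl fun b _ => Finset.sum_congr rfl fun a _ => ?_
  by_cases ha : f x < f a
  · rw [hg ha, zero_mul, zero_mul, zero_mul, zero_mul]
  · by_cases hb : f y < f b
    · rw [hg hb, mul_zero, mul_zero]
    · have := hf.rev_le b y (not_lt.1 hb)
      rw [cut_apply, if_pos (by omega)]

theorem cut_congr_of_cut_eq {n : ℕ} {f : Fin (2 * n) → ℕ} (hf : IsFlag f) {g : Mat n}
    (hg : BlockTriangular g f) {S T : Mat n} (h : cut f S = cut f T) :
    cut f (congr g S) = cut f (congr g T) := by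
  rw [← cut_congr_cut hf hg, h, cut_congr_cut hf hg]

theorem cut_symm {n : ℕ} {S : Mat n} (hS : Sᵀ = S) :
    (cut Fin.val S)ᵀ = cut Fin.val S := by
  ext x y
  rw [Matrix.transpose_apply, cut_apply, cut_apply]
  have h : S y x = S x y := congrFun (congrFun hS x) y
  rw [h]
  congr 1
  rw [Fin.val_rev, Fin.val_rev, eq_iff_iff]
  omega

theorem cut_cut {n : ℕ} (f : Fin (2 * n) → ℕ) (S : Mat n) : cut f (cut f S) = cut f S := by
  rw [cut_eq_cut_iff]
  intro x y h
  rw [cut_apply, if_pos h]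

/-- Symmetric matrices supported strictly above the antidiagonal. -/
def Adm {n : ℕ} (S : Mat n) : Prop := Sᵀ = S ∧ cut Fin.val S = S

theorem adm_cut {n : ℕ} {S : Mat n} (hS : Sᵀ = S) : Adm (cut Fin.val S) :=
  ⟨cut_symm hS, cut_cut _ _⟩

/-! ### Zariski closures of orbits of symmetric matrices -/

/-- The value of a polynomial in the entries of a matrix. -/
noncomputable def peval {n : ℕ} (S : Mat n) (F : MvPolynomial (Fin (2 * n) × Fin (2 * n)) ℂ) : ℂ :=
  MvPolynomial.eval (fun p => S p.1 p.2) F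

/-- `S` lies in the Zariski closure of the Borel orbit of `A`. -/
def InCl {n : ℕ} (A S : Mat n) : Prop :=
  ∀ F : MvPolynomial (Fin (2 * n) × Fin (2 * n)) ℂ,
    (∀ g ∈ borel n, peval (cut Fin.val (congr (g : Mat n) A)) F = 0) → peval S F = 0

theorem inCl_orbit {n : ℕ} (A : Mat n) {g : GL (Fin (2 * n)) ℂ} (hg : g ∈ borel n) :
    InCl A (cut Fin.val (congr (g : Mat n) A)) := fun _ hF => hF g hg

theorem exists_peval_comp {n : ℕ} (L : Mat n →ₗ[ℂ] Mat n) (C : Mat n)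
    (F : MvPolynomial (Fin (2 * n) × Fin (2 * n)) ℂ) :
    ∃ F', ∀ S, peval S F' = peval (L S + C) F := by
  refine ⟨MvPolynomial.bind₁ (fun p => ∑ a, ∑ b, MvPolynomial.C (L (Matrix.single a b 1) p.1 p.2) *
    MvPolynomial.X (a, b) + MvPolynomial.C (C p.1 p.2)) F, fun S => ?_⟩
  unfold peval
  rw [MvPolynomial.eval, MvPolynomial.eval₂Hom_bind₁]
  congr 2
  ext p
  have hS : S = ∑ a, ∑ b, S a b • Matrix.single a b (1 : ℂ) := by
    conv_lhs => rw [Matrix.matrix_eq_sum_single S]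
    simp [Matrix.smul_single]
  have hL : L S p.1 p.2 = ∑ a, ∑ b, S a b * L (Matrix.single a b 1) p.1 p.2 := by
    conv_lhs => rw [hS]
    simp only [map_sum, map_smul, Matrix.sum_apply, Matrix.smul_apply, smul_eq_mul]
  rw [Matrix.add_apply, hL]
  simp [mul_comm]

/-- Polynomials pull back along affine maps, so an affine map sending the orbit into the closure
sends the whole closure into it. -/
theorem InCl.map {n : ℕ} {A S : Mat n} (h : InCl A S) (L : Mat n →ₗ[ℂ] Mat n) (C : Mat n)
    (hL : ∀ g ∈ borel n, InCl A (L (cut Fin.val (congr (g : Mat n) A)) + C)) :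
    InCl A (L S + C) := by
  intro F hF
  obtain ⟨F', hF'⟩ := exists_peval_comp L C F
  rw [← hF']
  refine h F' fun g hg => ?_
  rw [hF']
  exact hL g hg F hF

/-- `S ↦ cut f (gᵀ S g)` as a linear map. -/
def cutCongr {n : ℕ} (f : Fin (2 * n) → ℕ) (g : Mat n) : Mat n →ₗ[ℂ] Mat n where
  toFun S := cut f (congr g S)
  map_add' S T := by
    ext x y
    simp only [congr, Matrix.mul_add, Matrix.add_mul, cut_apply, Matrix.add_apply]
    split_ifs <;> simp
  map_smul' c S := by
    ext x y
    simp only [congr, Matrix.mul_smul, Matrix.smul_mul, cut_apply, Matrix.smul_apply]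
    split_ifs <;> simp

theorem cutCongr_apply {n : ℕ} (f : Fin (2 * n) → ℕ) (g S : Mat n) :
    cutCongr f g S = cut f (congr g S) := rfl

theorem InCl.congr {n : ℕ} {A S : Mat n} (h : InCl A S) {g : GL (Fin (2 * n)) ℂ}
    (hg : g ∈ borel n) : InCl A (cut Fin.val (congr (g : Mat n) S)) := by
  have := h.map (cutCongr Fin.val (g : Mat n)) 0 fun k hk => by
    rw [add_zero, cutCongr_apply, cut_congr_cut isFlag_val hg.2, ← congr_mul, ← Units.val_mul]
    exact inCl_orbit A (mul_mem hk hg)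
  rwa [add_zero] at this

theorem InCl.trans {n : ℕ} {A S T : Mat n} (h : InCl A S) (h' : InCl S T) : InCl A T :=
  fun F hF => h' F fun _ hg => h.congr hg F hF

theorem isClosed_inCl {n : ℕ} (A : Mat n) : IsClosed {S | InCl A S} := by
  have : {S | InCl A S} = ⋂ F : {F : MvPolynomial (Fin (2 * n) × Fin (2 * n)) ℂ //
      ∀ g ∈ borel n, peval (cut Fin.val (SpOrbit.congr (g : Mat n) A)) F = 0},
      {S | peval S F.1 = 0} := by
    ext S
    simp [InCl]
  rw [this]
  refine isClosed_iInter fun F => isClosed_eq ?_ continuous_const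
  unfold peval
  refine (MvPolynomial.continuous_eval F.1).comp ?_
  fun_prop

/-- Zariski closed sets are closed in the classical topology, and the complement of a finite set is
dense in `ℂ`. All limit arguments below go through this statement. -/
theorem InCl.of_curve {n : ℕ} {A : Mat n} {γ : ℂ → Mat n} (hγ : Continuous γ) {T : Set ℂ}
    (hT : T.Finite) (h : ∀ t, t ∉ T → InCl A (γ t)) (t : ℂ) : InCl A (γ t) := by
  have hc : IsClosed {t | InCl A (γ t)} := (isClosed_inCl A).preimage hγ
  have hd : Dense Tᶜ := hT.countable.dense_compl ℂ
  have : (Set.univ : Set ℂ) ⊆ {t | InCl A (γ t)} := by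
    rw [← hd.closure_eq]
    exact hc.closure_subset_iff.2 h
  exact this (Set.mem_univ t)

/-! ### Elements of the symplectic group -/

/-- The nilpotent element `e_{x,z} ± e_{-z,-x}` of the symplectic Lie algebra. -/
def rootNil {n : ℕ} (x z : Fin (2 * n)) : Mat n :=
  Matrix.single x z 1 - (eta x * eta z) • Matrix.single z.rev x.rev 1

theorem rootNil_sq {n : ℕ} {x z : Fin (2 * n)} (h : x ≠ z) : rootNil x z * rootNil x z = 0 := by
  have h1 := rev_ne x
  have h2 := rev_ne z
  simp only [rootNil, Matrix.sub_mul, Matrix.mul_sub, Matrix.smul_mul, Matrix.mul_smul]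
  rw [Matrix.single_mul_single_of_ne _ _ _ _ h.symm, Matrix.single_mul_single_of_ne _ _ _ _ h2.symm,
    Matrix.single_mul_single_of_ne _ _ _ _ h1, Matrix.single_mul_single_of_ne]
  · simp
  · exact fun e => h (Fin.rev_injective e)

theorem rootNil_symp {n : ℕ} (x z : Fin (2 * n)) :
    (rootNil x z)ᵀ * J n + J n * rootNil x z = 0 := by
  rw [symp_iff]
  intro a b
  change rootNil x z b a * eta b + eta a * rootNil x z a.rev b.rev = 0
  have h1 := eta_mul_self x
  have h2 := eta_mul_self z
  simp only [rootNil, Matrix.sub_apply, Matrix.smul_apply, Matrix.single_apply, smul_eq_mul,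
    Fin.rev_inj]
  have e1 : (x = a.rev ∧ z = b.rev) ↔ (z.rev = b ∧ x.rev = a) := by
    rw [← Fin.rev_eq_iff, ← Fin.rev_eq_iff, and_comm]
  have e2 : (z = a ∧ x = b) ↔ (x = b ∧ z = a) := and_comm
  simp only [e1, e2]
  split_ifs with h3 h4 h4
  · obtain ⟨rfl, rfl⟩ := h3
    obtain ⟨-, rfl⟩ := h4
    rw [eta_rev]
    ring
  · obtain ⟨rfl, rfl⟩ := h3
    linear_combination - (eta x) * h2
  · obtain ⟨rfl, rfl⟩ := h4
    rw [eta_rev, eta_rev]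
    linear_combination (eta x) * h2
  · simp

/-- The root subgroup element `1 + c (e_{x,z} ± e_{-z,-x})`. -/
def rootElt {n : ℕ} {x z : Fin (2 * n)} (h : x ≠ z) (c : ℂ) : GL (Fin (2 * n)) ℂ where
  val := 1 + c • rootNil x z
  inv := 1 - c • rootNil x z
  val_inv := by
    have := rootNil_sq h
    simp [Matrix.add_mul, Matrix.mul_sub, this]
  inv_val := by
    have := rootNil_sq h
    simp [Matrix.sub_mul, Matrix.mul_add, this]

theorem rootElt_mem_Sp {n : ℕ} {x z : Fin (2 * n)} (h : x ≠ z) (c : ℂ) : rootElt h c ∈ Sp n := by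
  have h1 := rootNil_sq h
  have h2 := rootNil_symp x z
  have h3 : (rootNil x z)ᵀ * J n = -(J n * rootNil x z) := eq_neg_of_add_eq_zero_left h2
  change (1 + c • rootNil x z)ᵀ * J n * (1 + c • rootNil x z) = J n
  rw [Matrix.transpose_add, Matrix.transpose_one, Matrix.transpose_smul, Matrix.add_mul,
    Matrix.smul_mul, h3]
  simp [Matrix.add_mul, Matrix.mul_add, Matrix.mul_assoc, h1]

theorem rootElt_mem_parab {n : ℕ} {f : Fin (2 * n) → ℕ} (hf : IsFlag f) {x z : Fin (2 * n)}
    (h : x ≠ z) (hxz : f x ≤ f z) (c : ℂ) : rootElt h c ∈ parab f := by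
  refine ⟨rootElt_mem_Sp h c, ?_⟩
  intro a b hab
  have h1 : a ≠ b := fun e => by rw [e] at hab; exact lt_irrefl _ hab
  have h2 : ¬ (x = a ∧ z = b) := by
    rintro ⟨rfl, rfl⟩
    omega
  have h3 : ¬ (z.rev = a ∧ x.rev = b) := by
    rintro ⟨rfl, rfl⟩
    have := hf.rev_le x z hxz
    omega
  change (1 + c • rootNil x z : Mat n) a b = 0
  simp [rootNil, h1, h2, h3]

/-- The summand `e_{x,z}` adds `c` times row and column `x` to row and column `z`. The mirror
summand adds multiples of row and column `-z` to row and column `-x`; the hypotheses remove its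
contributions and the mixed terms at the entry considered. The quadratic term lives only at `(z,
z)`. -/
theorem congr_rootElt_apply_sq {n : ℕ} {x z : Fin (2 * n)} (h : x ≠ z) (c : ℂ) (S : Mat n)
    {a b : Fin (2 * n)} (h1 : a = x.rev → S z.rev b = 0) (h2 : b = x.rev → S a z.rev = 0)
    (h4 : a = x.rev → b = x.rev → S z.rev z.rev = 0)
    (h5 : ¬ (a = z ∧ b = x.rev)) (h6 : ¬ (a = x.rev ∧ b = z)) :
    congr (rootElt h c : Mat n) S a b =
      S a b + c * ((if b = z then S a x else 0) + if a = z then S x b else 0) +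
        c * c * (if a = z then if b = z then S x x else 0 else 0) := by
  have key : ∀ (M : Mat n) (u v : Fin (2 * n)), (M * (rootElt h c : Mat n)) u v = M u v +
      c * ((if v = z then M u x else 0) - eta x * eta z * if v = x.rev then M u z.rev else 0) := by
    intro M u v
    change (M * (1 + c • rootNil x z)) u v = _
    rw [Matrix.mul_add, Matrix.mul_one, Matrix.mul_smul, Matrix.add_apply, Matrix.smul_apply,
      rootNil, Matrix.mul_sub, Matrix.sub_apply, Matrix.mul_smul, Matrix.smul_apply, smul_eq_mul,
      smul_eq_mul]
    congr 3
    · split_ifs with hv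
      · rw [hv, Matrix.mul_single_apply_same, mul_one]
      · rw [Matrix.mul_single_apply_of_ne _ _ _ _ _ hv]
    · split_ifs with hv
      · rw [hv, Matrix.mul_single_apply_same, mul_one]
      · rw [Matrix.mul_single_apply_of_ne _ _ _ _ _ hv]
  have key2 : ∀ u v : Fin (2 * n), ((rootElt h c : Mat n)ᵀ * S) u v = S u v +
      c * ((if u = z then S x v else 0) - eta x * eta z * if u = x.rev then S z.rev v else 0) := by
    intro u v
    have := key Sᵀ v u
    rwa [← Matrix.transpose_apply (Sᵀ * _), Matrix.transpose_mul, Matrix.transpose_transpose] at this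
  rw [congr, key, key2, key2, key2]
  by_cases ha' : a = x.rev
  · have hs := h1 ha'
    have hbz : ¬ b = z := fun e => h6 ⟨ha', e⟩
    by_cases hb' : b = x.rev
    · have haz : ¬ a = z := fun e => h5 ⟨e, hb'⟩
      simp only [if_pos ha', if_pos hb', if_neg haz, if_neg hbz, hs, h2 hb', h4 ha' hb']
      ring
    · simp only [if_pos ha', if_neg hb', if_neg hbz, hs, ite_self]
      ring
  · by_cases hb' : b = x.rev
    · have haz : ¬ a = z := fun e => h5 ⟨e, hb'⟩
      simp only [if_neg ha', if_pos hb', if_neg haz, h2 hb', mul_zero, sub_zero, add_zero]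
    · by_cases ha : a = z
      · by_cases hb : b = z
        · simp only [if_neg ha', if_neg hb', if_pos ha, if_pos hb]
          ring
        · simp only [if_neg ha', if_neg hb', if_pos ha, if_neg hb]
          ring
      · simp only [if_neg ha', if_neg hb', if_neg ha, mul_zero, sub_zero, add_zero]

theorem congr_rootElt_apply {n : ℕ} {x z : Fin (2 * n)} (h : x ≠ z) (c : ℂ) (S : Mat n)
    {a b : Fin (2 * n)} (h1 : a = x.rev → S z.rev b = 0) (h2 : b = x.rev → S a z.rev = 0)
    (h3 : a = z → b = z → S x x = 0) (h4 : a = x.rev → b = x.rev → S z.rev z.rev = 0)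
    (h5 : ¬ (a = z ∧ b = x.rev)) (h6 : ¬ (a = x.rev ∧ b = z)) :
    congr (rootElt h c : Mat n) S a b =
      S a b + c * ((if b = z then S a x else 0) + if a = z then S x b else 0) := by
  rw [congr_rootElt_apply_sq h c S h1 h2 h4 h5 h6, add_eq_left]
  split_ifs with h7 h8
  · rw [h3 h7 h8, mul_zero]
  · rw [mul_zero]
  · rw [mul_zero]

/-- The monomial matrix attached to a signed permutation. -/
def monomial {n : ℕ} (π : Perm (Fin (2 * n))) (d : Fin (2 * n) → ℂ) : Mat n :=
  Matrix.of fun a b => if a = π b then d b else 0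

theorem monomial_mul {n : ℕ} (π ρ : Perm (Fin (2 * n))) (d e : Fin (2 * n) → ℂ) :
    monomial π d * monomial ρ e = monomial (π * ρ) fun b => d (ρ b) * e b := by
  ext a b
  simp [monomial, Matrix.mul_apply]
  rfl

theorem monomial_one {n : ℕ} : monomial (1 : Perm (Fin (2 * n))) (fun _ => 1) = 1 := by
  ext a b
  simp [monomial, Matrix.one_apply]
  rfl

theorem congr_monomial_apply {n : ℕ} (π : Perm (Fin (2 * n))) (d : Fin (2 * n) → ℂ) (S : Mat n)
    (x y : Fin (2 * n)) : congr (monomial π d) S x y = d x * d y * S (π x) (π y) := by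
  rw [congr_apply]
  simp only [monomial, Matrix.of_apply, ite_mul, zero_mul, mul_ite, mul_zero]
  simp
  ring

theorem monomial_symp {n : ℕ} {π : Perm (Fin (2 * n))} (hπ : RevComm π) {d : Fin (2 * n) → ℂ}
    (hd : ∀ x, d x * d x.rev * eta (π x) = eta x) :
    (monomial π d)ᵀ * J n * monomial π d = J n := by
  ext x y
  have := congr_monomial_apply π d (J n) x y
  rw [congr] at this
  rw [this, J_apply, J_apply]
  by_cases h : y = x.rev
  · rw [if_pos h, if_pos (by rw [h, hπ]), h, hd]
  · rw [if_neg h, if_neg, mul_zero]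
    rw [← hπ, π.injective.eq_iff]
    exact h

/-- The monomial matrix attached to a signed permutation as an invertible matrix. -/
noncomputable def monomialElt {n : ℕ} (π : Perm (Fin (2 * n))) (d : Fin (2 * n) → ℂ)
    (hd : ∀ x, d x ≠ 0) : GL (Fin (2 * n)) ℂ where
  val := monomial π d
  inv := monomial π⁻¹ fun b => (d (π⁻¹ b))⁻¹
  val_inv := by
    rw [monomial_mul, mul_inv_cancel, ← monomial_one]
    congr 1
    ext b
    exact mul_inv_cancel₀ (hd _)
  inv_val := by
    rw [monomial_mul, inv_mul_cancel, ← monomial_one]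
    congr 1
    ext b
    rw [perm_inv_apply]
    exact inv_mul_cancel₀ (hd _)

/-! ### Matrices attached to involutions -/

/-- `S` is a symmetric matrix whose nonzero entries are at the positions `(x, -π x)` with
`x < π x`. -/
structure IsType {n : ℕ} (π : Perm (Fin (2 * n))) (S : Mat n) : Prop where
  symm : Sᵀ = S
  ne_zero : ∀ x y, x < y.rev → π x = y.rev → S x y ≠ 0
  eq_zero : ∀ x y, ¬ (x < y.rev ∧ π x = y.rev) → S x y = 0

theorem IsType.apply_comm {n : ℕ} {π : Perm (Fin (2 * n))} {S : Mat n} (h : IsType π S)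
    (x y : Fin (2 * n)) : S x y = S y x := (congrFun (congrFun h.symm y) x).symm ▸ rfl

theorem IsType.adm {n : ℕ} {π : Perm (Fin (2 * n))} {S : Mat n} (h : IsType π S) : Adm S := by
  refine ⟨h.symm, ?_⟩
  ext x y
  rw [cut_apply]
  split_ifs with hxy
  · rfl
  · exact (h.eq_zero x y fun e => hxy (Fin.lt_def.1 e.1)).symm

/-- The diagonal torus suffices: it multiplies the entry at `(x, -π x)` by `d x * d (-π x)`, so a
square root of the required ratio is placed at both indices. -/
theorem IsType.inCl {n : ℕ} {π : Perm (Fin (2 * n))} (hπ : RevComm π) (hinv : ∀ a, π (π a) = a)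
    {S T : Mat n} (hS : IsType π S) (hT : IsType π T) : InCl S T := by
  have hsq : ∀ z : ℂ, ∃ r : ℂ, r * r = z := fun z => by
    obtain ⟨r, hr⟩ := IsAlgClosed.exists_pow_nat_eq z (n := 2) (by norm_num)
    exact ⟨r, by rw [← hr, pow_two]⟩
  choose sq hsq using hsq
  set ρ : Fin (2 * n) → ℂ := fun x => T x (π x).rev / S x (π x).rev with hρ
  have hlt : ∀ x, x < π x → S x (π x).rev ≠ 0 ∧ T x (π x).rev ≠ 0 := fun x hx =>
    ⟨hS.ne_zero _ _ (by rwa [Fin.rev_rev]) (Fin.rev_rev _).symm,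
      hT.ne_zero _ _ (by rwa [Fin.rev_rev]) (Fin.rev_rev _).symm⟩
  have hsq0 : ∀ x, x < π x → sq (ρ x) ≠ 0 := fun x hx h0 => by
    have h1 := hsq (ρ x)
    rw [h0, zero_mul] at h1
    exact div_ne_zero (hlt x hx).2 (hlt x hx).1 h1.symm
  -- The inverse at the negated index makes the diagonal matrix symplectic. The two branches do not
  -- conflict, since `x < π x` is equivalent to `π (-x) < -x`.
  set d : Fin (2 * n) → ℂ := fun x =>
    if x < π x then sq (ρ x) else if π x < x then (sq (ρ x.rev))⁻¹ else 1 with hd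
  have hrev : ∀ x, π x < x → x.rev < π x.rev := fun x hx => by rwa [hπ, Fin.rev_lt_rev]
  have hd0 : ∀ x, d x ≠ 0 := by
    intro x
    simp only [hd]
    split_ifs with h1 h2
    · exact hsq0 x h1
    · exact inv_ne_zero (hsq0 _ (hrev x h2))
    · exact one_ne_zero
  have hdd : ∀ x, d x * d x.rev = 1 := by
    intro x
    simp only [hd, Fin.rev_rev]
    rcases lt_trichotomy x (π x) with h1 | h1 | h1
    · have h2 : π x.rev < x.rev := by rwa [hπ, Fin.rev_lt_rev]
      rw [if_pos h1, if_neg h2.not_gt, if_pos h2]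
      exact mul_inv_cancel₀ (hsq0 x h1)
    · have h2 : π x.rev = x.rev := by rw [hπ, ← h1]
      rw [if_neg h1.not_lt, if_neg h1.not_gt, if_neg h2.not_gt, if_neg h2.not_lt, one_mul]
    · rw [if_neg h1.not_gt, if_pos h1, if_pos (hrev x h1)]
      exact inv_mul_cancel₀ (hsq0 _ (hrev x h1))
  have hg : monomialElt 1 d hd0 ∈ borel n := by
    refine ⟨monomial_symp RevComm.one fun x => by rw [hdd, one_mul]; rfl, fun a b hab => ?_⟩
    change (if a = (1 : Perm (Fin (2 * n))) b then d b else 0) = 0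
    rw [if_neg]
    exact hab.ne'
  have := inCl_orbit S hg
  convert this using 1
  ext x y
  change T x y = if _ then SpOrbit.congr (monomial 1 d) S x y else 0
  rw [congr_monomial_apply, Equiv.Perm.one_apply, Equiv.Perm.one_apply]
  split_ifs with h
  · by_cases hxy : π x = y.rev
    · have hy : y = (π x).rev := by rw [hxy, Fin.rev_rev]
      have hx : x < π x := by rw [hxy]; exact h
      have hyx : π y = x.rev := by rw [hy, hπ, hinv]
      have hyy : y < π y := by rw [hyx, hy]; exact Fin.rev_lt_rev.2 hx
      -- By symmetry the ratios at `x` and at `y = -π x` agree, so the chosen square roots agree as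
      -- well and multiply to the ratio.
      have hρy : ρ y = ρ x := by
        simp only [hρ]
        rw [hyx, Fin.rev_rev, hT.apply_comm y x, hS.apply_comm y x, ← hy]
      have e1 : d x = sq (ρ x) := if_pos hx
      have e2 : d y = sq (ρ x) := by rw [← hρy]; exact if_pos hyy
      rw [e1, e2, hsq]
      simp only [hρ]
      rw [← hy, div_mul_cancel₀]
      exact hS.ne_zero x y h hxy
    · rw [hS.eq_zero x y fun e => hxy e.2, hT.eq_zero x y fun e => hxy e.2, mul_zero]
  · exact hT.eq_zero x y fun e => h e.1

/-! ### Minimal parabolic subgroups -/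

/-- The flag stabilised by the `i`-th minimal parabolic subgroup. -/
def blk {n : ℕ} (i : Fin n) (x : Fin (2 * n)) : ℕ :=
  if x.val = i.val + 1 then i.val else if x.val = 2 * n - 1 - i.val then 2 * n - 2 - i.val
  else x.val

theorem isFlag_blk {n : ℕ} (i : Fin n) : IsFlag (blk i) where
  mono := by
    intro a b h
    rw [Fin.le_def] at h
    have := i.isLt
    have := a.isLt
    have := b.isLt
    unfold blk
    split_ifs <;> omega
  rev_le := by
    intro a b h
    have := i.isLt
    have := a.isLt
    have := b.isLt
    unfold blk at *
    simp only [Fin.val_rev]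
    split_ifs at h ⊢ <;> omega

theorem blk_lt_iff {n : ℕ} {i : Fin n} {x y : Fin (2 * n)} :
    blk i x < blk i y.rev ↔ x < y.rev ∧ ¬ (x = pos i ∧ y = (nxt i).rev) ∧
      ¬ (x = (nxt i).rev ∧ y = pos i) := by
  have := i.isLt
  have := x.isLt
  have := y.isLt
  simp only [blk, Fin.lt_def, Fin.ext_iff, Fin.val_rev, val_pos, val_nxt]
  constructor
  · intro h
    split_ifs at h <;> omega
  · rintro ⟨h1, h2, h3⟩
    split_ifs <;> omega

theorem lt_rev_comm {n : ℕ} {x y : Fin (2 * n)} (h : x < y.rev) : y < x.rev := by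
  rw [Fin.lt_def, Fin.val_rev] at *
  omega

/-- The symmetric matrix spanning the positions of the simple root. -/
def simpleMat {n : ℕ} (i : Fin n) : Mat n :=
  Matrix.of fun x y => if (x = pos i ∧ y = (nxt i).rev) ∨ (x = (nxt i).rev ∧ y = pos i)
    then 1 else 0

theorem simpleMat_symm {n : ℕ} (i : Fin n) : (simpleMat i)ᵀ = simpleMat i := by
  ext x y
  simp only [simpleMat, Matrix.transpose_apply, Matrix.of_apply]
  congr 1
  rw [eq_iff_iff]
  tauto

theorem pos_lt_nxt {n : ℕ} (i : Fin n) : pos i < nxt i := by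
  rw [Fin.lt_def, val_pos, val_nxt]
  omega

theorem simpleMat_pos {n : ℕ} (i : Fin n) : simpleMat i (pos i) (nxt i).rev = 1 :=
  if_pos (Or.inl ⟨rfl, rfl⟩)

theorem simpleMat_of_blk_lt {n : ℕ} {i : Fin n} {x y : Fin (2 * n)} (h : blk i x < blk i y.rev) :
    simpleMat i x y = 0 := by
  rw [blk_lt_iff] at h
  exact if_neg (by tauto)

theorem simpleMat_of_not_lt {n : ℕ} {i : Fin n} {x y : Fin (2 * n)} (h : ¬ x < y.rev) :
    simpleMat i x y = 0 := by
  refine if_neg ?_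
  rintro (⟨rfl, rfl⟩ | ⟨rfl, rfl⟩)
  · rw [Fin.rev_rev] at h
    exact h (pos_lt_nxt i)
  · exact h (Fin.rev_lt_rev.2 (pos_lt_nxt i))

theorem Adm.symm_apply {n : ℕ} {S : Mat n} (h : Adm S) (x y : Fin (2 * n)) : S x y = S y x :=
  (congrFun (congrFun h.1 y) x).symm ▸ rfl

theorem Adm.eq_zero {n : ℕ} {S : Mat n} (h : Adm S) {x y : Fin (2 * n)} (hxy : ¬ x < y.rev) :
    S x y = 0 := by
  rw [← h.2, cut_apply, if_neg]
  exact fun h => hxy (Fin.lt_def.2 h)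

theorem adm_ext {n : ℕ} {i : Fin n} {S T : Mat n} (hS : Adm S) (hT : Adm T)
    (h : cut (blk i) S = cut (blk i) T) (h' : S (pos i) (nxt i).rev = T (pos i) (nxt i).rev) :
    S = T := by
  rw [cut_eq_cut_iff] at h
  ext x y
  by_cases hxy : blk i x < blk i y.rev
  · exact h x y hxy
  · by_cases hlt : x < y.rev
    · rw [blk_lt_iff] at hxy
      have : (x = pos i ∧ y = (nxt i).rev) ∨ (x = (nxt i).rev ∧ y = pos i) := by tauto
      rcases this with ⟨rfl, rfl⟩ | ⟨rfl, rfl⟩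
      · exact h'
      · rw [hS.symm_apply, hT.symm_apply, h']
    · rw [hS.eq_zero hlt, hT.eq_zero hlt]

theorem adm_cut_add {n : ℕ} (i : Fin n) {M : Mat n} (hM : Mᵀ = M) (e : ℂ) :
    Adm (cut (blk i) M + e • simpleMat i) := by
  constructor
  · ext x y
    rw [Matrix.transpose_apply, Matrix.add_apply, Matrix.add_apply, Matrix.smul_apply,
      Matrix.smul_apply, cut_apply, cut_apply]
    have h1 : M y x = M x y := congrFun (congrFun hM x) y
    have h2 : simpleMat i y x = simpleMat i x y := congrFun (congrFun (simpleMat_symm i) x) y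
    rw [h1, h2]
    congr 1
    congr 1
    rw [eq_iff_iff, blk_lt_iff, blk_lt_iff]
    have : y < x.rev ↔ x < y.rev := ⟨lt_rev_comm, lt_rev_comm⟩
    tauto
  · ext x y
    rw [cut_apply]
    split_ifs with h
    · rfl
    · have h1 : ¬ blk i x < blk i y.rev := fun e =>
        h (Fin.lt_def.1 (blk_lt_iff.1 e).1)
      rw [Matrix.add_apply, Matrix.smul_apply, simpleMat_of_not_lt fun e => h (Fin.lt_def.1 e),
        cut_apply, if_neg h1]
      simp

theorem cut_cut_add {n : ℕ} (i : Fin n) (M : Mat n) (e : ℂ) :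
    cut (blk i) (cut (blk i) M + e • simpleMat i) = cut (blk i) M := by
  rw [cut_eq_cut_iff]
  intro x y h
  rw [Matrix.add_apply, Matrix.smul_apply, simpleMat_of_blk_lt h, cut_apply, if_pos h]
  simp

theorem cut_add_pos {n : ℕ} (i : Fin n) (M : Mat n) (e : ℂ) :
    (cut (blk i) M + e • simpleMat i) (pos i) (nxt i).rev = e := by
  rw [Matrix.add_apply, Matrix.smul_apply, simpleMat_pos, cut_apply, if_neg]
  · simp
  · rw [blk_lt_iff]
    tauto

theorem Adm.eq_cut_add {n : ℕ} {i : Fin n} {T M : Mat n} (hT : Adm T) (hM : Mᵀ = M)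
    (h : cut (blk i) T = cut (blk i) M) :
    T = cut (blk i) M + T (pos i) (nxt i).rev • simpleMat i :=
  adm_ext hT (adm_cut_add i hM _) (by rw [h, cut_cut_add]) (cut_add_pos i M _).symm

/-! ### The free entry at a descent -/

section Descent

variable {n : ℕ} {τ : Perm (Fin (2 * n))} {i : Fin n} {A : Mat n}

theorem IsType.eq_zero_left (h : IsType τ A) {x y : Fin (2 * n)} (h' : τ x = y.rev → ¬ x < y.rev) :
    A x y = 0 := h.eq_zero x y fun e => h' e.2 e.1

theorem IsType.transpose_eq (h : IsType τ A) (x y : Fin (2 * n)) : A x y = A y x :=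
  h.adm.symm_apply x y

/-- The closure of the orbit of a matrix of type `τ` contains all admissible matrices which agree
with it outside the position of a descent of `τ`. -/
theorem IsType.inCl_of_cut_eq (hτ : RevComm τ) (hinv : ∀ a, τ (τ a) = a) (hd : Desc τ i)
    (hA : IsType τ A) {S : Mat n} (hS : Adm S) (h : cut (blk i) S = cut (blk i) A) :
    InCl A S := by
  have hi := i.isLt
  unfold Desc at hd
  set p := pos i with hp
  set q := nxt i with hq
  have hpv : p.val = i.val := rfl
  have hqv : q.val = i.val + 1 := rfl
  have hne : p ≠ q := pos_ne_nxt i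
  have hcut := cut_eq_cut_iff.1 h
  by_cases hpq : τ p = q
  -- Here the entry at the simple root belongs to the pattern of `τ`. Every nonzero value of it
  -- gives a matrix of type `τ`, and the value zero is reached as a limit.
  · have key : ∀ t : ℂ, t ∉ ({-S p q.rev} : Set ℂ) → InCl A (S + t • simpleMat i) := by
      intro t ht
      have hval : ∀ x y, (x = p ∧ y = q.rev) ∨ (x = q.rev ∧ y = p) →
          (S + t • simpleMat i) x y ≠ 0 := by
        intro x y hxy
        have h1 : S x y = S p q.rev := by
          rcases hxy with ⟨rfl, rfl⟩ | ⟨rfl, rfl⟩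
          · rfl
          · rw [hS.symm_apply]
        have h2 : simpleMat i x y = 1 := if_pos hxy
        rw [Matrix.add_apply, Matrix.smul_apply, h1, h2, smul_eq_mul, mul_one]
        intro h0
        exact ht (eq_neg_of_add_eq_zero_right h0)
      have hval' : ∀ x y, ¬ ((x = p ∧ y = q.rev) ∨ (x = q.rev ∧ y = p)) → x < y.rev →
          (S + t • simpleMat i) x y = A x y := by
        intro x y hxy hlt
        have hb : blk i x < blk i y.rev := by
          rw [blk_lt_iff]
          tauto
        rw [Matrix.add_apply, Matrix.smul_apply, simpleMat_of_blk_lt hb, smul_zero, add_zero]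
        exact hcut x y hb
      refine hA.inCl hτ hinv ⟨?_, ?_, ?_⟩
      · rw [Matrix.transpose_add, Matrix.transpose_smul, simpleMat_symm, hS.1]
      · intro x y h1 h2
        by_cases hxy : (x = p ∧ y = q.rev) ∨ (x = q.rev ∧ y = p)
        · exact hval x y hxy
        · rw [hval' x y hxy h1]
          exact hA.ne_zero x y h1 h2
      · intro x y hxy
        by_cases hlt : x < y.rev
        · rw [hval' x y _ hlt]
          · exact hA.eq_zero x y hxy
          · rintro (⟨rfl, rfl⟩ | ⟨rfl, rfl⟩)
            · exact hxy ⟨hlt, by rw [hpq, Fin.rev_rev]⟩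
            · exact hxy ⟨hlt, by rw [hτ, ← hpq, hinv]⟩
        · rw [Matrix.add_apply, Matrix.smul_apply, hS.eq_zero hlt, simpleMat_of_not_lt hlt]
          simp
    have := InCl.of_curve (γ := fun t => S + t • simpleMat i) (by fun_prop) (Set.finite_singleton _)
      key 0
    simpa using this
  · have hA0 : A p q.rev = 0 := hA.eq_zero_left (by rw [Fin.rev_rev]; exact fun e => absurd e hpq)
    -- it suffices to find a root element which only changes the entry at the simple root
    suffices hs : ∃ (x z : Fin (2 * n)) (hxz : x ≠ z), x ≤ z ∧ ∃ D : ℂ, D ≠ 0 ∧ ∀ c,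
        (∀ a b, blk i a < blk i b.rev → congr (rootElt hxz c : Mat n) A a b = A a b) ∧
        congr (rootElt hxz c : Mat n) A p q.rev = c * D by
      obtain ⟨x, z, hxz, hle, D, hD, hc⟩ := hs
      obtain ⟨h1, h2⟩ := hc (S p q.rev / D)
      rw [div_mul_cancel₀ _ hD] at h2
      have hg : rootElt hxz (S p q.rev / D) ∈ borel n := rootElt_mem_parab isFlag_val hxz hle _
      have : S = cut Fin.val (congr (rootElt hxz (S p q.rev / D) : Mat n) A) := by
        refine adm_ext (i := i) hS (adm_cut (congr_symm _ hA.symm)) ?_ ?_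
        · rw [cut_cut_val (isFlag_blk i), h]
          exact (cut_eq_cut_iff.2 h1).symm
        · rw [cut_apply, if_pos, h2]
          rw [Fin.rev_rev]
          exact pos_lt_nxt i
      rw [this]
      exact inCl_orbit A hg
    have htp := (τ p).isLt
    have htq := (τ q).isLt
    have hpl := p.isLt
    rw [Fin.lt_def] at hd
    by_cases hb : q < τ p
    · rw [Fin.lt_def] at hb
      -- The pivot is the entry of `A` at `(p, -τ p)`: column `-τ p` is added to column `-q`. For
      -- the long simple root the target `(p, -q)` is diagonal, so the row and the column operation
      -- both contribute and the pivot is doubled.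
      refine ⟨(τ p).rev, q.rev, ?_, ?_, A p (τ p).rev + if p = q.rev then A p (τ p).rev else 0,
        ?_, fun c => ?_⟩
      · intro e
        exact hpq (Fin.rev_injective e)
      · rw [Fin.rev_le_rev, Fin.le_def]
        omega
      · have : A p (τ p).rev ≠ 0 := hA.ne_zero _ _ (by rw [Fin.rev_rev, Fin.lt_def]; omega)
          (Fin.rev_rev _).symm
        split_ifs
        · rw [← two_mul]
          exact mul_ne_zero two_ne_zero this
        · rwa [add_zero]
      have key : ∀ a b, a < b.rev → congr (rootElt (x := (τ p).rev) (z := q.rev)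
          (fun e => hpq (Fin.rev_injective e)) c : Mat n) A a b = A a b + c *
            ((if b = q.rev then A a (τ p).rev else 0) + if a = q.rev then A (τ p).rev b else 0) := by
        intro a b hab
        rw [Fin.lt_def, Fin.val_rev] at hab
        refine congr_rootElt_apply _ c A ?_ ?_ ?_ ?_ ?_ ?_
        all_goals try rw [Fin.rev_rev]
        all_goals try rw [Fin.rev_rev]
        · rintro rfl
          refine hA.eq_zero_left fun e => ?_
          have := congrArg Fin.val e
          rw [Fin.val_rev] at this
          omega
        · rintro rfl
          rw [hA.transpose_eq]
          refine hA.eq_zero_left fun e => ?_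
          have := congrArg Fin.val e
          rw [Fin.val_rev] at this
          omega
        · rintro rfl rfl
          refine hA.eq_zero_left fun e => ?_
          rw [hτ, hinv, Fin.rev_rev] at e
          have := congrArg Fin.val e
          rw [Fin.val_rev] at this hab
          omega
        · rintro rfl rfl
          refine hA.eq_zero_left fun e => ?_
          have := congrArg Fin.val e
          rw [Fin.val_rev] at this
          omega
        · rintro ⟨rfl, rfl⟩
          rw [Fin.val_rev] at hab
          omega
        · rintro ⟨rfl, rfl⟩
          rw [Fin.val_rev] at hab
          omega
      have hz : ∀ a, a ≠ p → A a (τ p).rev = 0 := fun a ha =>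
        hA.eq_zero_left fun e => absurd (τ.injective (by rw [e, Fin.rev_rev])) ha
      constructor
      · intro a b hab
        rw [blk_lt_iff] at hab
        rw [key a b hab.1, add_eq_left, mul_eq_zero]
        right
        rw [hA.transpose_eq (τ p).rev b]
        split_ifs with h1 h2 h2
        · rw [hz a fun e => hab.2.1 ⟨e, h1⟩, hz b fun e => hab.2.2 ⟨h2, e⟩, add_zero]
        · rw [hz a fun e => hab.2.1 ⟨e, h1⟩, add_zero]
        · rw [hz b fun e => hab.2.2 ⟨h2, e⟩, add_zero]
        · rw [add_zero]
      · rw [key p q.rev (by rw [Fin.rev_rev]; exact pos_lt_nxt i), hA0, zero_add, if_pos rfl]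
        split_ifs with h1
        · rw [← h1, hA.transpose_eq (τ p).rev p]
        · rfl
    · have hb' : τ q < p ∧ (τ p).val ≤ p.val := by
        have : (τ p).val ≠ q.val := fun e => hpq (Fin.ext e)
        rw [Fin.lt_def] at hb ⊢
        have : (τ q).val ≠ p.val := fun e => by
          have h1 : τ q = p := Fin.ext e
          exact hpq (by rw [← h1, hinv])
        omega
      obtain ⟨hb1, hb2⟩ := hb'
      have hrev : p ≠ q.rev := by
        intro e
        have h1 : τ p = (τ q).rev := by rw [e, hτ]
        have h2 := congrArg Fin.val h1
        have h3 := congrArg Fin.val e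
        rw [Fin.lt_def] at hb1
        rw [Fin.val_rev] at h2 h3
        omega
      have hxz : τ q ≠ p := hb1.ne
      -- Now the pivot is the entry at `(τ q, -q)`, and row `τ q` is added to row `p`.
      refine ⟨τ q, p, hxz, hb1.le, A (τ q) q.rev, ?_, fun c => ?_⟩
      · exact hA.ne_zero _ _ (by rw [Fin.rev_rev]; exact hb1.trans (pos_lt_nxt i))
          (by rw [hinv, Fin.rev_rev])
      rw [Fin.lt_def] at hb1
      have key : ∀ a b, a < b.rev → congr (rootElt hxz c : Mat n) A a b = A a b + c *
            ((if b = p then A a (τ q) else 0) + if a = p then A (τ q) b else 0) := by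
        intro a b hab
        rw [Fin.lt_def, Fin.val_rev] at hab
        refine congr_rootElt_apply _ c A ?_ ?_ ?_ ?_ ?_ ?_
        · rintro rfl
          refine hA.eq_zero_left fun e => ?_
          rw [hτ] at e
          have := congrArg Fin.val e
          rw [Fin.val_rev] at this hab
          rw [Fin.val_rev] at this
          omega
        · rintro rfl
          rw [hA.transpose_eq]
          refine hA.eq_zero_left fun e => ?_
          rw [hτ] at e
          have := congrArg Fin.val e
          rw [Fin.val_rev] at this hab
          rw [Fin.val_rev] at this
          omega
        · rintro rfl rfl
          refine hA.eq_zero_left fun e => ?_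
          rw [hinv] at e
          have := congrArg Fin.val e
          rw [Fin.val_rev] at this
          omega
        · rintro rfl rfl
          rw [Fin.val_rev] at hab
          omega
        · rintro ⟨rfl, rfl⟩
          rw [Fin.val_rev] at hab
          omega
        · rintro ⟨rfl, rfl⟩
          rw [Fin.val_rev] at hab
          omega
      have hz : ∀ a, a ≠ q.rev → A a (τ q) = 0 := fun a ha =>
        hA.eq_zero_left fun e => absurd (τ.injective (by rw [e, hτ])) ha
      constructor
      · intro a b hab
        rw [blk_lt_iff] at hab
        rw [key a b hab.1, add_eq_left, mul_eq_zero]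
        right
        rw [hA.transpose_eq (τ q) b]
        split_ifs with h1 h2 h2
        · rw [hz a fun e => hab.2.2 ⟨e, h1⟩, hz b fun e => hab.2.1 ⟨h2, e⟩, add_zero]
        · rw [hz a fun e => hab.2.2 ⟨e, h1⟩, add_zero]
        · rw [hz b fun e => hab.2.1 ⟨h2, e⟩, add_zero]
        · rw [add_zero]
      · rw [key p q.rev (by rw [Fin.rev_rev]; exact pos_lt_nxt i), hA0, zero_add, if_pos rfl,
          if_neg hrev.symm, zero_add]

end Descent

/-! ### The negative simple root subgroup on a matrix of type `τ` -/

section Saturation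

variable {n : ℕ} {τ : Perm (Fin (2 * n))} {i : Fin n} {A : Mat n}

/-- The closure of the orbit of `A` contains every admissible matrix which agrees with `M` outside
the position of the `i`-th simple root. -/
def Saturated (i : Fin n) (A M : Mat n) : Prop :=
  ∀ T, Adm T → cut (blk i) T = cut (blk i) M → InCl A T

theorem Saturated.of_cut_eq {M N : Mat n} (h : Saturated i A M)
    (hN : cut (blk i) N = cut (blk i) M) : Saturated i A N :=
  fun T hT hTN => h T hT (hTN.trans hN)

/-- A matrix `T` agreeing with the translate of `M` is moved back by `g⁻¹`. Agreement outside the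
simple root survives because the Borel subgroup lies in the minimal parabolic. -/
theorem Saturated.congr {M : Mat n} (h : Saturated i A M) {g : GL (Fin (2 * n)) ℂ}
    (hg : g ∈ borel n) : Saturated i A (congr (g : Mat n) M) := by
  intro T hT hTM
  have hf := isFlag_blk i
  have hgi := borel_le_parab hf (inv_mem hg)
  have e1 : SpOrbit.congr (g : Mat n) (SpOrbit.congr ((g⁻¹ : GL _ ℂ) : Mat n) T) = T := by
    rw [← congr_mul, Units.inv_mul, congr_one]
  have e2 : SpOrbit.congr ((g⁻¹ : GL _ ℂ) : Mat n) (SpOrbit.congr (g : Mat n) M) = M := by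
    rw [← congr_mul, Units.mul_inv, congr_one]
  have h1 := h (cut Fin.val (SpOrbit.congr ((g⁻¹ : GL _ ℂ) : Mat n) T)) (adm_cut (congr_symm _ hT.1))
    (by rw [cut_cut_val hf, cut_congr_of_cut_eq hf hgi.2 hTM, e2])
  have h2 := h1.congr hg
  rwa [cut_congr_cut isFlag_val hg.2, e1, hT.2] at h2

/-- The pairs `(x, z)` and `(-z, -x)` name the same root subgroup; this allows either summand of
`rootNil` to play the leading role in the entry formulas. -/
theorem rootElt_symm_val {x z : Fin (2 * n)} (h : x ≠ z) (h' : z.rev ≠ x.rev) (c : ℂ) :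
    (rootElt h c : Mat n) = (rootElt h' (-(eta x * eta z) * c) : Mat n) := by
  change 1 + c • rootNil x z = 1 + (-(eta x * eta z) * c) • rootNil z.rev x.rev
  have h1 := eta_mul_self x
  have h2 := eta_mul_self z
  unfold rootNil
  rw [Fin.rev_rev, Fin.rev_rev, eta_rev, eta_rev, smul_sub, smul_sub, smul_smul, smul_smul]
  have e : -(eta x * eta z) * c * (-eta z * -eta x) = -c := by
    linear_combination (-(c * eta z * eta z)) * h1 - c * h2
  rw [e, neg_smul, neg_mul, neg_smul, mul_comm (eta x * eta z)]
  abel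

/-- Two root elements act in the same way on a matrix of type `τ` outside the position of the
simple root. -/
theorem congr_rootElt_eq (hA : IsType τ A) {x z x' z' : Fin (2 * n)} (h : x ≠ z) (h' : x' ≠ z')
    (hx : ∀ a, a ≠ z' → A a x = 0) (hx' : ∀ a, a ≠ z → A a x' = 0) (hzx : A z x' ≠ 0)
    (hxr : ∀ b, x.rev < b.rev → A z.rev b = 0) (hxr' : ∀ b, x'.rev < b.rev → A z'.rev b = 0)
    (hzz : z < z.rev → A x x = 0) (hzz' : z' < z'.rev → A x' x' = 0)
    (hr : x.rev < x → A z.rev z.rev = 0) (hr' : x'.rev < x' → A z'.rev z'.rev = 0)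
    (hs : ¬ blk i z < blk i x) (hs' : ¬ z' < x') (t : ℂ) :
    cut (blk i) (congr (rootElt h t : Mat n) A) =
      cut (blk i) (congr (rootElt h' (t * A z' x / A z x') : Mat n) A) := by
  rw [cut_eq_cut_iff]
  intro a b hab
  have hab' : a < b.rev := (blk_lt_iff.1 hab).1
  have hba' : b < a.rev := lt_rev_comm hab'
  have hba : blk i b < blk i a.rev := by
    rw [blk_lt_iff] at hab ⊢
    exact ⟨hba', fun e => hab.2.2 ⟨e.2, e.1⟩, fun e => hab.2.1 ⟨e.2, e.1⟩⟩
  rw [congr_rootElt_apply h t A, congr_rootElt_apply h' _ A]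
  · rw [add_right_inj]
    have key : ∀ a b, t * (if b = z then A a x else 0) =
        t * A z' x / A z x' * if a = z' then A x' b else 0 := by
      intro a b
      by_cases hb : b = z
      · by_cases ha : a = z'
        · rw [if_pos hb, if_pos ha, ha, hb, hA.transpose_eq x' z, div_mul_cancel₀ _ hzx]
        · rw [if_pos hb, if_neg ha, hx a ha, mul_zero, mul_zero]
      · rw [if_neg hb, hA.transpose_eq x' b, hx' b hb, ite_self, mul_zero, mul_zero]
    have h1 := key a b
    have h2 := key b a
    rw [hA.transpose_eq b x, hA.transpose_eq x' a] at h2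
    rw [mul_add, mul_add, h1, h2, add_comm]
  · rintro rfl
    exact hxr' b hab'
  · rintro rfl
    rw [hA.transpose_eq]
    exact hxr' a hba'
  · rintro rfl rfl
    exact hzz' hab'
  · rintro rfl rfl
    exact hr' (by rwa [Fin.rev_rev] at hab')
  · rintro ⟨rfl, rfl⟩
    exact hs' (by rwa [Fin.rev_rev] at hab')
  · rintro ⟨rfl, rfl⟩
    exact hs' (by rwa [Fin.rev_rev] at hba')
  · rintro rfl
    exact hxr b hab'
  · rintro rfl
    rw [hA.transpose_eq]
    exact hxr a hba'
  · rintro rfl rfl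
    exact hzz hab'
  · rintro rfl rfl
    exact hr (by rwa [Fin.rev_rev] at hab')
  · rintro ⟨rfl, rfl⟩
    exact hs (by rwa [Fin.rev_rev] at hab)
  · rintro ⟨rfl, rfl⟩
    exact hs (by rwa [Fin.rev_rev] at hba)

theorem nxt_ne_pos (i : Fin n) : nxt i ≠ pos i := (pos_ne_nxt i).symm

/-- The negative simple root copies row `q` into row `p` and row `-p` into row `-q`. At a descent,
whatever this does outside the simple root is matched by a column operation from the Borel subgroup,
upper triangular because `τ q < τ p`. The claim then follows from the freedom of the simple root
entry for `A` itself. -/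
theorem IsType.saturated_rootElt (hτ : RevComm τ) (hinv : ∀ a, τ (τ a) = a) (hd : Desc τ i)
    (hlast : i.val + 1 = n ∨ (τ (nxt i)).val < n) (hA : IsType τ A) (t : ℂ) :
    Saturated i A (congr (rootElt (nxt_ne_pos i) t : Mat n) A) := by
  have hsat : Saturated i A A := fun T hT h => hA.inCl_of_cut_eq hτ hinv hd hT h
  suffices h : ∃ g ∈ borel n, cut (blk i) (SpOrbit.congr (rootElt (nxt_ne_pos i) t : Mat n) A) =
      cut (blk i) (SpOrbit.congr (g : Mat n) A) by
    obtain ⟨g, hg, h⟩ := h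
    exact (hsat.congr hg).of_cut_eq h
  have hi := i.isLt
  unfold Desc at hd
  have hblk1 : ¬ blk i (pos i) < blk i (nxt i) := by
    unfold blk
    rw [val_pos, val_nxt]
    split_ifs <;> omega
  have hblk2 : ¬ blk i (nxt i).rev < blk i (pos i).rev := by
    rw [blk_lt_iff]
    tauto
  have hA0 : ∀ x y, (τ x = y.rev → ¬ x < y.rev) → A x y = 0 := fun x y => hA.eq_zero_left
  revert hblk1 hblk2 hd hlast
  generalize_proofs hne
  revert hne
  generalize hp : pos i = p
  generalize hq : nxt i = q
  intro hne hd hlast hblk1 hblk2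
  have hpv : p.val = i.val := by rw [← hp]; rfl
  have hqv : q.val = i.val + 1 := by rw [← hq]; rfl
  have htp := (τ p).isLt
  have htq := (τ q).isLt
  have hp2 := hinv p
  have hq2 := hinv q
  have hpr := hτ p
  have hqr := hτ q
  have hd' := Fin.lt_def.1 hd
  have val_rev : ∀ a : Fin (2 * n), a.rev.val = 2 * n - (a.val + 1) := fun a => Fin.val_rev a
  by_cases h1 : q < τ q
  · have h1' := Fin.lt_def.1 h1
    -- For the last index `q = -p`, and `q < τ q` would contradict the descent. Otherwise `τ q < n`
    -- keeps the diagonal position of column `-τ q` out of sight, so the compensating congruence has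
    -- no visible quadratic term.
    have hlast' : (τ q).val < n ∧ i.val + 1 < n := by
      by_cases hc : i.val + 1 = n
      · have hqp : q = p.rev := Fin.ext (by rw [val_rev]; omega)
        have h2 : τ q = (τ p).rev := by rw [hqp, hτ]
        have h3 := congrArg Fin.val h2
        rw [val_rev] at h3
        omega
      · omega
    have hx'z' : (τ p).rev ≠ (τ q).rev := fun e => by
      rw [Fin.rev_injective e] at hd
      exact lt_irrefl _ hd
    -- Copying row `q` into row `p` creates an entry at `(p, -τ q)`. Column `-τ p` has its only
    -- entry in row `p`, so adding a multiple of it to column `-τ q` creates the same entry.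
    refine ⟨rootElt hx'z' (t * A (τ q).rev q / A p (τ p).rev),
      rootElt_mem_parab isFlag_val hx'z' (Fin.rev_le_rev.2 hd.le) _, ?_⟩
    refine congr_rootElt_eq hA hne hx'z' ?_ ?_ ?_ ?_ ?_ ?_ ?_ ?_ ?_ hblk1 ?_ t
    · intro a ha
      refine hA0 _ _ fun e => absurd ?_ ha
      rw [← hinv a, e, hqr]
    · intro a ha
      refine hA0 _ _ fun e => absurd ?_ ha
      rw [← hinv a, e, Fin.rev_rev, hp2]
    · refine hA.ne_zero _ _ ?_ ?_
      · rw [Fin.rev_rev, Fin.lt_def]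
        omega
      · rw [Fin.rev_rev]
    · intro b hb
      refine hA0 _ _ fun e => ?_
      rw [hpr] at e
      rw [← e] at hb
      have := Fin.rev_lt_rev.1 hb
      rw [Fin.lt_def] at this
      omega
    · intro b hb
      rw [Fin.rev_rev] at hb ⊢
      refine hA0 _ _ fun e => ?_
      rw [hq2] at e
      rw [← e, Fin.lt_def] at hb
      omega
    · intro _
      refine hA0 _ _ fun e => ?_
      have := congrArg Fin.val e
      rw [val_rev] at this
      omega
    · intro hb
      rw [Fin.rev_rev, Fin.lt_def, val_rev] at hb
      omega
    · intro hb
      rw [Fin.lt_def, val_rev] at hb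
      omega
    · intro _
      rw [Fin.rev_rev]
      refine hA0 _ _ fun e => ?_
      rw [hq2] at e
      have := congrArg Fin.val e
      rw [val_rev] at this
      omega
    · rw [not_lt]
      exact Fin.rev_le_rev.2 hd.le
  · by_cases h2 : τ p < p
    · have h2' := Fin.lt_def.1 h2
      have hc : i.val + 1 ≠ n := by
        intro hc
        have hqp : q = p.rev := Fin.ext (by rw [val_rev]; omega)
        have h2 : τ q = (τ p).rev := by rw [hqp, hτ]
        have h3 := congrArg Fin.val h2
        rw [val_rev] at h3
        omega
      have hne' : p.rev ≠ q.rev := fun e => hne (Fin.rev_injective e).symm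
      -- The mirror situation: row `-p` is copied into row `-q`, which is matched by adding column
      -- `τ q` to column `τ p`.
      rw [rootElt_symm_val hne hne']
      have hx'z' : τ q ≠ τ p := hd.ne
      refine ⟨rootElt hx'z' (-(eta q * eta p) * t * A (τ p) p.rev / A q.rev (τ q)),
        rootElt_mem_parab isFlag_val hx'z' hd.le _, ?_⟩
      refine congr_rootElt_eq hA hne' hx'z' ?_ ?_ ?_ ?_ ?_ ?_ ?_ ?_ ?_ hblk2 ?_ _
      · intro a ha
        refine hA0 _ _ fun e => absurd ?_ ha
        rw [← hinv a, e, Fin.rev_rev]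
      · intro a ha
        refine hA0 _ _ fun e => absurd ?_ ha
        rw [← hinv a, e, hτ, hq2]
      · refine hA.ne_zero _ _ ?_ ?_
        · rw [Fin.rev_lt_rev, Fin.lt_def]
          omega
        · exact hqr
      · intro b hb
        rw [Fin.rev_rev] at hb ⊢
        refine hA0 _ _ fun e => ?_
        rw [← e, Fin.lt_def] at hb
        omega
      · intro b hb
        refine hA0 _ _ fun e => ?_
        rw [hτ, hp2] at e
        rw [← e, Fin.lt_def, val_rev, val_rev] at hb
        omega
      · intro _
        refine hA0 _ _ fun e => ?_
        rw [hpr, Fin.rev_rev] at e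
        have := congrArg Fin.val e
        rw [val_rev] at this
        omega
      · intro _
        refine hA0 _ _ fun e => ?_
        rw [hq2] at e
        have := congrArg Fin.val e
        rw [val_rev] at this
        omega
      · intro _
        rw [Fin.rev_rev]
        refine hA0 _ _ fun e => ?_
        have := congrArg Fin.val e
        rw [val_rev] at this
        omega
      · intro hb
        rw [Fin.lt_def, val_rev] at hb
        omega
      · exact hd.le.not_gt
    -- In the remaining case rows `q` and `-p` of `A` vanish, so the root element changes nothing
    -- outside the simple root.
    · refine ⟨1, one_mem _, ?_⟩
      rw [Units.val_one, congr_one, cut_eq_cut_iff]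
      have hAq : ∀ b, A q b = 0 := fun b => hA0 _ _ fun e => by rwa [← e]
      have hAq' : ∀ b, A b q = 0 := fun b => by rw [hA.transpose_eq, hAq]
      have hAp : ∀ b, A p.rev b = 0 := fun b => hA0 _ _ fun e => by
        rw [← e, hpr, Fin.rev_lt_rev]
        exact h2
      have hAp' : ∀ b, A b p.rev = 0 := fun b => by rw [hA.transpose_eq, hAp]
      intro a b hab
      rw [congr_rootElt_apply hne t A (fun _ => hAp b) (fun _ => hAp' a) (fun _ _ => hAq q)
        (fun _ _ => hAp _), hAq, hAq', ite_self, ite_self, add_zero, mul_zero, add_zero]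
      · rintro ⟨rfl, rfl⟩
        rw [Fin.rev_rev] at hab
        exact hblk1 hab
      · rintro ⟨rfl, rfl⟩
        exact hblk2 hab

end Saturation

/-! ### Stability of orbit closures under minimal parabolics -/

section Parabolic

variable {n : ℕ} {τ : Perm (Fin (2 * n))} {i : Fin n} {A : Mat n}

theorem rootElt_nxt_mem_parab (i : Fin n) (t : ℂ) : rootElt (nxt_ne_pos i) t ∈ parab (blk i) := by
  refine rootElt_mem_parab (isFlag_blk i) _ ?_ t
  unfold blk
  rw [val_pos, val_nxt]
  split_ifs <;> omega

theorem blk_lt_of_lt {x y : Fin (2 * n)} (h : x < y) (h1 : ¬ (x = pos i ∧ y = nxt i))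
    (h2 : ¬ (x = (nxt i).rev ∧ y = (pos i).rev)) : blk i x < blk i y := by
  rw [← Fin.rev_rev y, blk_lt_iff, Fin.rev_rev]
  refine ⟨h, fun e => h1 ⟨e.1, Fin.rev_injective e.2⟩, fun e => h2 ⟨e.1, ?_⟩⟩
  rw [← e.2, Fin.rev_rev]

/-- Below the diagonal the blocks leave only the positions `(q, p)` and `(-p, -q)`, with `p = pos i`
and `q = nxt i`. The entry of `gᵀ J g = J` at `(p, -q)` reduces to the product of the `(p, p)` and
`(-p, -q)` entries up to sign, so the second position vanishes too. -/
theorem mem_borel_of_mem_parab {g : GL (Fin (2 * n)) ℂ} (hg : g ∈ parab (blk i))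
    (h1 : (g : Mat n) (nxt i) (pos i) = 0) (h2 : (g : Mat n) (pos i) (pos i) ≠ 0) :
    g ∈ borel n := by
  refine ⟨hg.1, fun a b hab => ?_⟩
  by_cases e1 : b = pos i ∧ a = nxt i
  · rw [e1.1, e1.2, h1]
  by_cases e2 : b = (nxt i).rev ∧ a = (pos i).rev
  · rw [e2.1, e2.2]
    have h3 := congrFun (congrFun hg.1 (pos i)) (nxt i).rev
    have hne : (nxt i).rev ≠ (pos i).rev := fun e => nxt_ne_pos i (Fin.rev_injective e)
    change congr (g : Mat n) (J n) (pos i) (nxt i).rev = _ at h3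
    rw [J_apply, if_neg hne, congr_apply, Finset.sum_eq_single (pos i).rev,
      Finset.sum_eq_single (pos i), J_apply, if_pos rfl] at h3
    · rcases mul_eq_zero.1 h3 with h3 | h3
      · rcases mul_eq_zero.1 h3 with h3 | h3
        · exact absurd h3 h2
        · have := eta_mul_self (pos i)
          rw [h3, mul_zero] at this
          exact absurd this zero_ne_one
      · exact h3
    · intro c _ hc
      rw [J_apply, if_neg fun e => hc (by rw [Fin.rev_injective e]), mul_zero, zero_mul]
    · simp
    · intro b _ hb
      refine Finset.sum_eq_zero fun a _ => ?_
      rw [J_apply]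
      split_ifs with hba
      · have hab : a ≠ pos i := fun e => hb (by rw [hba, e])
        suffices (g : Mat n) a (pos i) = 0 ∨ (g : Mat n) b (nxt i).rev = 0 by
          rcases this with h | h <;> rw [h] <;> ring
        by_cases hlt : pos i < a
        · left
          by_cases hq : a = nxt i
          · rw [hq, h1]
          · refine hg.2 (blk_lt_of_lt hlt (fun e => hq e.2) fun e => ?_)
            have e1 := congrArg Fin.val e.1
            have e2 := congrArg Fin.val e.2
            rw [Fin.val_rev, val_pos, val_nxt] at e1
            rw [Fin.val_rev, val_pos] at e2
            exact hq (Fin.ext (by rw [val_nxt]; omega))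
        · right
          have hlt' : a < pos i := lt_of_le_of_ne (not_lt.1 hlt) hab
          have hrev : (pos i).rev < b := by rw [hba]; exact Fin.rev_lt_rev.2 hlt'
          have hlt2 : (nxt i).rev < b := (Fin.rev_lt_rev.2 (pos_lt_nxt i)).trans hrev
          refine hg.2 (blk_lt_of_lt hlt2 (fun e => ?_) fun e => hb e.2)
          have e1 := congrArg Fin.val e.1
          have e2 := congrArg Fin.val e.2
          rw [Fin.val_rev, val_pos, val_nxt] at e1
          rw [val_nxt] at e2
          rw [Fin.lt_def, Fin.val_rev, val_pos] at hrev
          have := i.isLt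
          omega
      · ring
    · simp
  exact hg.2 (blk_lt_of_lt hab e1 e2)

theorem rootElt_nxt_mul_apply (i : Fin n) : ∃ k : ℂ, k ≠ 0 ∧ ∀ (t : ℂ) (M : Mat n),
    (∀ y, ((rootElt (nxt_ne_pos i) t : Mat n) * M) (nxt i) y = M (nxt i) y + k * t * M (pos i) y) ∧
    (∀ y, ((rootElt (nxt_ne_pos i) t : Mat n) * M) (pos i) y = M (pos i) y) ∧
    (∀ x, (M * (rootElt (nxt_ne_pos i) t : Mat n)) x (pos i) =
      M x (pos i) + k * t * M x (nxt i)) := by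
  have hne := nxt_ne_pos i
  have hrp : (pos i).rev ≠ pos i := rev_ne _
  have hN : ∃ k : ℂ, k ≠ 0 ∧ rootNil (nxt i) (pos i) (nxt i) (pos i) = k ∧
      (∀ y, y ≠ pos i → rootNil (nxt i) (pos i) (nxt i) y = 0) ∧
      (∀ y, rootNil (nxt i) (pos i) (pos i) y = 0) ∧
      (∀ y, y ≠ nxt i → rootNil (nxt i) (pos i) y (pos i) = 0) := by
    by_cases hrev : nxt i = (pos i).rev
    -- For the long simple root the two summands of `rootNil` coincide and add up, hence `k = 2`;
    -- otherwise `k = 1`.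
    · have e : rootNil (nxt i) (pos i) = Matrix.single (nxt i) (pos i) 2 := by
        unfold rootNil
        rw [hrev, Fin.rev_rev, eta_rev, neg_mul, eta_mul_self, neg_one_smul, sub_neg_eq_add,
          ← Matrix.single_add]
        norm_num
      rw [e]
      refine ⟨2, two_ne_zero, by simp, ?_, ?_, ?_⟩
      · intro y hy
        rw [Matrix.single_apply, if_neg fun e => hy e.2.symm]
      · intro y
        rw [Matrix.single_apply, if_neg fun e => hne e.1]
      · intro y hy
        rw [Matrix.single_apply, if_neg fun e => hy e.1.symm]
    · have h1 : (nxt i).rev ≠ pos i := fun e => hrev (by rw [← e, Fin.rev_rev])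
      have h2 : (pos i).rev ≠ nxt i := fun e => hrev e.symm
      refine ⟨1, one_ne_zero, ?_, ?_, ?_, ?_⟩ <;>
        simp +contextual [rootNil, h1, h2, hne, hrp, Ne.symm]
  obtain ⟨k, hk, h1, h2, h3, h4⟩ := hN
  refine ⟨k, hk, fun t M => ⟨fun y => ?_, fun y => ?_, fun x => ?_⟩⟩
  · change ((1 + t • rootNil (nxt i) (pos i)) * M) (nxt i) y = _
    rw [Matrix.add_mul, Matrix.one_mul, Matrix.smul_mul, Matrix.add_apply, Matrix.smul_apply,
      Matrix.mul_apply, Finset.sum_eq_single (pos i), h1, smul_eq_mul]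
    · ring
    · intro b _ hb
      rw [h2 b hb, zero_mul]
    · simp
  · change ((1 + t • rootNil (nxt i) (pos i)) * M) (pos i) y = _
    rw [Matrix.add_mul, Matrix.one_mul, Matrix.smul_mul, Matrix.add_apply, Matrix.smul_apply,
      Matrix.mul_apply, Finset.sum_eq_zero fun b _ => by rw [h3, zero_mul], smul_zero, add_zero]
  · change (M * (1 + t • rootNil (nxt i) (pos i))) x (pos i) = _
    rw [Matrix.mul_add, Matrix.mul_one, Matrix.mul_smul, Matrix.add_apply, Matrix.smul_apply,
      Matrix.mul_apply, Finset.sum_eq_single (nxt i), h1, smul_eq_mul]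
    · ring
    · intro b _ hb
      rw [h4 b hb, mul_zero]
    · simp

/-- In the product of `g` and `g⁻¹` at `(p, p)`, `p = pos i`, only the columns `pos i` and `nxt i`
of row `p` of `g` contribute, so they cannot both vanish. -/
theorem parab_row_ne_zero {g : GL (Fin (2 * n)) ℂ} (hg : g ∈ parab (blk i))
    (h : (g : Mat n) (pos i) (pos i) = 0) : (g : Mat n) (pos i) (nxt i) ≠ 0 := by
  intro h'
  have h1 : ((g : Mat n) * ((g⁻¹ : GL _ ℂ) : Mat n)) (pos i) (pos i) = 1 := by
    rw [Units.mul_inv, Matrix.one_apply_eq]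
  rw [Matrix.mul_apply, Finset.sum_eq_zero] at h1
  · exact zero_ne_one h1
  intro y _
  by_cases hy : y < pos i
  · rw [hg.2 (blk_lt_of_lt hy (fun e => ?_) fun e => ?_), zero_mul]
    · exact hy.ne e.1
    · have e2 := congrArg Fin.val e.2
      rw [Fin.val_rev, val_pos] at e2
      have := i.isLt
      omega
  · by_cases e1 : y = pos i
    · rw [e1, h, zero_mul]
    by_cases e2 : y = nxt i
    · rw [e2, h', zero_mul]
    have hy' : pos i < y := lt_of_le_of_ne (not_lt.1 hy) (Ne.symm e1)
    rw [(inv_mem hg).2 (blk_lt_of_lt hy' (fun e => e2 e.2) fun e => ?_), mul_zero]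
    have h3 := congrArg Fin.val e.1
    have h4 := congrArg Fin.val e.2
    rw [Fin.val_rev, val_pos, val_nxt] at h3
    rw [Fin.val_rev, val_pos] at h4
    exact e2 (Fin.ext (by rw [val_nxt]; omega))

/-- This is the big cell: `g` factors as a negative simple root element times a Borel element, the
parameter `t` being chosen to clear the `(nxt i, pos i)` entry. -/
theorem IsType.saturated_of_ne_zero (hτ : RevComm τ) (hinv : ∀ a, τ (τ a) = a) (hd : Desc τ i)
    (hlast : i.val + 1 = n ∨ (τ (nxt i)).val < n) (hA : IsType τ A) {g : GL (Fin (2 * n)) ℂ}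
    (hg : g ∈ parab (blk i)) (h : (g : Mat n) (pos i) (pos i) ≠ 0) :
    Saturated i A (congr (g : Mat n) A) := by
  obtain ⟨k, hk, hmul⟩ := rootElt_nxt_mul_apply i
  set t := (g : Mat n) (nxt i) (pos i) / (k * (g : Mat n) (pos i) (pos i)) with ht
  set b := rootElt (nxt_ne_pos i) (-t) * g with hb
  have hb1 : b ∈ borel n := by
    refine mem_borel_of_mem_parab (mul_mem (rootElt_nxt_mem_parab i _) hg) ?_ ?_
    · rw [Units.val_mul, (hmul _ _).1, ht]
      field_simp
      ring
    · rwa [Units.val_mul, (hmul _ _).2.1]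
  have hgb : (g : Mat n) = (rootElt (nxt_ne_pos i) t : Mat n) * (b : Mat n) := by
    have h1 : (rootElt (nxt_ne_pos i) t : Mat n) * (rootElt (nxt_ne_pos i) (-t) : Mat n) = 1 := by
      have e : (rootElt (nxt_ne_pos i) (-t) : Mat n) =
          (((rootElt (nxt_ne_pos i) t)⁻¹ : GL _ ℂ) : Mat n) := by
        change 1 + (-t) • rootNil (nxt i) (pos i) = 1 - t • rootNil (nxt i) (pos i)
        rw [neg_smul, sub_eq_add_neg]
      rw [e, Units.mul_inv]
    rw [hb, Units.val_mul, ← Matrix.mul_assoc, h1, Matrix.one_mul]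
  rw [hgb, congr_mul]
  exact (hA.saturated_rootElt hτ hinv hd hlast t).congr hb1

theorem continuous_rootElt {x z : Fin (2 * n)} (h : x ≠ z) :
    Continuous fun t : ℂ => (rootElt h t : Mat n) := by
  change Continuous fun t : ℂ => (1 : Mat n) + t • rootNil x z
  fun_prop

theorem continuous_cut_congr (f : Fin (2 * n) → ℕ) (S : Mat n) :
    Continuous fun g : Mat n => cut f (congr g S) := by
  refine continuous_matrix fun x y => ?_
  simp only [cut_apply, congr]
  split_ifs
  · fun_prop
  · fun_prop

/-- Density of the big cell: right multiplication by the negative root element with parameter `t`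
makes the `(pos i, pos i)` entry nonzero for all but at most one `t`, and the closure is closed
along the resulting curve. -/
theorem IsType.saturated_parab (hτ : RevComm τ) (hinv : ∀ a, τ (τ a) = a) (hd : Desc τ i)
    (hlast : i.val + 1 = n ∨ (τ (nxt i)).val < n) (hA : IsType τ A) {g : GL (Fin (2 * n)) ℂ}
    (hg : g ∈ parab (blk i)) : Saturated i A (congr (g : Mat n) A) := by
  obtain ⟨k, hk, hmul⟩ := rootElt_nxt_mul_apply i
  intro T hT hTg
  -- The simple root entry is held at its value in `T`, so that the curve passes through `T` at `t =
  -- 0`.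
  set γ : ℂ → Mat n := fun t =>
    cut (blk i) (congr ((g : Mat n) * (rootElt (nxt_ne_pos i) t : Mat n)) A) +
      T (pos i) (nxt i).rev • simpleMat i with hγ
  have hc : Continuous γ := by
    refine Continuous.add ?_ continuous_const
    refine (continuous_cut_congr (blk i) A).comp ?_
    exact continuous_const.matrix_mul (continuous_rootElt _)
  have h0 : γ 0 = T := by
    have e : (rootElt (nxt_ne_pos i) 0 : Mat n) = 1 := by
      change 1 + (0 : ℂ) • rootNil (nxt i) (pos i) = 1
      rw [zero_smul, add_zero]
    simp only [hγ]
    rw [e, Matrix.mul_one]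
    exact (hT.eq_cut_add (congr_symm _ hA.symm) hTg).symm
  rw [← h0]
  refine InCl.of_curve hc (T := {t | (g : Mat n) (pos i) (pos i) +
    k * t * (g : Mat n) (pos i) (nxt i) = 0}) ?_ ?_ 0
  · by_cases hpq : (g : Mat n) (pos i) (nxt i) = 0
    · have : (g : Mat n) (pos i) (pos i) ≠ 0 := fun e => parab_row_ne_zero hg e hpq
      simp [hpq, this]
    · refine (Set.finite_singleton
        (-(g : Mat n) (pos i) (pos i) / (k * (g : Mat n) (pos i) (nxt i)))).subset ?_
      intro t ht
      rw [Set.mem_singleton_iff, eq_div_iff (mul_ne_zero hk hpq)]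
      have ht' : (g : Mat n) (pos i) (pos i) + k * t * (g : Mat n) (pos i) (nxt i) = 0 := ht
      linear_combination ht'
  · intro t ht
    have hg' : g * rootElt (nxt_ne_pos i) t ∈ parab (blk i) :=
      mul_mem hg (rootElt_nxt_mem_parab i t)
    refine hA.saturated_of_ne_zero hτ hinv hd hlast hg' ?_ _
      (adm_cut_add i (congr_symm _ hA.symm) _) ?_
    · rw [Units.val_mul, (hmul _ _).2.2]
      exact ht
    · rw [cut_cut_add, Units.val_mul]

/-- The closure of the orbit attached to `τ` is stable under the minimal parabolic subgroup of a
descent of `τ`. -/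
theorem IsType.inCl_parab (hτ : RevComm τ) (hinv : ∀ a, τ (τ a) = a) (hd : Desc τ i)
    (hlast : i.val + 1 = n ∨ (τ (nxt i)).val < n) (hA : IsType τ A) {g : GL (Fin (2 * n)) ℂ}
    (hg : g ∈ parab (blk i)) {S T : Mat n} (hS : InCl A S) (hS' : Adm S) (hT : Adm T)
    (h : cut (blk i) T = cut (blk i) (congr (g : Mat n) S)) : InCl A T := by
  rw [hT.eq_cut_add (congr_symm _ hS'.1) h]
  refine hS.map (cutCongr (blk i) (g : Mat n)) _ fun b hb => ?_
  rw [cutCongr_apply]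
  refine hA.saturated_parab hτ hinv hd hlast (mul_mem (borel_le_parab (isFlag_blk i) hb) hg) _
    (adm_cut_add i (congr_symm _ (cut_symm (congr_symm _ hA.symm))) _) ?_
  rw [cut_cut_add, Units.val_mul, congr_mul]
  exact cut_congr_of_cut_eq (isFlag_blk i) hg.2 (cut_cut_val (isFlag_blk i) _)

end Parabolic

/-! ### The action of fundamental reflections on involutions -/

section Lower

variable {n : ℕ} {σ τ : Perm (Fin (2 * n))} {i : Fin n}

open Classical in
/-- The involution below `π` obtained from a descent: `π s` if `s` and `π` commute, `s π s`
otherwise. -/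
noncomputable def lower (i : Fin n) (π : Perm (Fin (2 * n))) : Perm (Fin (2 * n)) :=
  if simplePerm i * π = π * simplePerm i then π * simplePerm i else simplePerm i * π * simplePerm i

theorem lower_revComm (hσ : RevComm σ) : RevComm (lower i σ) := by
  unfold lower
  split_ifs
  · exact hσ.mul (simplePerm_revComm i)
  · exact ((simplePerm_revComm i).mul hσ).mul (simplePerm_revComm i)

theorem lower_lower_apply (hinv : ∀ a, σ (σ a) = a) (a : Fin (2 * n)) :
    lower i σ (lower i σ a) = a := by
  unfold lower
  split_ifs with h
  · have h' : ∀ b, simplePerm i (σ b) = σ (simplePerm i b) := fun b => by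
      rw [← Equiv.Perm.mul_apply, h, Equiv.Perm.mul_apply]
    rw [Equiv.Perm.mul_apply, Equiv.Perm.mul_apply, h', hinv, simplePerm_simplePerm]
  · simp only [Equiv.Perm.mul_apply, simplePerm_simplePerm, hinv]

/-- A descent at which the reflection commutes with the involution is of one of two kinds. -/
theorem cases_of_commute (hd : Desc σ i)
    (hc : simplePerm i * σ = σ * simplePerm i) :
    σ (pos i) = nxt i ∨ (i.val + 1 < n ∧ σ (pos i) = (pos i).rev ∧ σ (nxt i) = (nxt i).rev) := by
  have h1 : simplePerm i (σ (pos i)) = σ (nxt i) := by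
    rw [← Equiv.Perm.mul_apply, hc, Equiv.Perm.mul_apply, simplePerm_pos]
  have hi := i.isLt
  have hval := congrArg Fin.val h1
  rw [simplePerm_val] at hval
  unfold Desc at hd
  rw [Fin.lt_def] at hd
  have hp := (σ (pos i)).isLt
  simp only [Fin.ext_iff, Fin.val_rev, val_pos, val_nxt]
  split_ifs at hval <;> omega

theorem commute_of_apply_pos (hσ : RevComm σ) (hinv : ∀ a, σ (σ a) = a)
    (h : σ (pos i) = nxt i) : simplePerm i * σ = σ * simplePerm i := by
  have h1 : σ (nxt i) = pos i := by rw [← h, hinv]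
  have h2 := hσ (pos i)
  have h3 := hσ (nxt i)
  rw [h] at h2
  rw [h1] at h3
  ext a : 1
  rw [Equiv.Perm.mul_apply, Equiv.Perm.mul_apply, simplePerm_apply, simplePerm_apply]
  have e : ∀ b, σ a = b ↔ a = σ b := fun b =>
    ⟨fun h => by rw [← h, hinv], fun h => by rw [h, hinv]⟩
  simp only [e, h, h1, h2, h3]
  split_ifs <;> simp_all

theorem inv_eq_of_apply_apply (hinv : ∀ a, σ (σ a) = a) : σ⁻¹ = σ :=
  inv_eq_of_mul_eq_one_left (Equiv.ext hinv)

theorem commute_of_apply_eq_rev (hσ : RevComm σ) (hinv : ∀ a, σ (σ a) = a)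
    (hq : σ (nxt i) = (nxt i).rev) (hp : σ (pos i) = (pos i).rev) :
    simplePerm i * σ = σ * simplePerm i := by
  have h3 := hσ (pos i)
  have h4 := hσ (nxt i)
  rw [hp, Fin.rev_rev] at h3
  rw [hq, Fin.rev_rev] at h4
  ext a : 1
  rw [Equiv.Perm.mul_apply, Equiv.Perm.mul_apply, simplePerm_apply, simplePerm_apply]
  have e : ∀ b, σ a = b ↔ a = σ b := fun b =>
    ⟨fun h => by rw [← h, hinv], fun h => by rw [h, hinv]⟩
  simp only [e, hq, hp, h3, h4]
  grind

/-- Left multiplication by `s` reverses the order of `σ q < σ p` only if `s` swaps these two values,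
that is, if they are `p, q` or `-q, -p`. In both cases `s` commutes with `σ`. -/
theorem desc_simplePerm_mul (hσ : RevComm σ) (hinv : ∀ a, σ (σ a) = a) (hd : Desc σ i)
    (hc : simplePerm i * σ ≠ σ * simplePerm i) : Desc (simplePerm i * σ) i := by
  have h1 : (σ (pos i)).val ≠ i.val + 1 := fun h =>
    hc (commute_of_apply_pos hσ hinv (Fin.ext h))
  have h2 : ¬ ((σ (nxt i)).val = 2 * n - (i.val + 1 + 1) ∧
      (σ (pos i)).val = 2 * n - (i.val + 1)) := fun h =>
    hc (commute_of_apply_eq_rev hσ hinv (Fin.ext (by rw [h.1, Fin.val_rev, val_nxt]))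
      (Fin.ext (by rw [h.2, Fin.val_rev, val_pos])))
  unfold Desc at *
  rw [Equiv.Perm.mul_apply, Equiv.Perm.mul_apply, Fin.lt_def, simplePerm_val, simplePerm_val]
  rw [Fin.lt_def] at hd
  have := i.isLt
  have := (σ (pos i)).isLt
  have := (σ (nxt i)).isLt
  split_ifs <;> omega

theorem mul_simplePerm_inv (hinv : ∀ a, σ (σ a) = a) :
    (σ * simplePerm i)⁻¹ = simplePerm i * σ := by
  rw [_root_.mul_inv_rev, simplePerm_inv, inv_eq_of_apply_apply hinv]

theorem conj_simplePerm_inv (hinv : ∀ a, σ (σ a) = a) :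
    (simplePerm i * σ * simplePerm i)⁻¹ = simplePerm i * σ * simplePerm i := by
  rw [_root_.mul_inv_rev, _root_.mul_inv_rev, simplePerm_inv, inv_eq_of_apply_apply hinv, mul_assoc]

theorem lower_le_mul (hσ : RevComm σ) (hinv : ∀ a, σ (σ a) = a) (hd : Desc σ i) :
    RkLE (lower i σ) (σ * simplePerm i) := by
  unfold lower
  split_ifs with hc
  · exact fun _ _ => le_rfl
  · have h := (mul_le_of_desc ((simplePerm_revComm i).mul hσ)
      (desc_simplePerm_mul hσ hinv hd hc)).inv
    rwa [conj_simplePerm_inv hinv, _root_.mul_inv_rev, simplePerm_inv, inv_eq_of_apply_apply hinv] at h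

/-- Lifting is applied on the right and then, after inverting both sides, once more on the other
side. When `s` commutes with `τ`, the first application suffices, since `lower i σ` lies below `σ
s`. -/
theorem RkLE.lower_lower (hσ : RevComm σ) (hτ : RevComm τ) (hσ' : ∀ a, σ (σ a) = a)
    (hτ' : ∀ a, τ (τ a) = a) (h : RkLE σ τ) (hd : Desc τ i) (hd' : Desc σ i) :
    RkLE (lower i σ) (lower i τ) := by
  have h1 : RkLE (σ * simplePerm i) (τ * simplePerm i) := h.mul_of_desc hσ hτ hd hd'
  by_cases hc : simplePerm i * τ = τ * simplePerm i
  · have e : lower i τ = τ * simplePerm i := if_pos hc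
    rw [e]
    exact (lower_le_mul hσ hσ' hd').trans h1
  · have e : lower i τ = simplePerm i * τ * simplePerm i := if_neg hc
    rw [e]
    have h2 := h1.inv
    rw [mul_simplePerm_inv hσ', mul_simplePerm_inv hτ'] at h2
    have hsσ := (simplePerm_revComm i).mul hσ
    have hsτ := (simplePerm_revComm i).mul hτ
    have hdτ := desc_simplePerm_mul hτ hτ' hd hc
    by_cases hc' : simplePerm i * σ = σ * simplePerm i
    · have e : lower i σ = simplePerm i * σ := by rw [lower, if_pos hc', hc']
      rw [e]
      refine h2.le_mul_of_desc hsσ hsτ hdτ ?_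
      rw [hc', desc_mul, not_not]
      exact hd'
    · have e : lower i σ = simplePerm i * σ * simplePerm i := if_neg hc'
      rw [e]
      exact h2.mul_of_desc hsσ hsτ hdτ (desc_simplePerm_mul hσ hσ' hd' hc')

theorem RkLE.le_lower (hσ : RevComm σ) (hτ : RevComm τ) (hσ' : ∀ a, σ (σ a) = a)
    (hτ' : ∀ a, τ (τ a) = a) (h : RkLE σ τ) (hd : Desc τ i) (hd' : ¬ Desc σ i) :
    RkLE σ (lower i τ) := by
  have h1 : RkLE σ (τ * simplePerm i) := h.le_mul_of_desc hσ hτ hd hd'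
  by_cases hc : simplePerm i * τ = τ * simplePerm i
  · have e : lower i τ = τ * simplePerm i := if_pos hc
    rwa [e]
  · have e : lower i τ = simplePerm i * τ * simplePerm i := if_neg hc
    rw [e]
    have h2 := h1.inv
    rw [inv_eq_of_apply_apply hσ', mul_simplePerm_inv hτ'] at h2
    exact h2.le_mul_of_desc hσ ((simplePerm_revComm i).mul hτ) (desc_simplePerm_mul hτ hτ' hd hc) hd'

/-- The sum of all values of the rank function. -/
def rkSum {N : ℕ} (π : Perm (Fin N)) : ℕ :=
  ∑ a : Fin (N + 1), ∑ b : Fin (N + 1), rk π a.val b.val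

theorem rkSum_le {N : ℕ} {π ρ : Perm (Fin N)} (h : RkLE π ρ) : rkSum π ≤ rkSum ρ :=
  Finset.sum_le_sum fun _ _ => Finset.sum_le_sum fun _ _ => h _ _

theorem rkSum_mul_lt (hσ : RevComm σ) (hd : Desc σ i) : rkSum (σ * simplePerm i) < rkSum σ := by
  have hle := mul_le_of_desc hσ hd
  refine Finset.sum_lt_sum (fun _ _ => Finset.sum_le_sum fun _ _ => hle _ _)
    -- The strict drop is at row `i + 1` and threshold `σ (pos i)`: there `σ` counts position `pos
    -- i`, while `σ s` puts the smaller value `σ (nxt i)` in it.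
    ⟨⟨i.val + 1, by omega⟩, Finset.mem_univ _, ?_⟩
  refine Finset.sum_lt_sum (fun _ _ => hle _ _)
    ⟨⟨(σ (pos i)).val, by omega⟩, Finset.mem_univ _, ?_⟩
  unfold Desc at hd
  rw [Fin.lt_def] at hd
  have h1 := rk_succ σ (pos i) (σ (pos i)).val
  have h2 := rk_succ (σ * simplePerm i) (pos i) (σ (pos i)).val
  rw [rk_mul_simplePerm _ _ (j := (pos i).val) (by unfold IsRow; rw [val_pos]; omega),
    Equiv.Perm.mul_apply, simplePerm_pos, if_neg (by omega)] at h2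
  rw [if_pos le_rfl] at h1
  rw [val_pos] at h1 h2
  simp only
  omega

theorem rkSum_lower_lt (hσ : RevComm σ) (hinv : ∀ a, σ (σ a) = a) (hd : Desc σ i) :
    rkSum (lower i σ) < rkSum σ :=
  (rkSum_le (lower_le_mul hσ hinv hd)).trans_lt (rkSum_mul_lt hσ hd)

/-- After the largest descent the values increase up to the middle. The ascent there compares a
value with its own negative, so that value is positive, and hence so are the ones before it back to
`nxt i`. This is the side condition needed for saturation. -/
theorem exists_last_desc (hτ : RevComm τ) (h : ∃ i, Desc τ i) :
    ∃ i, Desc τ i ∧ (i.val + 1 = n ∨ (τ (nxt i)).val < n) := by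
  classical
  obtain ⟨i, hi, hmax⟩ := (Finset.univ.filter fun i => Desc τ i).exists_max_image id
    (by obtain ⟨i, hi⟩ := h; exact ⟨i, by simpa using hi⟩)
  have hi' : Desc τ i := by simpa using hi
  refine ⟨i, hi', ?_⟩
  by_cases hin : i.val + 1 = n
  · exact Or.inl hin
  right
  have hilt := i.isLt
  have hasc : ∀ j : Fin n, i < j → τ (pos j) < τ (nxt j) := fun j hj => by
    rw [← not_desc_iff]
    intro hd
    exact absurd (hmax j (by simpa using hd)) (not_le.2 hj)
  have key : ∀ d : ℕ, ∀ j : Fin n, i < j → j.val + d + 1 = n → (τ (pos j)).val < n := by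
    intro d
    induction d with
    | zero =>
      intro j hj hjn
      have h1 := hasc j hj
      have h2 : nxt j = (pos j).rev := by
        apply Fin.ext
        rw [val_nxt, Fin.val_rev, val_pos]
        omega
      rw [h2, hτ, Fin.lt_def, Fin.val_rev] at h1
      omega
    | succ d ih =>
      intro j hj hjn
      have h1 := Fin.lt_def.1 (hasc j hj)
      have h2 : nxt j = pos ⟨j.val + 1, by omega⟩ := rfl
      have h3 := ih ⟨j.val + 1, by omega⟩ (hj.trans (Fin.lt_def.2 (Nat.lt_succ_self _)))
        (by simp only; omega)
      rw [h2] at h1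
      omega
  exact key (n - i.val - 2) ⟨i.val + 1, by omega⟩ (Fin.lt_def.2 (Nat.lt_succ_self _))
    (by simp only; omega)

end Lower

/-! ### Raising an involution inside a parabolic subgroup -/

section Raise

variable {n : ℕ} {σ : Perm (Fin (2 * n))} {i : Fin n} {S : Mat n}

/-- A monomial representative of `s` in the parabolic conjugates the pattern. The simple root entry
is irrelevant, since `σ (pos i) = nxt i` would make `s` commute with `σ`. -/
theorem raise_of_not_commute (hσ : RevComm σ) (hinv : ∀ a, σ (σ a) = a)
    (hc : simplePerm i * σ ≠ σ * simplePerm i) (hS : IsType (lower i σ) S) :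
    ∃ g ∈ parab (blk i), ∃ T, IsType σ T ∧ cut (blk i) (congr (g : Mat n) S) = cut (blk i) T := by
  have e : lower i σ = simplePerm i * σ * simplePerm i := if_neg hc
  rw [e] at hS
  have he0 : ∀ a : Fin (2 * n), eta a ≠ 0 := fun a h => by
    have := eta_mul_self a
    rw [h, mul_zero] at this
    exact zero_ne_one this
  -- The signs compensate for those of `J`, making the monomial matrix symplectic; they are trivial
  -- unless the long simple reflection is involved.
  set d : Fin (2 * n) → ℂ := fun x => if x.val < n then 1 else eta x * eta (simplePerm i x) with hd
  have hd0 : ∀ x, d x ≠ 0 := by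
    intro x
    simp only [hd]
    split_ifs
    · exact one_ne_zero
    · exact mul_ne_zero (he0 _) (he0 _)
  have hdd : ∀ x, d x * d x.rev * eta (simplePerm i x) = eta x := by
    intro x
    have h1 := eta_mul_self (simplePerm i x)
    have hx := x.isLt
    simp only [hd, simplePerm_revComm i x, eta_rev]
    rw [Fin.val_rev]
    by_cases h : x.val < n
    · rw [if_pos h, if_neg (by omega)]
      linear_combination eta x * h1
    · rw [if_neg h, if_pos (by omega)]
      linear_combination eta x * h1
  have hblk : ∀ x, blk i (simplePerm i x) = blk i x := by
    intro x
    have := x.isLt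
    have := i.isLt
    unfold blk
    rw [simplePerm_val]
    split_ifs <;> omega
  have hlt : ∀ x z, blk i x < blk i z → simplePerm i x < simplePerm i z := fun x z h =>
    (isFlag_blk i).mono.reflect_lt (by rwa [hblk, hblk])
  have hg : monomialElt (simplePerm i) d hd0 ∈ parab (blk i) := by
    refine ⟨monomial_symp (simplePerm_revComm i) hdd, fun a b hab => ?_⟩
    change (if a = simplePerm i b then d b else 0) = 0
    rw [if_neg]
    rintro rfl
    rw [hblk] at hab
    exact lt_irrefl _ hab
  refine ⟨_, hg, cut (blk i) (congr (monomial (simplePerm i) d) S), ?_, (cut_cut _ _).symm⟩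
  have hval : ∀ x y, blk i x < blk i y.rev → cut (blk i) (congr (monomial (simplePerm i) d) S) x y =
      d x * d y * S (simplePerm i x) (simplePerm i y) := fun x y h => by
    rw [cut_apply, if_pos h, congr_monomial_apply]
  refine ⟨?_, ?_, ?_⟩
  · have := (adm_cut_add i (congr_symm (monomial (simplePerm i) d) hS.symm) 0).1
    rwa [zero_smul, add_zero] at this
  · intro x y h1 h2
    have hb : blk i x < blk i y.rev := by
      rw [blk_lt_iff]
      refine ⟨h1, ?_, ?_⟩
      · rintro ⟨rfl, rfl⟩
        rw [Fin.rev_rev] at h2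
        exact hc (commute_of_apply_pos hσ hinv h2)
      · rintro ⟨rfl, rfl⟩
        rw [hσ] at h2
        refine hc (commute_of_apply_pos hσ hinv ?_)
        rw [← Fin.rev_injective h2, hinv]
    rw [hval x y hb]
    refine mul_ne_zero (mul_ne_zero (hd0 x) (hd0 y)) (hS.ne_zero _ _ ?_ ?_)
    · rw [← simplePerm_revComm]
      exact hlt _ _ hb
    · simp only [Equiv.Perm.mul_apply, simplePerm_simplePerm]
      rw [h2, simplePerm_revComm]
  · intro x y h
    by_cases hb : blk i x < blk i y.rev
    · rw [hval x y hb, hS.eq_zero, mul_zero]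
      rintro ⟨-, h2⟩
      simp only [Equiv.Perm.mul_apply, simplePerm_simplePerm] at h2
      rw [← simplePerm_revComm] at h2
      exact h ⟨(blk_lt_iff.1 hb).1, (simplePerm i).injective h2⟩
    · rw [cut_apply, if_neg hb]

/-- The visible patterns of `σ` and `σ s` differ only at the simple root, which truncation forgets;
so no group element is needed. -/
theorem raise_of_apply_pos (hσ : RevComm σ) (hinv : ∀ a, σ (σ a) = a)
    (h : σ (pos i) = nxt i) (hS : IsType (lower i σ) S) :
    ∃ g ∈ parab (blk i), ∃ T, IsType σ T ∧ cut (blk i) (congr (g : Mat n) S) = cut (blk i) T := by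
  have e : lower i σ = σ * simplePerm i := if_pos (commute_of_apply_pos hσ hinv h)
  rw [e] at hS
  have h1 : σ (nxt i) = pos i := by rw [← h, hinv]
  have h2 := hσ (pos i)
  have h3 := hσ (nxt i)
  rw [h] at h2
  rw [h1] at h3
  refine ⟨1, one_mem _, S + simpleMat i, ?_, ?_⟩
  · have hiff : ∀ x y : Fin (2 * n), blk i x < blk i y.rev →
        ((σ * simplePerm i) x = y.rev ↔ σ x = y.rev) := by
      intro x y hb
      rw [Equiv.Perm.mul_apply, simplePerm_apply]
      obtain ⟨h4, h5, h6⟩ := blk_lt_iff.1 hb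
      have hlt := pos_lt_nxt i
      have hlt' := Fin.rev_lt_rev.2 hlt
      have e1 : ∀ a : Fin (2 * n), a = y.rev → y = a.rev := fun a h => by rw [h, Fin.rev_rev]
      split_ifs with h7 h7 h7 h7
      · subst h7
        rw [h1, h]
        constructor
        · intro h; rw [← h] at h4; exact absurd h4 (lt_irrefl _)
        · intro h; exact absurd ⟨rfl, e1 _ h⟩ h5
      · subst h7
        rw [h1, h]
        constructor
        · intro h; rw [← h] at h4; exact absurd h4 (lt_irrefl _)
        · intro h; rw [← h] at h4; exact absurd h4 hlt.not_gt
      · subst h7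
        rw [h2, h3]
        constructor
        · intro h; rw [← h] at h4; exact absurd h4 (lt_irrefl _)
        · intro h; rw [← h] at h4; exact absurd h4 hlt'.not_gt
      · subst h7
        rw [h2, h3]
        constructor
        · intro h; rw [← h] at h4; exact absurd h4 (lt_irrefl _)
        · intro h
          have := e1 _ h
          rw [Fin.rev_rev] at this
          exact absurd ⟨rfl, this⟩ h6
      · rfl
    have hE : ∀ x y : Fin (2 * n), x < y.rev → ¬ blk i x < blk i y.rev →
        σ x = y.rev ∧ (S + simpleMat i) x y ≠ 0 := by
      intro x y hlt hb
      rw [blk_lt_iff] at hb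
      have hxy : (x = pos i ∧ y = (nxt i).rev) ∨ (x = (nxt i).rev ∧ y = pos i) := by tauto
      have e1 : simpleMat i x y = 1 := if_pos hxy
      have e2 : S x y = 0 := by
        refine hS.eq_zero_left fun e => ?_
        rw [Equiv.Perm.mul_apply] at e
        rcases hxy with ⟨rfl, rfl⟩ | ⟨rfl, rfl⟩
        · rw [simplePerm_pos, h1, Fin.rev_rev] at e
          exact absurd e (pos_ne_nxt i)
        · rw [simplePerm_revComm, simplePerm_nxt, h2] at e
          exact absurd (Fin.rev_injective e) (nxt_ne_pos i)
      refine ⟨?_, ?_⟩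
      · rcases hxy with ⟨rfl, rfl⟩ | ⟨rfl, rfl⟩
        · rw [h, Fin.rev_rev]
        · exact h3
      · rw [Matrix.add_apply, e1, e2, zero_add]
        exact one_ne_zero
    refine ⟨?_, ?_, ?_⟩
    · rw [Matrix.transpose_add, hS.symm, simpleMat_symm]
    · intro x y h4 h5
      by_cases hb : blk i x < blk i y.rev
      · rw [Matrix.add_apply, simpleMat_of_blk_lt hb, add_zero]
        exact hS.ne_zero _ _ h4 ((hiff x y hb).2 h5)
      · exact (hE x y h4 hb).2
    · intro x y hxy
      by_cases hb : blk i x < blk i y.rev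
      · rw [Matrix.add_apply, simpleMat_of_blk_lt hb, add_zero]
        exact hS.eq_zero _ _ fun e => hxy ⟨e.1, (hiff x y hb).1 e.2⟩
      · by_cases hlt : x < y.rev
        · exact absurd ⟨hlt, (hE x y hlt hb).1⟩ hxy
        · rw [Matrix.add_apply, simpleMat_of_not_lt hlt, add_zero]
          exact hS.eq_zero _ _ fun e => hlt e.1
  · rw [Units.val_one, congr_one, cut_eq_cut_iff]
    intro x y hb
    rw [Matrix.add_apply, simpleMat_of_blk_lt hb, add_zero]

/-- On rows and columns `p`, `q` type `σ s` is a hyperbolic plane and type `σ` is a diagonal form of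
rank two. Over `ℂ` these are congruent, by two root elements of the parabolic. -/
theorem raise_of_apply_eq_rev (hσ : RevComm σ) (hin : i.val + 1 < n)
    (h : σ (pos i) = (pos i).rev) (h' : σ (nxt i) = (nxt i).rev)
    (hc : simplePerm i * σ = σ * simplePerm i) (hS : IsType (lower i σ) S) :
    ∃ g ∈ parab (blk i), ∃ T, IsType σ T ∧ cut (blk i) (congr (g : Mat n) S) = cut (blk i) T := by
  have e : lower i σ = σ * simplePerm i := if_pos hc
  rw [e] at hS
  have hsp : (σ * simplePerm i) (pos i) = (nxt i).rev := by
    rw [Equiv.Perm.mul_apply, simplePerm_pos, h']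
  have hsq : (σ * simplePerm i) (nxt i) = (pos i).rev := by
    rw [Equiv.Perm.mul_apply, simplePerm_nxt, h]
  have hrc := hσ.mul (simplePerm_revComm i)
  have hspr : (σ * simplePerm i) (pos i).rev = nxt i := by rw [hrc, hsp, Fin.rev_rev]
  have hsqr : (σ * simplePerm i) (nxt i).rev = pos i := by rw [hrc, hsq, Fin.rev_rev]
  have hoth : ∀ x, x ≠ pos i → x ≠ nxt i → x ≠ (pos i).rev → x ≠ (nxt i).rev →
      (σ * simplePerm i) x = σ x := by
    intro x h1 h2 h3 h4
    rw [Equiv.Perm.mul_apply, simplePerm_apply, if_neg h1, if_neg h2, if_neg h3, if_neg h4]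
  have hpr : σ (pos i).rev = pos i := by rw [hσ, h, Fin.rev_rev]
  have hqr : σ (nxt i).rev = nxt i := by rw [hσ, h', Fin.rev_rev]
  revert hsp hsq hspr hsqr hoth hpr hqr h h' hS
  have hnep := nxt_ne_pos i
  have hmem1 := rootElt_nxt_mem_parab i 1
  have hmem2 : rootElt (pos_ne_nxt i) (-1 / 2) ∈ parab (blk i) :=
    rootElt_mem_parab (isFlag_blk i) _ ((isFlag_blk i).mono (pos_lt_nxt i).le) _
  have hlt1 := pos_lt_nxt i
  have hlt2 : nxt i < (nxt i).rev := by
    rw [Fin.lt_def, Fin.val_rev, val_nxt]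
    omega
  have hblkiff : ∀ x y, blk i x < blk i y.rev ↔ x < y.rev ∧ ¬ (x = pos i ∧ y = (nxt i).rev) ∧
      ¬ (x = (nxt i).rev ∧ y = pos i) := fun x y => blk_lt_iff
  generalize σ * simplePerm i = π
  revert hnep hmem1 hmem2 hlt1 hlt2 hblkiff
  generalize_proofs hne1 hne2
  revert hne1 hne2
  generalize pos i = p
  generalize nxt i = q
  intro hne1 hne2 hnep hmem1 hmem2 hlt1 hlt2 hblkiff h h' hS hsp hsq hspr hsqr hoth hpr hqr
  have hlt3 : q.rev < p.rev := Fin.rev_lt_rev.2 hlt1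
  have hrow : ∀ x b, π x < x → S x b = 0 := fun x b hx =>
    hS.eq_zero_left fun e hlt => by rw [← e] at hlt; exact lt_asymm hlt hx
  have hrow_pr : ∀ b, S p.rev b = 0 := fun b =>
    hrow _ b (by rw [hspr]; exact hlt2.trans hlt3)
  have hrow_qr : ∀ b, S q.rev b = 0 := fun b =>
    hrow _ b (by rw [hsqr]; exact hlt1.trans hlt2)
  have hSp : ∀ b, b ≠ q → S p b = 0 := fun b hb =>
    hS.eq_zero_left fun e => by
      rw [hsp] at e
      exact absurd (Fin.rev_injective e).symm hb
  have hSq : ∀ b, b ≠ p → S q b = 0 := fun b hb =>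
    hS.eq_zero_left fun e => by
      rw [hsq] at e
      exact absurd (Fin.rev_injective e).symm hb
  have hm : S p q ≠ 0 := hS.ne_zero _ _ (hlt1.trans hlt2) hsp
  set m := S p q with hmdef
  have hmq : S q p = m := hS.transpose_eq q p
  -- Adding `q` to `p` turns the block `(0, m; m, 0)` into `(2m, m; m, 0)`. Subtracting half of `p`
  -- from `q` then gives `diag(2m, -m/2)`.
  set M := congr (rootElt hne1 1 : Mat n) S with hM
  have hMsymm : Mᵀ = M := congr_symm _ hS.symm
  have hMval : ∀ a b, blk i a < blk i b.rev →
      M a b = S a b + ((if b = p then S a q else 0) + if a = p then S q b else 0) := by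
    intro a b hab
    rw [hblkiff] at hab
    rw [hM, congr_rootElt_apply hne1 1 S (fun _ => hrow_pr b)
      (fun _ => by rw [hS.transpose_eq, hrow_pr]) (fun _ _ => hSq q hnep)
      (fun _ _ => hrow_pr _) hab.2.1 fun e => hab.2.2 e, one_mul]
  have hcol_qr : ∀ b, blk i q.rev < blk i b.rev → M q.rev b = 0 := by
    intro b hb
    rw [hMval _ _ hb, hrow_qr, hrow_qr, ite_self, if_neg (hlt1.trans hlt2).ne']
    simp
  have hval : ∀ a b, blk i a < blk i b.rev → congr (rootElt hne2 (-1 / 2) : Mat n) M a b =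
      M a b + -1 / 2 * ((if b = q then M a p else 0) + if a = q then M p b else 0) +
        -1 / 2 * (-1 / 2) * (if a = q then if b = q then M p p else 0 else 0) := by
    intro a b hab
    have hab' := (hblkiff _ _).1 hab
    have hba : blk i b < blk i a.rev := by
      rw [hblkiff]
      exact ⟨lt_rev_comm hab'.1, fun e => hab'.2.2 ⟨e.2, e.1⟩, fun e => hab'.2.1 ⟨e.2, e.1⟩⟩
    have hmono : ∀ c, blk i p.rev < c → blk i q.rev < c := fun c hc =>
      ((isFlag_blk i).mono hlt3.le).trans_lt hc
    refine congr_rootElt_apply_sq hne2 _ M ?_ ?_ ?_ ?_ ?_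
    · rintro rfl
      exact hcol_qr b (hmono _ hab)
    · rintro rfl
      have := congrFun (congrFun hMsymm q.rev) a
      rw [Matrix.transpose_apply] at this
      rw [this]
      exact hcol_qr a (hmono _ hba)
    · rintro rfl rfl
      exact absurd hab'.1 (by rw [Fin.rev_rev]; exact ((hlt1.trans hlt2).trans hlt3).not_gt)
    · rintro ⟨rfl, rfl⟩
      have := hab'.1
      rw [Fin.rev_rev] at this
      exact lt_asymm this hlt1
    · rintro ⟨rfl, rfl⟩
      exact lt_asymm hab'.1 hlt3
  refine ⟨_, mul_mem hmem1 hmem2, cut (blk i) (congr (rootElt hne2 (-1 / 2) : Mat n) M), ?_, ?_⟩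
  swap
  · rw [cut_cut, Units.val_mul, congr_mul]
  have hpp : p < p.rev := (hlt1.trans hlt2).trans hlt3
  have b1 : blk i p < blk i p.rev := by
    rw [hblkiff]
    exact ⟨hpp, fun e => (hlt1.trans hlt2).ne e.2, fun e => (hlt1.trans hlt2).ne e.1⟩
  have b2 : blk i p < blk i q.rev := by
    rw [hblkiff]
    exact ⟨hlt1.trans hlt2, fun e => hlt2.ne e.2, fun e => hnep e.2⟩
  have b3 : blk i q < blk i p.rev := by
    rw [hblkiff]
    exact ⟨hlt2.trans hlt3, fun e => hnep e.1, fun e => hlt2.ne e.1⟩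
  have b4 : blk i q < blk i q.rev := by
    rw [hblkiff]
    exact ⟨hlt2, fun e => hnep e.1, fun e => hnep e.2⟩
  have hMpp : M p p = 2 * m := by
    rw [hMval p p b1, hSp p hnep.symm, if_pos rfl, if_pos rfl, hmq]
    ring
  have hMpq : M p q = m := by
    rw [hMval p q b2, if_neg hnep, if_pos rfl, hSq q hnep]
    ring
  have hMqp : M q p = m := by
    rw [hMval q p b3, if_pos rfl, if_neg hnep, hSq q hnep, hmq]
    ring
  have hMqq : M q q = 0 := by
    rw [hMval q q b4, if_neg hnep, hSq q hnep]
    ring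
  set T := cut (blk i) (congr (rootElt hne2 (-1 / 2) : Mat n) M) with hT
  have hTsymm : Tᵀ = T := by
    have := (adm_cut_add i (congr_symm (rootElt hne2 (-1 / 2) : Mat n) hMsymm) 0).1
    rwa [zero_smul, add_zero] at this
  have hTsymm' : ∀ a b, T a b = T b a := fun a b => (congrFun (congrFun hTsymm b) a)
  have hTval : ∀ a b, blk i a < blk i b.rev → T a b =
      M a b + -1 / 2 * ((if b = q then M a p else 0) + if a = q then M p b else 0) +
        -1 / 2 * (-1 / 2) * (if a = q then if b = q then M p p else 0 else 0) := by
    intro a b hab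
    rw [hT, cut_apply, if_pos hab, hval a b hab]
  have hTpp : T p p = 2 * m := by
    rw [hTval p p b1, hMpp, if_neg hnep.symm, if_neg hnep.symm]
    ring
  have hTpq : T p q = 0 := by
    rw [hTval p q b2, hMpp, hMpq, if_pos rfl, if_neg hnep.symm, if_neg hnep.symm]
    ring
  have hTqq : T q q = -m / 2 := by
    rw [hTval q q b4, hMqq, if_pos rfl, if_pos rfl, if_pos rfl, if_pos rfl, hMqp, hMpq, hMpp]
    ring
  have hToth : ∀ a b, a ≠ p → a ≠ q → b ≠ p → b ≠ q → blk i a < blk i b.rev → T a b = S a b := by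
    intro a b h1 h2 h3 h4 hab
    rw [hTval a b hab, hMval a b hab, if_neg h1, if_neg h2, if_neg h3, if_neg h4, if_neg h2]
    ring
  have hTp : ∀ b, b ≠ p → b ≠ q → T p b = 0 := by
    intro b h1 h2
    by_cases hb : blk i p < blk i b.rev
    · rw [hTval p b hb, hMval p b hb, hSp b h2, hSq b h1, if_neg h1, if_neg h2, if_neg hnep.symm,
        if_neg hnep.symm, if_pos rfl]
      ring
    · rw [hT, cut_apply, if_neg hb]
  have hTq : ∀ b, b ≠ p → b ≠ q → T q b = 0 := by
    intro b h1 h2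
    by_cases hb : blk i q < blk i b.rev
    · have hb' : blk i p < blk i b.rev := ((isFlag_blk i).mono hlt1.le).trans_lt hb
      rw [hTval q b hb, hMval q b hb, hMval p b hb', hSp b h2, hSq b h1, if_neg h1, if_neg h2,
        if_neg hnep, if_neg h1, if_pos rfl, if_pos rfl, if_pos rfl, if_neg h2]
      ring
    · rw [hT, cut_apply, if_neg hb]
  have hTne : ∀ a b, a = p ∨ a = q → (T a b ≠ 0 ↔ a < b.rev ∧ σ a = b.rev) := by
    intro a b hab
    rcases hab with rfl | rfl
    · rw [h, Fin.rev_inj]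
      by_cases h1 : b = a
      · rw [h1, hTpp]
        simp [hm, hpp]
      · by_cases h2 : b = q
        · rw [h2, hTpq]
          simp [hnep.symm]
        · rw [hTp b h1 h2]
          simp [Ne.symm h1]
    · rw [h', Fin.rev_inj]
      by_cases h1 : b = p
      · rw [h1, hTsymm', hTpq]
        simp [hnep]
      · by_cases h2 : b = a
        · rw [h2, hTqq]
          simp [hm, hlt2]
        · rw [hTq b h1 h2]
          simp [Ne.symm h2]
  have hmain : ∀ a b, T a b ≠ 0 ↔ a < b.rev ∧ σ a = b.rev := by
    intro a b
    by_cases ha : a = p ∨ a = q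
    · exact hTne a b ha
    by_cases hb : b = p ∨ b = q
    · rw [hTsymm', hTne b a hb]
      have e1 : b < a.rev ↔ a < b.rev := ⟨lt_rev_comm, lt_rev_comm⟩
      rw [e1]
      have e2 : σ b = b.rev := by rcases hb with rfl | rfl <;> assumption
      rw [e2, Fin.rev_inj]
      constructor
      · rintro ⟨-, rfl⟩
        exact absurd hb ha
      · rintro ⟨-, h2⟩
        exfalso
        apply ha
        have e3 : σ b.rev = b := by rw [hσ, e2, Fin.rev_rev]
        rcases hb with rfl | rfl
        · left
          rw [← h] at h2
          exact σ.injective h2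
        · right
          rw [← h'] at h2
          exact σ.injective h2
    push Not at ha hb
    by_cases hab : blk i a < blk i b.rev
    · rw [hToth a b ha.1 ha.2 hb.1 hb.2 hab]
      have hlt := ((hblkiff _ _).1 hab).1
      by_cases h1 : a = p.rev
      · have e1 : S a b = 0 := by rw [h1, hrow_pr]
        have e2 : ¬ σ a = b.rev := fun e => by
          rw [← e, h1, hpr] at hlt
          exact lt_asymm hlt hpp
        simp [e1, e2]
      by_cases h2 : a = q.rev
      · have e1 : S a b = 0 := by rw [h2, hrow_qr]
        have e2 : ¬ σ a = b.rev := fun e => by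
          rw [← e, h2, hqr] at hlt
          exact lt_asymm hlt hlt2
        simp [e1, e2]
      rw [← hoth a ha.1 ha.2 h1 h2]
      constructor
      · intro hs
        refine ⟨hlt, ?_⟩
        by_contra hc
        exact hs (hS.eq_zero _ _ fun e => hc e.2)
      · rintro ⟨-, hs⟩
        exact hS.ne_zero _ _ hlt hs
    · have hlt : ¬ a < b.rev := fun hlt => hab <| by
        rw [hblkiff]
        exact ⟨hlt, fun e => ha.1 e.1, fun e => hb.1 e.2⟩
      rw [hT, cut_apply, if_neg hab]
      simp [hlt]
  exact ⟨hTsymm, fun x y h1 h2 => (hmain x y).2 ⟨h1, h2⟩,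
    fun x y hxy => by_contra fun h => hxy ((hmain x y).1 h)⟩

theorem IsType.raise (hσ : RevComm σ) (hinv : ∀ a, σ (σ a) = a) (hd : Desc σ i)
    (hS : IsType (lower i σ) S) :
    ∃ g ∈ parab (blk i), ∃ T, IsType σ T ∧ cut (blk i) (congr (g : Mat n) S) = cut (blk i) T := by
  by_cases hc : simplePerm i * σ = σ * simplePerm i
  · rcases cases_of_commute hd hc with h | ⟨h1, h2, h3⟩
    · exact raise_of_apply_pos hσ hinv h hS
    · exact raise_of_apply_eq_rev hσ h1 h2 h3 hc hS
  · exact raise_of_not_commute hσ hinv hc hS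

end Raise

/-! ### Degenerations -/

theorem exists_isType {n : ℕ} {π : Perm (Fin (2 * n))} (hπ : RevComm π)
    (hinv : ∀ a, π (π a) = a) : ∃ S : Mat n, IsType π S := by
  refine ⟨Matrix.of fun x y => if x < y.rev ∧ π x = y.rev then 1 else 0, ?_, ?_, ?_⟩
  · ext x y
    simp only [Matrix.transpose_apply, Matrix.of_apply]
    congr 1
    rw [eq_iff_iff]
    have e : ∀ x y, y < x.rev ∧ π y = x.rev → x < y.rev ∧ π x = y.rev := fun x y h =>
      ⟨lt_rev_comm h.1, by rw [← hinv y, h.2, hπ, Fin.rev_rev]⟩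
    exact ⟨e x y, e y x⟩
  · intro x y h1 h2
    change (if _ then (1 : ℂ) else 0) ≠ 0
    rw [if_pos ⟨h1, h2⟩]
    exact one_ne_zero
  · intro x y h
    exact if_neg h

theorem IsType.inCl_of_rkLE {n : ℕ} {σ τ : Perm (Fin (2 * n))} (hσ : RevComm σ) (hτ : RevComm τ)
    (hσ' : ∀ a, σ (σ a) = a) (hτ' : ∀ a, τ (τ a) = a) (h : RkLE σ τ) {A S : Mat n}
    (hA : IsType τ A) (hS : IsType σ S) : InCl A S := by
  induction hm : rkSum τ using Nat.strong_induction_on generalizing σ τ A S with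
  | _ m ih =>
    by_cases hd : ∃ i, Desc τ i
    · obtain ⟨i, hd, hlast⟩ := exists_last_desc hτ hd
      have hτl := lower_revComm (i := i) hτ
      have hτl' := lower_lower_apply (i := i) hτ'
      obtain ⟨A', hA'⟩ := exists_isType hτl hτl'
      -- Raising is reversed here: `A'` is recovered from a matrix `B` of type `τ` by `g⁻¹`, so
      -- parabolic stability puts it in the closure of the orbit of `A`.
      obtain ⟨g, hg, B, hB, hgB⟩ := hA'.raise hτ hτ' hd
      have hAB : InCl A B := hA.inCl hτ hτ' hB
      have hAA' : InCl A A' := by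
        refine hA.inCl_parab hτ hτ' hd hlast (inv_mem hg) hAB hB.adm hA'.adm ?_
        rw [← cut_congr_of_cut_eq (isFlag_blk i) (inv_mem hg).2 hgB, ← congr_mul, Units.mul_inv,
          congr_one]
      have hlt : rkSum (lower i τ) < m := by
        rw [← hm]
        exact rkSum_lower_lt hτ hτ' hd
      -- If `i` is a descent of `σ`, the induction hypothesis reaches `lower i σ`, and raising stays
      -- inside the closure. Otherwise `σ` itself lies below `lower i τ`.
      by_cases hd' : Desc σ i
      · have hσl := lower_revComm (i := i) hσ
        have hσl' := lower_lower_apply (i := i) hσ'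
        obtain ⟨S', hS'⟩ := exists_isType hσl hσl'
        have h1 : InCl A S' := hAA'.trans (ih _ hlt hσl hτl hσl' hτl'
          (h.lower_lower hσ hτ hσ' hτ' hd hd') hA' hS' rfl)
        obtain ⟨k, hk, C, hC, hkC⟩ := hS'.raise hσ hσ' hd'
        exact (hA.inCl_parab hτ hτ' hd hlast hk h1 hS'.adm hC.adm hkC.symm).trans
          (hC.inCl hσ hσ' hS)
      · exact hAA'.trans (ih _ hlt hσ hτl hσ' hτl' (h.le_lower hσ hτ hσ' hτ' hd hd') hA' hS rfl)
    · have h1 := eq_one_of_not_desc hτ (not_exists.1 hd)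
      subst h1
      have h2 := h.eq_one
      subst h2
      exact hA.inCl hσ hσ' hS

/-! ### Ranks of corners on orbit closures -/

/-- Row `a` of the corner can be nonzero only if `a < i` and `k ≤ τ a`. -/
theorem rank_le_rk {n : ℕ} {τ : Perm (Fin (2 * n))} {A : Mat n} (hA : IsType τ A) (i k : ℕ) :
    (Matrix.of fun a b : Fin (2 * n) =>
      if a.val < i ∧ k ≤ b.rev.val then A a b else 0).rank ≤ rk τ i k := by
  classical
  set M : Mat n := Matrix.of fun a b : Fin (2 * n) =>
    if a.val < i ∧ k ≤ b.rev.val then A a b else 0 with hM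
  set d : Fin (2 * n) → ℂ := fun a => if a.val < i ∧ k ≤ (τ a).val then 1 else 0 with hd
  have h : M = diagonal d * M := by
    ext a b
    rw [diagonal_mul]
    simp only [hM, hd, Matrix.of_apply]
    by_cases h1 : a.val < i ∧ k ≤ b.rev.val
    · rw [if_pos h1]
      by_cases h2 : τ a = b.rev
      · rw [if_pos (by rwa [h2]), one_mul]
      · rw [hA.eq_zero a b fun e => h2 e.2, mul_zero]
    · rw [if_neg h1, mul_zero]
  rw [h]
  refine (rank_mul_le_left _ _).trans (le_of_eq ?_)
  rw [rank_diagonal, Fintype.card_subtype, rk]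
  congr 1
  ext a
  simp [hd]

/-- An upper-triangular congruence builds an entry only from entries weakly above and to the left,
which stay in the corner. -/
theorem congr_apply_corner {n : ℕ} {g : Mat n} (hg : ∀ a b, b < a → g a b = 0) (A : Mat n)
    {i k : ℕ} {x y : Fin (2 * n)} (hx : x.val < i) (hy : k ≤ y.rev.val) :
    congr g A x y = congr g (Matrix.of fun a b : Fin (2 * n) =>
      if a.val < i ∧ k ≤ b.rev.val then A a b else 0) x y := by
  rw [congr_apply, congr_apply]
  refine Finset.sum_congr rfl fun b _ => Finset.sum_congr rfl fun a _ => ?_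
  rcases lt_or_ge x a with ha | ha
  · rw [hg a x ha, zero_mul, zero_mul, zero_mul, zero_mul]
  rcases lt_or_ge y b with hb | hb
  · rw [hg b y hb, mul_zero, mul_zero]
  have h1 : a.val < i := lt_of_le_of_lt ha hx
  have h2 : k ≤ b.rev.val := hy.trans (Fin.rev_le_rev.2 hb)
  rw [Matrix.of_apply, if_pos ⟨h1, h2⟩]

theorem IsType.rkLE_of_inCl {n : ℕ} {σ τ : Perm (Fin (2 * n))} (hσ : ∀ a, σ (σ a) = a)
    (hτ : ∀ a, τ (τ a) = a) {A S : Mat n} (hA : IsType τ A) (hS : IsType σ S) (h : InCl A S) :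
    RkLE σ τ := by
  refine RkLE.of_involutive (inv_eq_of_apply_apply hσ) (inv_eq_of_apply_apply hτ)
    fun i k hik _ => ?_
  let R := {x : Fin (2 * n) // x.val < i ∧ k ≤ (σ x).val}
  let r : R → Fin (2 * n) := fun x => x.1
  let c : R → Fin (2 * n) := fun x => (σ x.1).rev
  -- This is where `i ≤ k` enters: the whole minor lies in visible positions, so truncation does not
  -- affect it.
  have hvis : ∀ x y : R, r x < (c y).rev := fun x y => by
    change x.1 < (σ y.1).rev.rev
    rw [Fin.rev_rev, Fin.lt_def]
    exact x.2.1.trans_le (hik.trans y.2.2)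
  -- The minor picks the nonzero entries of `S` in the corner, on which `S` is diagonal. Being
  -- nonzero at `S`, it is nonzero somewhere on the orbit, which bounds its size by the corner rank.
  let F : MvPolynomial (Fin (2 * n) × Fin (2 * n)) ℂ :=
    (Matrix.of fun x y : R => MvPolynomial.X (r x, c y)).det
  have hF : ∀ M : Mat n, peval M F = (M.submatrix r c).det := by
    intro M
    unfold peval
    rw [RingHom.map_det]
    congr 1
    ext x y
    simp
  have hdet : peval S F ≠ 0 := by
    rw [hF]
    have hd : S.submatrix r c = diagonal fun x => S (r x) (c x) := by
      ext x y
      rw [submatrix_apply]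
      by_cases hxy : x = y
      · rw [hxy, diagonal_apply_eq]
      · rw [diagonal_apply_ne _ hxy]
        refine hS.eq_zero _ _ fun e => hxy (Subtype.ext (σ.injective ?_))
        rw [e.2]
        exact Fin.rev_rev _
    rw [hd, det_diagonal, Finset.prod_ne_zero_iff]
    exact fun x _ => hS.ne_zero _ _ (hvis x x) (Fin.rev_rev _).symm
  obtain ⟨g, hg, hgF⟩ : ∃ g ∈ borel n, peval (cut Fin.val (congr (g : Mat n) A)) F ≠ 0 := by
    by_contra! hcon
    exact hdet (h F hcon)
  set A' : Mat n := Matrix.of fun a b : Fin (2 * n) =>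
    if a.val < i ∧ k ≤ b.rev.val then A a b else 0 with hA'
  have hsub : (cut Fin.val (congr (g : Mat n) A)).submatrix r c =
      (congr (g : Mat n) A').submatrix r c := by
    ext x y
    rw [submatrix_apply, submatrix_apply, cut_apply, if_pos (Fin.lt_def.1 (hvis x y))]
    refine congr_apply_corner hg.2 A x.2.1 ?_
    change k ≤ (σ y.1).rev.rev.val
    rw [Fin.rev_rev]
    exact y.2.2
  rw [hF, hsub] at hgF
  have hu := rank_of_isUnit _ ((isUnit_iff_isUnit_det _).2 (isUnit_iff_ne_zero.2 hgF))
  have h1 : Fintype.card R = rk σ i k := Fintype.card_subtype _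
  rw [← h1, ← hu]
  calc _ ≤ (congr (g : Mat n) A').rank := rank_submatrix_le _ _ _
    _ ≤ ((g : Mat n)ᵀ * A').rank := rank_mul_le_left _ _
    _ ≤ A'.rank := rank_mul_le_right _ _
    _ ≤ rk τ i k := rank_le_rk hA i k

/-! ### The symmetric matrix of a linear form on the nilradical -/

/-- The extension of a linear form on `𝔫` to all matrices. -/
noncomputable def extend {n : ℕ} (l : Dual ℂ (nil n)) : Mat n →ₗ[ℂ] ℂ :=
  ∑ α, coords l α • Matrix.entryLinearMap ℂ ℂ (entry α).1 (entry α).2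

theorem extend_apply {n : ℕ} (l : Dual ℂ (nil n)) (M : Mat n) :
    extend l M = ∑ α, coords l α * M (entry α).1 (entry α).2 := by
  simp [extend]

theorem extend_of_mem {n : ℕ} (l : Dual ℂ (nil n)) {M : Mat n} (hM : M ∈ nil n) :
    extend l M = l ⟨M, hM⟩ := by
  have : (⟨M, hM⟩ : nil n) = ∑ α, M (entry α).1 (entry α).2 • rootVec α := by
    rw [← sub_eq_zero]
    refine Subtype.ext (eq_zero_of_entry (Subtype.prop _) fun β => ?_)
    rw [Submodule.coe_sub, Matrix.sub_apply, sum_entry, sub_self]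
  rw [this, map_sum, extend_apply]
  refine Finset.sum_congr rfl fun α _ => ?_
  rw [map_smul, smul_eq_mul, mul_comm]
  rfl

/-- The element `(Q + Qᵀ) J` of the symplectic Lie algebra. -/
def sympl {n : ℕ} : Mat n →ₗ[ℂ] Mat n where
  toFun Q := (Q + Qᵀ) * J n
  map_add' P Q := by
    rw [Matrix.transpose_add, ← Matrix.add_mul]
    congr 1
    abel
  map_smul' c Q := by
    rw [Matrix.transpose_smul, ← smul_add, Matrix.smul_mul]
    rfl

theorem sympl_apply {n : ℕ} (Q : Mat n) : sympl Q = (Q + Qᵀ) * J n := rfl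

theorem sympl_transpose {n : ℕ} (Q : Mat n) : sympl Qᵀ = sympl Q := by
  rw [sympl_apply, sympl_apply, Matrix.transpose_transpose, add_comm]

theorem J_transpose {n : ℕ} : (J n)ᵀ = -J n := by
  ext a b
  rw [Matrix.transpose_apply, Matrix.neg_apply, J_apply, J_apply]
  by_cases h : a = b.rev
  · rw [if_pos h, if_pos (by rw [h, Fin.rev_rev]), h, eta_rev, neg_neg]
  · rw [if_neg h, if_neg (fun e => h (by rw [e, Fin.rev_rev])), neg_zero]

theorem sympl_symp {n : ℕ} (Q : Mat n) : (sympl Q)ᵀ * J n + J n * sympl Q = 0 := by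
  rw [sympl_apply, Matrix.transpose_mul, Matrix.transpose_add, Matrix.transpose_transpose,
    J_transpose, add_comm Qᵀ, Matrix.neg_mul, Matrix.neg_mul, Matrix.mul_assoc, neg_add_cancel]

theorem sympl_single {n : ℕ} (x y a b : Fin (2 * n)) :
    sympl (Matrix.single x y 1) a b =
      ((if x = a ∧ y = b.rev then 1 else 0) + if y = a ∧ x = b.rev then 1 else 0) * eta b.rev := by
  have hJ : ∀ c, J n c b = if c = b.rev then eta b.rev else 0 := fun c => by
    rw [J_apply]
    by_cases h : c = b.rev
    · rw [if_pos h, if_pos (by rw [h, Fin.rev_rev]), h]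
    · rw [if_neg h, if_neg (fun e => h (by rw [e, Fin.rev_rev]))]
  rw [sympl_apply, Matrix.mul_apply]
  simp only [hJ, mul_ite, mul_zero]
  rw [Finset.sum_ite_eq' Finset.univ, if_pos (Finset.mem_univ _), Matrix.add_apply,
    Matrix.transpose_apply, Matrix.single_apply, Matrix.single_apply]
  simp only [and_comm]

theorem sympl_single_mem {n : ℕ} {x y : Fin (2 * n)} (h : x < y.rev) :
    sympl (Matrix.single x y 1) ∈ nil n := by
  refine ⟨sympl_symp _, fun a b hab => ?_⟩
  have h' := lt_rev_comm h
  rw [sympl_single, if_neg, if_neg, add_zero, zero_mul]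
  · rintro ⟨rfl, rfl⟩
    rw [Fin.rev_rev] at h'
    exact hab.not_gt h'
  · rintro ⟨rfl, rfl⟩
    rw [Fin.rev_rev] at h
    exact hab.not_gt h

/-- The symmetric matrix of a linear form on `𝔫`. -/
noncomputable def toSym {n : ℕ} (l : Dual ℂ (nil n)) : Mat n :=
  Matrix.of fun x y => extend l (sympl (Matrix.single x y 1))

theorem toSym_apply {n : ℕ} (l : Dual ℂ (nil n)) (x y : Fin (2 * n)) :
    toSym l x y = extend l (sympl (Matrix.single x y 1)) := rfl

theorem toSym_comm {n : ℕ} (l : Dual ℂ (nil n)) (x y : Fin (2 * n)) :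
    toSym l x y = toSym l y x := by
  rw [toSym_apply, toSym_apply, ← sympl_transpose, Matrix.transpose_single]

theorem toSym_eq_zero {n : ℕ} (l : Dual ℂ (nil n)) {x y : Fin (2 * n)} (h : ¬ x < y.rev) :
    toSym l x y = 0 := by
  rw [toSym_apply, extend_apply]
  refine Finset.sum_eq_zero fun α _ => ?_
  have hα := (entry_val α).1
  rw [sympl_single, if_neg, if_neg, add_zero, zero_mul, mul_zero]
  · rintro ⟨h1, h2⟩
    refine h (lt_rev_comm ?_)
    rw [h1, h2, Fin.rev_rev]
    exact hα
  · rintro ⟨h1, h2⟩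
    rw [h1, h2, Fin.rev_rev] at h
    exact h hα

theorem extend_sympl {n : ℕ} (l : Dual ℂ (nil n)) (Q : Mat n) :
    extend l (sympl Q) = ∑ b, ∑ a, Q a b * toSym l a b := by
  have hQ : Q = ∑ b, ∑ a, Q a b • Matrix.single a b (1 : ℂ) := by
    conv_lhs => rw [Matrix.matrix_eq_sum_single Q]
    rw [Finset.sum_comm]
    simp [Matrix.smul_single]
  conv_lhs => rw [hQ]
  simp only [map_sum, map_smul, smul_eq_mul, toSym_apply]

/-- The symplectic relation gives `J h⁻¹ = hᵀ J`, which turns conjugation on the Lie algebra into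
congruence on symmetric matrices. -/
theorem conj_sympl {n : ℕ} {h : GL (Fin (2 * n)) ℂ} (hh : h ∈ Sp n) (Q : Mat n) :
    (h : Mat n) * sympl Q * ((h⁻¹ : GL (Fin (2 * n)) ℂ) : Mat n) =
      sympl ((h : Mat n) * Q * (h : Mat n)ᵀ) := by
  have h1 : (h : Mat n) * ((h⁻¹ : GL (Fin (2 * n)) ℂ) : Mat n) = 1 := h.mul_inv
  have h2 : J n * ((h⁻¹ : GL (Fin (2 * n)) ℂ) : Mat n) = (h : Mat n)ᵀ * J n := by
    have h3 : (h : Mat n)ᵀ * J n * (h : Mat n) = J n := hh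
    conv_lhs => rw [← h3]
    rw [Matrix.mul_assoc, h1, Matrix.mul_one]
  rw [sympl_apply, sympl_apply, Matrix.mul_assoc, Matrix.mul_assoc, h2]
  simp only [Matrix.transpose_mul, Matrix.transpose_transpose, Matrix.mul_add, Matrix.add_mul,
    Matrix.mul_assoc]

theorem toSym_coAd {n : ℕ} (g : borel n) (l : Dual ℂ (nil n)) :
    toSym (coAd n g l) =
      cut Fin.val (congr ((g⁻¹ : borel n) : GL (Fin (2 * n)) ℂ) (toSym l) : Mat n) := by
  ext x y
  rw [cut_apply]
  split_ifs with h
  · have hm := sympl_single_mem h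
    rw [toSym_apply, extend_of_mem _ hm]
    have e : coAd n g l ⟨_, hm⟩ = l (Ad n g⁻¹ ⟨_, hm⟩) := rfl
    rw [e]
    have e2 := extend_of_mem l (Ad n g⁻¹ ⟨_, hm⟩).2
    rw [Subtype.coe_eta] at e2
    rw [← e2]
    have e3 : (Ad n g⁻¹ ⟨_, hm⟩ : nil n).1 = _ := conj_sympl (g⁻¹).2.1 (Matrix.single x y 1)
    rw [e3, extend_sympl, congr_apply]
    refine Finset.sum_congr rfl fun b _ => Finset.sum_congr rfl fun a _ => ?_
    have : ∀ k : Mat n, (k * Matrix.single x y 1 * kᵀ : Mat n) a b = k a x * k b y := fun k => by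
      rw [Matrix.mul_apply, Finset.sum_eq_single y]
      · rw [Matrix.mul_single_apply_same, mul_one, Matrix.transpose_apply]
      · intro c _ hc
        rw [Matrix.mul_single_apply_of_ne _ _ _ _ _ hc, zero_mul]
      · simp
    rw [this]
    ring
  · exact toSym_eq_zero _ h

/-- The scaling factor between the coordinate at `α` and the corresponding matrix entry. -/
def scale {n : ℕ} (α : PosRoot n) : ℂ :=
  (1 + if (entry α).2.rev = (entry α).1 then 1 else 0) * eta (entry α).2.rev

theorem scale_ne_zero {n : ℕ} (α : PosRoot n) : scale α ≠ 0 := by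
  refine mul_ne_zero ?_ (left_ne_zero_of_mul_eq_one (eta_mul_self _))
  split_ifs <;> norm_num

/-- The factor is a sign, doubled for a long root, where the two terms of `sympl` fall on the same
entry. The inequality in `entry_val` prevents any other root from contributing. -/
theorem toSym_entry {n : ℕ} (l : Dual ℂ (nil n)) (α : PosRoot n) :
    toSym l (entry α).1 (entry α).2.rev = scale α * coords l α := by
  rw [toSym_apply, extend_apply, Finset.sum_eq_single α]
  · rw [sympl_single, mul_comm, scale]
    congr 2
    rw [if_pos ⟨rfl, rfl⟩]
    congr 2
    rw [eq_iff_iff]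
    exact ⟨fun h => h.1, fun h => ⟨h, h.symm⟩⟩
  · intro β _ hβ
    have h1 : entry α ≠ entry β := fun e => hβ (entry_injective e).symm
    rw [sympl_single, if_neg, if_neg, add_zero, zero_mul, mul_zero]
    · rintro ⟨h2, h3⟩
      refine h1 (Prod.ext ?_ ?_) <;>
      · have h4 := (entry_val α).2
        have h5 := (entry_val β).2
        have h6 := congrArg Fin.val h2
        have h7 := congrArg Fin.val h3
        rw [Fin.val_rev] at h6 h7
        apply Fin.ext
        omega
    · rintro ⟨h2, h3⟩
      exact h1 (Prod.ext h2 (Fin.rev_injective h3))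
  · simp

theorem coords_form {n : ℕ} (D : Finset (PosRoot n)) (α : PosRoot n) :
    coords (form D) α = if α ∈ D then 1 else 0 := by
  have h : rootVec α = rootBasis n α := (Basis.mk_apply _ _ α).symm
  simp [coords, form, h, Finsupp.single_apply]

theorem isType_toSym {n : ℕ} {π : Perm (Fin (2 * n))} (hπ : RevComm π)
    (hinv : ∀ a, π (π a) = a) : IsType π (toSym (form (suppOf π))) := by
  have key : ∀ x y : Fin (2 * n), x ≤ y → x < y.rev →
      (toSym (form (suppOf π)) x y ≠ 0 ↔ π x = y.rev) := by
    intro x y hxy h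
    obtain ⟨α, hα⟩ := exists_entry h (by
      have := Fin.le_def.1 hxy
      rw [Fin.val_rev]
      omega)
    have := toSym_entry (form (suppOf π)) α
    rw [hα, Fin.rev_rev, coords_form] at this
    rw [this, mul_ne_zero_iff, ite_ne_right_iff, mem_suppOf, hα]
    simp [scale_ne_zero]
  have key2 : ∀ x y : Fin (2 * n), x < y.rev →
      (toSym (form (suppOf π)) x y ≠ 0 ↔ π x = y.rev) := by
    intro x y h
    rcases le_total x y with hxy | hxy
    · exact key x y hxy h
    · rw [toSym_comm, key y x hxy (lt_rev_comm h)]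
      constructor
      · intro e
        rw [← Fin.rev_inj, Fin.rev_rev, ← hπ, ← e, hinv]
      · intro e
        rw [← Fin.rev_inj, Fin.rev_rev, ← hπ, ← e, hinv]
  refine ⟨?_, fun x y h => (key2 x y h).2, fun x y h => ?_⟩
  · ext x y
    exact toSym_comm _ _ _
  · by_cases hxy : x < y.rev
    · by_contra h0
      exact h ⟨hxy, (key2 x y hxy).1 h0⟩
    · exact toSym_eq_zero _ hxy

/-- The coordinates of a form and the entries of its symmetric matrix are linear functions of each
other, so polynomials can be pulled back in both directions. The inverse in `toSym_coAd` is harmless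
because `g` ranges over a group. -/
theorem mem_zariskiClosure_iff {n : ℕ} (τ : weylGroup n) (m : Dual ℂ (nil n)) :
    m ∈ zariskiClosure (orbit τ) ↔ InCl (toSym (form (supp τ))) (toSym m) := by
  have hz : m ∈ zariskiClosure (orbit τ) ↔ ∀ p : MvPolynomial (PosRoot n) ℂ,
      (∀ g : borel n, MvPolynomial.eval (coords (coAd n g (form (supp τ)))) p = 0) →
        MvPolynomial.eval (coords m) p = 0 := by
    change (∀ p : MvPolynomial (PosRoot n) ℂ, (∀ x ∈ coords '' orbit τ,
      MvPolynomial.aeval x p = 0) → MvPolynomial.aeval (coords m) p = 0) ↔ _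
    simp only [orbit, Set.forall_mem_image, Set.forall_mem_range]
    rfl
  rw [hz]
  constructor
  · intro h F hF
    let F' : MvPolynomial (PosRoot n) ℂ := MvPolynomial.bind₁ (fun p => ∑ α,
      MvPolynomial.X α *
        MvPolynomial.C (sympl (Matrix.single p.1 p.2 1) (entry α).1 (entry α).2)) F
    have hF' : ∀ l : Dual ℂ (nil n), MvPolynomial.eval (coords l) F' = peval (toSym l) F := by
      intro l
      unfold peval
      rw [MvPolynomial.eval, MvPolynomial.eval₂Hom_bind₁]
      congr 2
      ext p
      rw [toSym_apply, extend_apply]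
      simp
    rw [← hF']
    refine h F' fun g => ?_
    rw [hF', toSym_coAd]
    exact hF _ (g⁻¹).2
  · intro h p hp
    let F : MvPolynomial (Fin (2 * n) × Fin (2 * n)) ℂ := MvPolynomial.bind₁ (fun α =>
      MvPolynomial.C (scale α)⁻¹ * MvPolynomial.X ((entry α).1, (entry α).2.rev)) p
    have hF : ∀ l : Dual ℂ (nil n), peval (toSym l) F = MvPolynomial.eval (coords l) p := by
      intro l
      unfold peval
      rw [MvPolynomial.eval, MvPolynomial.eval₂Hom_bind₁]
      congr 2
      ext α
      simp [toSym_entry, inv_mul_cancel_left₀ (scale_ne_zero α)]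
    rw [← hF]
    refine h F fun g hg => ?_
    have := toSym_coAd (⟨g, hg⟩⁻¹ : borel n) (form (supp τ))
    rw [inv_inv] at this
    rw [← this, hF]
    exact hp _

end SpOrbit

theorem theorem1p1 (n : ℕ) (σ τ : SpOrbit.weylGroup n) (hσ : σ ^ 2 = 1) (hτ : τ ^ 2 = 1) :
    (∃! D, SpOrbit.IsSupport σ D) ∧ (∃! D, SpOrbit.IsSupport τ D) ∧
      (SpOrbit.orbit σ ⊆ SpOrbit.zariskiClosure (SpOrbit.orbit τ) ↔ SpOrbit.BruhatLE σ τ) := by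
  refine ⟨SpOrbit.existsUnique_isSupport hσ, SpOrbit.existsUnique_isSupport hτ, ?_⟩
  have hσ' := SpOrbit.perm_perm hσ
  have hτ' := SpOrbit.perm_perm hτ
  have tσ := SpOrbit.isType_toSym (SpOrbit.perm_revComm σ) hσ'
  have tτ := SpOrbit.isType_toSym (SpOrbit.perm_revComm τ) hτ'
  rw [← SpOrbit.supp_eq hσ] at tσ
  rw [← SpOrbit.supp_eq hτ] at tτ
  rw [SpOrbit.bruhatLE_iff]
  constructor
  · intro h
    have h1 : SpOrbit.form (SpOrbit.supp σ) ∈ SpOrbit.orbit σ := ⟨1, by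
      change SpOrbit.coAd n 1 _ = _
      rw [map_one]
      rfl⟩
    exact tτ.rkLE_of_inCl hσ' hτ' tσ ((SpOrbit.mem_zariskiClosure_iff _ _).1 (h h1))
  · rintro h _ ⟨g, rfl⟩
    refine (SpOrbit.mem_zariskiClosure_iff _ _).2 ?_
    change SpOrbit.InCl _ (SpOrbit.toSym (SpOrbit.coAd n g _))
    rw [SpOrbit.toSym_coAd]
    exact (SpOrbit.IsType.inCl_of_rkLE (SpOrbit.perm_revComm σ) (SpOrbit.perm_revComm τ)
      hσ' hτ' h tτ tσ).congr (g⁻¹).2
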